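/- **Setting.** Let $\overline{\mathcal H}=(\mathbb C\times\mathbb R)\cup\{\infty\}$ be the CR sphere in Heisenberg coordinates, identified with the null lines of the Hermitian form $\langle v,u\rangle=\bar u^{t}Jv$, $J=\begin{pmatrix}0&0&1\\0&1&0\\1&0&0\end{pmatrix}$, by $(z,t)\mapsto[\tfrac{it-|z|^2}{2},z,1]$, $\infty\mapsto[1,0,0]$; the group $\mathrm{PU}(2,1)$ acts on it (CR transformations). For $P\ne Q$ let $[P,Q]$ be the arc from $P$ to $Q$ of the oriented $\mathbb C$-circle through $P,Q$ (so $[(0,0),\infty]$ is the ray $t\ge 0$), and put $[P^+,Q,R]=\bigcup_{Y\in[Q,R]}[P,Y]$, $[P^-,Q,R]=\bigcup_{Y\in[Q,R]}[Y,P]$. Let $\omega=-\frac12(1+i\sqrt3)$, $P_1=(1,\sqrt3)$, $P_2=(-\omega,\sqrt3)$, $P_3=(0,0)$, $P_4=\infty$. *Model cells.* $\mathfrak T_A$ and $\mathfrak T_B$ are the closed balls bounded by $[P_4^-,P_1,P_2]\cup[P_4^-,P_3,P_1]\cup[P_4^-,P_3,P_2]$ and, as bottom face, $[P_2^-,P_3,P_1]$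 for $\mathfrak T_A$, $[P_3^+,P_1,P_2]$ for $\mathfrak T_B$, on the upper side of the bottom face. With $B'$, $B_k$ the unions of $\{\infty\}$ and of the vertical lines over the rays $1+re^{-i\pi/6}$ and $-\omega+re^{i\pi(1-2k)/6}$ ($r\ge0$), the slab $\mathfrak S_k$ is the closed ball bounded by $[P_4^+,P_1,P_2]\cup[P_4^-,P_1,P_2]\cup B'\cup B_k$ that has $(3/2,\sqrt3)$ in its interior. Let $$G_1=\begin{bmatrix}-\omega&0&0\\1&1&0\\-\bar\omega&\omega&-\omega\end{bmatrix},\ G_2=\begin{bmatrix}1&1&\omega\\0&-\bar\omega&\bar\omega\\0&0&1\end{bmatrix},\ G_3=\begin{bmatrix}1&0&0\\0&-\omega&0\\0&0&1\end{bmatrix},\ G_4=\begin{bmatrix}0&0&-\omega\\0&-\bar\omega&0\\-\omega&0&1-\bar\omega\end{bmatrix}\in \mathrm{PU}(2,1).$$ *The decomposition $\mathcal D_f$ and its realisation.* Let $f\in \mathrm{SL}(2,\mathbb Z)$ have two distinct positive real eigenvalues, and let $w=w_0\cdots w_{m-1}$, $w_j\in\{\mathcal R,\mathcal L\}$, be a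 flip sequence of $f$, that is, $f$ is conjugate in $\mathrm{SL}(2,\mathbb Z)$ to the product in this order of the matrices $\begin{pmatrix}1&1\\0&1\end{pmatrix}$ (for $\mathcal R$) and $\begin{pmatrix}1&0\\1&1\end{pmatrix}$ (for $\mathcal L$). Indices are taken modulo $m$. The decomposition $\mathcal D_f$ of the once-punctured torus bundle $M_f$ has one ideal tetrahedron $\hat\sigma_j$ for each $j$ (written $\hat\sigma_j^{\mathcal L}$ or $\hat\sigma_j^{\mathcal R}$ according to $w_j$), realised as $\mathfrak T_B$ if $w_{j-1}=\mathcal R$ and as $\mathfrak T_A$ if $w_{j-1}=\mathcal L$, with vertices $1,2,3,4$ at $P_1,P_2,P_3,P_4$; and one slab $\hat\sigma^S_j$ for each $j$ with $w_j=\mathcal R$, realised as $\mathfrak S_k$, where $k$ is the number of letters $\mathcal L$ between the preceding $\mathcal R$ and $w_j$, with vertices $1,2,4$ at $P_1,P_2,P_4$. All vertices are removed. The face pairings are, for $w_j=\mathcal L$: $\hat\sigma_j(134)\to\hat\sigma_{j+1}(132)$ by $G_1$ and $\hat\sigma_j(124)\to\hat\sigma_{j+1}(324)$ by $G_2$; for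 $w_j=\mathcal R$: $\hat\sigma_j(134)\to\hat\sigma_{j+1}(234)$ by $G_3$, $\hat\sigma_j(124)\to\hat\sigma_j^S$ by the identity on $[P_4^-,P_1,P_2]$, and $\hat\sigma^S_j\to\hat\sigma_{j+1}(123)$ by $G_4$ on $[P_4^+,P_1,P_2]$; and for each cyclic subword $\mathcal R\mathcal L^n\mathcal R$ of $w$ beginning at index $j$: the bigon $B'$ of $\hat\sigma_j^S$ to the bigon $B_n$ of $\hat\sigma_{j+n+1}^S$ by $G_2^nG_3$. Let $\hat\pi$ be the quotient map from the disjoint union of the cells to the glued space $M_f$. The valence of an edge $e$ of $\mathcal D_f$ is the number of edges of the $3$-cells that $\hat\pi$ maps onto $e$. *Ramification.* A developing map on an open set $U\subset M_f$ is a map $\varphi:U\to\overline{\mathcal H}$ that on each realised cell is locally a CR transformation, such that the CR transformations $g,g'$ giving $\varphi$ near two points matched by a face pairing realised by $G$ satisfy $g=g'\circ G$. A branched CR chart of ramification order $N\ge1$ at $x$ is a developing map $\varphi$ on an open neighbourhood $U$ of $x$ together with a homeomorphism $\psi$ from $U$ onto an open subset of $\mathbb C\times\mathbb R$, with $\psi(x)$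 on the axis $z=0$, such that $\varphi=\xi_N\circ\psi$, where $\xi_N(z,t)=(z^N,t)$. The ramification order at $x$ is $N$ if there is such a chart of order $N$ at $x$ and every branched CR chart at $x$ has order $N$. **Lemma.** Let $w_j=\mathcal L$, let $e_j=\hat\pi(\hat\sigma_j^{\mathcal L}(14))$ be the (open) edge of $\mathcal D_f$ represented by the edge $(14)$ of $\hat\sigma_j^{\mathcal L}$, and let $3n_j+4$ be its valence in $\mathcal D_f$. Then the ramification order of the branched CR structure around $e_j$, i.e. at every point of $e_j$, is $n_j+1$. -/

import Mathlib

open scoped Matrix Topology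

noncomputable section

namespace CRBundle

/-! ### The CR sphere in the Heisenberg model -/

/-- The Heisenberg model of the CR sphere: the one-point compactification of `ℂ × ℝ`. -/
abbrev Hbar : Type := OnePoint (ℂ × ℝ)

/-- The point of the CR sphere with Heisenberg coordinates `(z, t)`. -/
def pt (z : ℂ) (t : ℝ) : Hbar := ((z, t) : ℂ × ℝ)

/-- The matrix of the Hermitian form of signature `(2,1)`. -/
def J : Matrix (Fin 3) (Fin 3) ℂ := !![0, 0, 1; 0, 1, 0; 1, 0, 0]

/-- The Hermitian form `⟨v, u⟩ = ū ᵗ J v`. -/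
def herm (v u : Fin 3 → ℂ) : ℂ := star u ⬝ᵥ (J *ᵥ v)

/-- The standard null vector over a point of the CR sphere (the inverse of stereographic
projection). -/
def lift : Hbar → (Fin 3 → ℂ)
  | none => ![1, 0, 0]
  | some P => ![(Complex.I * P.2 - (‖P.1‖ : ℂ) ^ 2) / 2, P.1, 1]

open Classical in
/-- Stereographic projection, in homogeneous coordinates: on null vectors it is
`[x, y, 1] ↦ (y, (2 x + |y|²) / i)` and `[1, 0, 0] ↦ ∞`. -/
def stereo (v : Fin 3 → ℂ) : Hbar :=
  if v 2 = 0 then OnePoint.infty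
  else pt (v 1 / v 2) (((2 * (v 0 / v 2) + (‖v 1 / v 2‖ : ℂ) ^ 2) / Complex.I).re)

/-- The map of the CR sphere induced by a `3 × 3` matrix. -/
def crMap (A : Matrix (Fin 3) (Fin 3) ℂ) (P : Hbar) : Hbar := stereo (A *ᵥ lift P)

/-- CR transformations: the maps of the CR sphere induced by elements of `U(2,1)`, in other
words the elements of `PU(2,1)` regarded as transformations. -/
def IsCR (F : Hbar → Hbar) : Prop :=
  ∃ A : Matrix (Fin 3) (Fin 3) ℂ, Aᴴ * J * A = J ∧ F = crMap A

/-! ### Edges, marked triangles, tetrahedra, slabs -/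

/-- The oriented edge `[P, Q]` (endpoints included): the arc from `P` to `Q` of the oriented
`ℂ`-circle through `P` and `Q`. With `p`, `q` null vectors over `P`, `Q`, the points other than
`Q` of the `ℂ`-circle are the classes of the null vectors `p + l q`, that is, those with
`l̄ ⟨p, q⟩` purely imaginary, and the orientation selects the arc on which `l̄ ⟨p, q⟩ ∈ -i ℝ≥0`.
For instance `[(0,0), ∞]` is the ascending vertical ray `t ≥ 0`, with `∞`. -/
def edge (P Q : Hbar) : Set Hbar :=
  {X | X = Q ∨ ∃ (l : ℂ) (s : ℝ), 0 ≤ s ∧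
    star l * herm (lift P) (lift Q) = -Complex.I * s ∧ X = stereo (lift P + l • lift Q)}

/-- The marked triangle `[P⁺, Q, R]`, foliated by the edges from `P` to the points of `[Q, R]`. -/
def triPlus (P Q R : Hbar) : Set Hbar := {X | ∃ Y ∈ edge Q R, X ∈ edge P Y}

/-- The marked triangle `[P⁻, Q, R]`, foliated by the edges from the points of `[Q, R]` to `P`. -/
def triMinus (P Q R : Hbar) : Set Hbar := {X | ∃ Y ∈ edge Q R, X ∈ edge Y P}

/-- The cube root of unity `ω = -(1 + i √3) / 2`. -/
def om : ℂ := -((1 + Complex.I * (Real.sqrt 3 : ℂ)) / 2)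

def P1 : Hbar := pt 1 (Real.sqrt 3)
def P2 : Hbar := pt (-om) (Real.sqrt 3)
def P3 : Hbar := pt 0 0
def P4 : Hbar := OnePoint.infty

/-- The closed ball whose boundary sphere consists of a bottom triangle `F` with vertices `P1`,
`P2`, `P3` and of the three vertical walls `[P4⁻, P1, P2]`, `[P4⁻, P3, P1]`, `[P4⁻, P3, P2]` of
ascending rays over the sides of `F`, on its upper side: as `F` projects injectively to the
`z`-plane, it is the union of the ascending rays from the points of `F` to `P4 = ∞`. -/
def ballOver (F : Set Hbar) : Set Hbar := {X | ∃ Y ∈ F, X ∈ edge Y P4}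

/-- The standard symmetric tetrahedron of type `A`, with bottom face `[P2⁻, P3, P1]`. -/
def tetA : Set Hbar := ballOver (triMinus P2 P3 P1)

/-- The standard symmetric tetrahedron of type `B`, with bottom face `[P3⁺, P1, P2]`. -/
def tetB : Set Hbar := ballOver (triPlus P3 P1 P2)

/-- The closed bigon `B'` bounded by the edges `[P1, P4]` and `[P4, P1]`: the vertical
lines over the ray `1 + r e^{-iπ/6}`, and `∞`. -/
def bigonB : Set Hbar :=
  {X | X = P4 ∨ ∃ r s : ℝ, 0 ≤ r ∧
    X = pt (1 + r * Complex.exp (-(Real.pi / 6 : ℝ) * Complex.I)) s}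

/-- The `z`-projection of the slab of index `k`. The plane curve formed by the ray
`1 + r e^{-iπ/6}`, the shortest arc of the unit circle from `1` to `-ω = e^{iπ/3}` and the ray
`-ω + r e^{iπ(1 - 2k)/6}` cuts the plane into two regions; this is the closed region on the outer
side of the arc. It consists of the half-strip swept by the arc in the direction `e^{-iπ/6}`, which
ends at the ray from `-ω` in the direction `e^{-iπ/6}`, and of the sector at `-ω` swept
anticlockwise from that ray to the ray in the direction `e^{iπ(1 - 2k)/6}`. -/
def slabBase (k : ℤ) : Set ℂ :=
  {z | ∃ th r : ℝ, 0 ≤ th ∧ th ≤ Real.pi / 3 ∧ 0 ≤ r ∧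
      z = Complex.exp (th * Complex.I) + r * Complex.exp (-(Real.pi / 6 : ℝ) * Complex.I)} ∪
  {z | ∃ th r : ℝ, -(Real.pi / 6) ≤ th ∧
      th ≤ -(Real.pi / 6) + Real.pi / 3 * (((1 - k) % 6 : ℤ) : ℝ) ∧ 0 ≤ r ∧
      z = -om + r * Complex.exp (th * Complex.I)}

/-- The slab of index `k`: the closed ball bounded by the triangles `[P4⁺, P1, P2]` and
`[P4⁻, P1, P2]` (together the vertical cylinder over the arc), the bigon `B'` over the ray from `1`,
and the bigon `B_k` over the ray `-ω + r e^{iπ(1 - 2k)/6}`. -/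
def slab (k : ℤ) : Set Hbar := {X | X = P4 ∨ ∃ z ∈ slabBase k, ∃ t : ℝ, X = pt z t}

/-! ### The face pairings of the model cells -/

def G1 : Matrix (Fin 3) (Fin 3) ℂ := !![-om, 0, 0; 1, 1, 0; -star om, om, -om]
def G2 : Matrix (Fin 3) (Fin 3) ℂ := !![1, 1, om; 0, -star om, star om; 0, 0, 1]
def G3 : Matrix (Fin 3) (Fin 3) ℂ := !![1, 0, 0; 0, -om, 0; 0, 0, 1]
def G4 : Matrix (Fin 3) (Fin 3) ℂ := !![0, 0, -om; 0, -star om, 0; -om, 0, 1 - star om]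

/-! ### Monodromies and flip sequences -/

/-- The two types of flips, right and left. -/
inductive Flip
  | R
  | L

/-- The element of the mapping class group `SL(2, ℤ)` of a right or left flip. -/
def Flip.mat : Flip → Matrix.SpecialLinearGroup (Fin 2) ℤ
  | Flip.R => ⟨!![1, 1; 0, 1], by simp [Matrix.det_fin_two]⟩
  | Flip.L => ⟨!![1, 0; 1, 1], by simp [Matrix.det_fin_two]⟩

def HasDistinctPositiveEigenvalues (f : Matrix.SpecialLinearGroup (Fin 2) ℤ) : Prop :=
  ∃ a b : ℝ, 0 < a ∧ 0 < b ∧ a ≠ b ∧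
    ((f : Matrix (Fin 2) (Fin 2) ℤ).map (Int.cast : ℤ → ℝ)).charpoly.IsRoot a ∧
    ((f : Matrix (Fin 2) (Fin 2) ℤ).map (Int.cast : ℤ → ℝ)).charpoly.IsRoot b

/-- `w = w₀ w₁ ⋯ w_{m-1}` (a cyclic word with a starting point) is a flip sequence of `f`: up to
conjugation, `f` is the product of the flips of the word, read from left to right. -/
def IsFlipSequence (f : Matrix.SpecialLinearGroup (Fin 2) ℤ) {m : ℕ} (w : ZMod m → Flip) : Prop :=
  ∃ c : Matrix.SpecialLinearGroup (Fin 2) ℤ,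
    c * f * c⁻¹ = (List.ofFn fun i : Fin m => (w (i.val : ZMod m)).mat).prod

/-! ### The ideal cell decomposition and its geometric realisation

The `j`-th tetrahedron of the monodromy triangulation has type `w j`: the next tetrahedron is layered
on it by the flip `w j`. -/

variable {m : ℕ}

/-- The `3`-cells of the decomposition: a tetrahedron for every letter of the word, and a slab for
every letter `R`. -/
inductive Cell (w : ZMod m → Flip)
  | tet (j : ZMod m)
  | slab (j : ZMod m) (h : w j = Flip.R)

/-- For the slab of a letter `R` at `j`: the number `k` of letters `L` between the preceding letter
`R` and `j`; so `k + 4` is the valence of the edge `(24)` of that slab. -/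
def lRun (w : ZMod m → Flip) (j : ZMod m) : ℕ :=
  sInf {k : ℕ | w (j - ((k + 1 : ℕ) : ZMod m)) = Flip.R}

/-- The geometric realisation of a cell. A tetrahedron layered on one of type `R` is realised by the
standard tetrahedron of type `B`, one layered on a tetrahedron of type `L` by that of type `A`,
and in both cases the vertices `1, 2, 3, 4` by `P1, P2, P3, P4`. A slab is realised by the slab of
index `lRun w j`, its vertices `1, 2, 4` by `P1, P2, P4`. -/
def Cell.body {w : ZMod m → Flip} : Cell w → Set Hbar
  | .tet j => match w (j - 1) with
    | Flip.R => tetB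
    | Flip.L => tetA
  | .slab j _ => CRBundle.slab (lRun w j)

/-- The vertices of a realised cell. They are ideal, that is, removed. -/
def Cell.vertices {w : ZMod m → Flip} : Cell w → Set Hbar
  | .tet _ => {P1, P2, P3, P4}
  | .slab _ _ => {P1, P2, P4}

/-- The `1`-cells of a realised cell: for a tetrahedron `(12), (13), (14), (23), (24), (34)`, for a
slab `(12), (14), (24), (41), (42)`. -/
def Cell.edges {w : ZMod m → Flip} : Cell w → Set (Set Hbar)
  | .tet _ => {edge P1 P2, edge P3 P1, edge P1 P4, edge P3 P2, edge P2 P4, edge P3 P4}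
  | .slab _ _ => {edge P1 P2, edge P1 P4, edge P2 P4, edge P4 P1, edge P4 P2}

/-- `FacePairing w c d F G`: there is a face pairing from the face of the cell `c` realised by `F` to
a face of the cell `d`, realised by the CR transformation `G` (so the latter face is `G '' F`). -/
inductive FacePairing (w : ZMod m → Flip) :
    Cell w → Cell w → Set Hbar → (Hbar → Hbar) → Prop
  /-- left layering, `(134) → (132)` -/
  | l134 (j : ZMod m) (h : w j = Flip.L) :
      FacePairing w (.tet j) (.tet (j + 1)) (triMinus P4 P3 P1) (crMap G1)
  /-- left layering, `(124) → (324)` -/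
  | l124 (j : ZMod m) (h : w j = Flip.L) :
      FacePairing w (.tet j) (.tet (j + 1)) (triMinus P4 P1 P2) (crMap G2)
  /-- right layering, `(134) → (234)` -/
  | r134 (j : ZMod m) (h : w j = Flip.R) :
      FacePairing w (.tet j) (.tet (j + 1)) (triMinus P4 P3 P1) (crMap G3)
  /-- from the face `(124)` of a tetrahedron to the slab lying on it -/
  | r124 (j : ZMod m) (h : w j = Flip.R) :
      FacePairing w (.tet j) (.slab j h) (triMinus P4 P1 P2) (crMap 1)
  /-- right layering, from the other triangle of the slab to the face `(123)` -/
  | s124 (j : ZMod m) (h : w j = Flip.R) :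
      FacePairing w (.slab j h) (.tet (j + 1)) (triPlus P4 P1 P2) (crMap G4)
  /-- for a subword `R Lⁿ R`, from the bigon `(14), (41)` of the slab of the first `R` to the bigon
  `(24), (42)` of the slab of the last -/
  | bigon (j : ZMod m) (n : ℕ) (h : w j = Flip.R)
      (hL : ∀ k : ℕ, 1 ≤ k → k ≤ n → w (j + (k : ZMod m)) = Flip.L)
      (hR : w (j + ((n + 1 : ℕ) : ZMod m)) = Flip.R) :
      FacePairing w (.slab j h) (.slab (j + ((n + 1 : ℕ) : ZMod m)) hR) bigonB
        (crMap (G2 ^ n * G3))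

/-- The disjoint union of the realised ideal cells. -/
abbrev Pts (w : ZMod m → Flip) : Type :=
  Σ c : Cell w, {P : Hbar // P ∈ c.body ∧ P ∉ c.vertices}

/-- Two points of the disjoint union are matched by a face pairing. -/
def Glue (w : ZMod m → Flip) (p q : Pts w) : Prop :=
  ∃ F G, FacePairing w p.1 q.1 F G ∧ p.2.1 ∈ F ∧ q.2.1 = G p.2.1

/-- The punctured torus bundle as the space of its ideal cell decomposition: the topological quotient
of the disjoint union of the ideal cells by the face pairings. -/
abbrev Space (w : ZMod m → Flip) : Type := Quot (Glue w)

/-- The quotient map. -/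
def proj (w : ZMod m → Flip) (p : Pts w) : Space w := Quot.mk _ p

/-- The image in the quotient of the part `E` (an edge, say) of the cell `c`. -/
def imageOf (w : ZMod m → Flip) (c : Cell w) (E : Set Hbar) : Set (Space w) :=
  {x | ∃ p : Pts w, p.1 = c ∧ p.2.1 ∈ E ∧ proj w p = x}

/-- The valence of an edge `e` of the decomposition: the number of `1`-cells of the `3`-cells that the
quotient map sends onto `e`. -/
def valence (w : ZMod m → Flip) (e : Set (Space w)) : ℕ :=
  Set.ncard {a : Cell w × Set Hbar | a.2 ∈ a.1.edges ∧ imageOf w a.1 a.2 = e}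

/-! ### The branched CR structure and its ramification orders -/

/-- `φ` is, on `U`, a developing map of the structure defined by the realised cells and face pairings:
on the cells it is locally given by CR transformations (`g p` near the point `p`), and at two points
matched by a face pairing these differ exactly by the CR transformation of that face pairing. -/
def IsDeveloping (w : ZMod m → Flip) (U : Set (Space w)) (φ : Space w → Hbar) : Prop :=
  ∃ g : Pts w → Hbar → Hbar,
    (∀ p, proj w p ∈ U → IsCR (g p)) ∧
    (∀ p, proj w p ∈ U → ∀ᶠ p' in 𝓝 p, g p' = g p) ∧
    (∀ p q, proj w p ∈ U → ∀ F G, FacePairing w p.1 q.1 F G → p.2.1 ∈ F → q.2.1 = G p.2.1 →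
      g p = g q ∘ G) ∧
    (∀ p, proj w p ∈ U → φ (proj w p) = g p p.2.1)

/-- There is a branched CR chart of ramification order `N` at `x`: an open neighbourhood `U` of `x`
with a developing map `φ` on it that is the standard CR branching map `(z, t) ↦ (z ^ N, t)` after a
homeomorphism `ψ` of `U` onto an open subset of `ℂ × ℝ` which puts `x` on the axis `z = 0`. -/
def HasBranchedChart (w : ZMod m → Flip) (x : Space w) (N : ℕ) : Prop :=
  0 < N ∧ ∃ (U : Set (Space w)) (φ : Space w → Hbar) (ψ : Space w → ℂ × ℝ),
    IsOpen U ∧ x ∈ U ∧ IsDeveloping w U φ ∧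
    Topology.IsOpenEmbedding (U.domRestrict ψ) ∧ (ψ x).1 = 0 ∧
    ∀ y ∈ U, φ y = pt ((ψ y).1 ^ N) (ψ y).2

/-- The ramification order of the branched CR structure at `x` is `N`: there is a branched chart of
order `N` at `x`, and every branched chart at `x` has order `N`. -/
def IsRamificationOrder (w : ZMod m → Flip) (x : Space w) (N : ℕ) : Prop :=
  HasBranchedChart w x N ∧ ∀ N' : ℕ, HasBranchedChart w x N' → N' = N

end CRBundle

end

open scoped Matrix Topology
open Filter

noncomputable section

namespace CRBundle

section

/-! ### The cube root of unity -/

/-! Let `n` be the number of letters `R` between the `L` at `j` and the next `L`. The cells around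
`e_j` are, in cyclic order: `σ_j` along its edge (14); alternately the tetrahedra `σ_{j+1}, …,
σ_{j+n+1}` and the `n` slabs between them, all along (12); `σ_{j+n+2}` along (23); and `σ_{j+n+1},
…, σ_{j+1}` again, along (34). These are `1 + (n+1) + n + 1 + (n+1) = 3n+4` corners (`Corner`), and
no other 1-cell is sent onto `e_j`. So this `n` is the one read off from the valence
(`EdgeWord.valence_eq`).

Develop the cells so that `e_j` lies on the vertical axis. Each corner becomes a wedge between two
curved half-planes ("sheets") bounded by the axis. For `n = 0` the four wedges make exactly one
turn. Each letter `R` inserts a slab of angle `π`, a corner (12) of a tetrahedron of type `B` of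
angle `2π/3` and a corner (34) of angle `π/3`, that is, one more full turn. The total angle is
`2π(n+1)`, and the structure winds `n+1` times around the edge. These angles are recorded in
`Corner.ang`; that the wedges follow one another without overlap, each of width at most `π`, is
`Corner.ang_next`.

The sheets are not planes, so the angle of a wedge varies with the point. A sheet is described by a
multiplier `γ`, a continuous function with values in `ℂ`: the sheet is the set where `z γ(z,t)` is a
nonnegative real number, and the sign of its imaginary part tells the two sides apart. In the
coordinates of the model cells these imaginary parts turn out to be the equations of the faces,
which is how the explicit cells are compared with wedges (`EdgeWord.body`, `EdgeWord.isOut`,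
`EdgeWord.isInn`, collected in `EdgeWord.edgeCycle`).

The topology is separated from the geometry. `WedgeCycle` treats wedges of total angle `2πN` glued
cyclically in a quotient space: taking `N`-th roots, with the branch prescribed by the angle, gives
a homeomorphism onto an open set of `ℂ × ℝ` (`WedgeCycle.isOpenEmbedding_glued`). `EdgeCycle`
produces such wedges from cells, developing maps and multipliers, and yields the branched chart
(`EdgeCycle.hasBranchedChart`).

Uniqueness of the order is a count of preimages. Two developing maps differ near `x` by an injective
map of the sphere; a chart of order `N` takes some value `N` times in every neighbourhood of `x`,
and a chart of order `N'` takes no value more than `N'` times (`HasBranchedChart.le`). -/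

lemma star_om : star om = -1 - om := by
  apply Complex.ext
  · simp [om]; norm_num
  · simp [om]; ring

lemma om_sq : om ^ 2 = -1 - om := by
  have h : ((Real.sqrt 3 : ℝ) : ℂ) ^ 2 = 3 := by
    rw [← Complex.ofReal_pow, Real.sq_sqrt (by norm_num)]; norm_num
  simp only [om]
  linear_combination (-1 / 4 : ℂ) * h + (1 / 4) * ((Real.sqrt 3 : ℝ) : ℂ) ^ 2 * Complex.I_sq

lemma om_re : om.re = -1 / 2 := by simp [om]; norm_num

lemma om_im : om.im = -Real.sqrt 3 / 2 := by simp [om]; ring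

lemma om_ne_zero : om ≠ 0 := fun h => by
  have := om_re; rw [h] at this; norm_num at this

/-! ### Null vectors and stereographic projection -/

lemma herm_eq (v u : Fin 3 → ℂ) :
    herm v u = star (u 0) * v 2 + star (u 1) * v 1 + star (u 2) * v 0 := by
  simp [herm, J, Matrix.mulVec, dotProduct, Fin.sum_univ_three]

lemma lift_infty : lift OnePoint.infty = ![1, 0, 0] := rfl

/-- The `0`-th homogeneous coordinate of the point with Heisenberg coordinates `q`. -/
def xc (q : ℂ × ℝ) : ℂ := (Complex.I * q.2 - (‖q.1‖ : ℂ) ^ 2) / 2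

lemma lift_coe (q : ℂ × ℝ) : lift (q : Hbar) = ![xc q, q.1, 1] := rfl

lemma lift_pt (z : ℂ) (t : ℝ) : lift (pt z t) = ![xc (z, t), z, 1] := rfl

lemma xc_eq_ofReal (q : ℂ × ℝ) :
    xc q = ((-‖q.1‖ ^ 2 / 2 : ℝ) : ℂ) + ((q.2 / 2 : ℝ) : ℂ) * Complex.I := by
  simp only [xc]; push_cast; ring

lemma xc_re (q : ℂ × ℝ) : (xc q).re = -Complex.normSq q.1 / 2 := by
  rw [Complex.normSq_eq_norm_sq]
  rw [xc_eq_ofReal]; simp only [Complex.add_re, Complex.ofReal_re,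
    Complex.re_ofReal_mul, Complex.I_re]; ring

lemma xc_im (q : ℂ × ℝ) : (xc q).im = q.2 / 2 := by
  rw [xc_eq_ofReal]; simp only [Complex.add_im, Complex.ofReal_im,
    Complex.im_ofReal_mul, Complex.I_im]; ring

lemma xc_add_star (q : ℂ × ℝ) : xc q + star (xc q) = - q.1 * star q.1 := by
  apply Complex.ext <;> simp [xc_re, xc_im, Complex.normSq_apply] <;> ring

@[fun_prop]
lemma continuous_xc : Continuous xc := by unfold xc; fun_prop

/-- Heisenberg coordinates of the class of a vector with nonzero last coordinate. -/
def chart (v : Fin 3 → ℂ) : ℂ × ℝ := (v 1 / v 2, 2 * (v 0 / v 2).im)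

/-- Dividing by `i` turns the real number `|y|²` into an imaginary one, so only `2 Im x` survives in
the real part. Nullity of the vector plays no role. -/
lemma stereo_of_ne {v : Fin 3 → ℂ} (h : v 2 ≠ 0) : stereo v = (chart v : Hbar) := by
  simp only [stereo, h, if_false, pt, chart]
  congr 2
  rw [Complex.div_I]
  generalize v 0 / v 2 = x
  generalize v 1 / v 2 = y
  have : (‖y‖ : ℂ) ^ 2 = ((‖y‖ ^ 2 : ℝ) : ℂ) := by push_cast; rfl
  rw [this, Complex.neg_re, Complex.mul_I_re, Complex.add_im, Complex.ofReal_im]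
  simp

lemma stereo_of_eq {v : Fin 3 → ℂ} (h : v 2 = 0) : stereo v = OnePoint.infty := by
  simp [stereo, h]

lemma stereo_smul {c : ℂ} (hc : c ≠ 0) (v : Fin 3 → ℂ) : stereo (c • v) = stereo v := by
  by_cases h : v 2 = 0
  · rw [stereo_of_eq h, stereo_of_eq (by simp [h])]
  · rw [stereo_of_ne h, stereo_of_ne (by simp [h, hc])]
    simp [chart, mul_div_mul_left _ _ hc]

lemma herm_lift_self (P : Hbar) : herm (lift P) (lift P) = 0 := by
  induction P using OnePoint.rec with
  | infty => simp [herm_eq, lift_infty]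
  | coe q =>
    have := xc_add_star q
    simp [herm_eq, lift_coe] at this ⊢
    linear_combination this

lemma lift_ne_zero (P : Hbar) : lift P ≠ 0 := by
  induction P using OnePoint.rec with
  | infty => intro h; simpa [lift_infty] using congrFun h 0
  | coe q => intro h; simpa [lift_coe] using congrFun h 2

lemma stereo_lift (P : Hbar) : stereo (lift P) = P := by
  induction P using OnePoint.rec with
  | infty => exact stereo_of_eq (by simp [lift_infty])
  | coe q =>
    rw [stereo_of_ne (by simp [lift_coe])]
    congr 1
    apply Prod.ext
    · simp [chart, lift_coe]
    · simp [chart, lift_coe, xc_im]; ring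

/-- A null vector is a multiple of the standard lift of its class. -/
lemma exists_smul_lift_stereo {v : Fin 3 → ℂ} (hv : v ≠ 0) (h0 : herm v v = 0) :
    ∃ c : ℂ, c ≠ 0 ∧ v = c • lift (stereo v) := by
  rw [herm_eq] at h0
  by_cases h : v 2 = 0
  · have h1 : v 1 = 0 := by simpa [h] using h0
    refine ⟨v 0, fun h00 => hv ?_, ?_⟩
    · ext i; fin_cases i <;> simp [h, h1, h00]
    · rw [stereo_of_eq h]; ext i; fin_cases i <;> simp [h, h1, lift_infty]
  · refine ⟨v 2, h, ?_⟩
    rw [stereo_of_ne h, lift_coe]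
    have hx : xc (chart v) = v 0 / v 2 := by
      have hs : star (v 2) ≠ 0 := star_ne_zero.mpr h
      have h2 : v 0 / v 2 + star (v 0 / v 2) = - (v 1 / v 2) * star (v 1 / v 2) := by
        rw [star_div₀, star_div₀]; field_simp; linear_combination h0
      have := congrArg Complex.re h2
      apply Complex.ext
      · rw [xc_re, chart, Complex.normSq_apply]
        simp only [Complex.add_re, Complex.mul_re, Complex.neg_re, Complex.neg_im,
          Complex.star_def, Complex.conj_re, Complex.conj_im] at this
        linarith
      · rw [xc_im, chart]; ring
    rw [hx]
    ext i; fin_cases i <;> simp [chart, mul_div_cancel₀, h]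

/-! ### CR transformations -/

/-- The unitary matrices of the Hermitian form. -/
def IsUnit21 (A : Matrix (Fin 3) (Fin 3) ℂ) : Prop := Aᴴ * J * A = J

lemma J_mul_J : J * J = 1 := by
  ext i j; fin_cases i <;> fin_cases j <;> simp [J, Matrix.mul_apply, Fin.sum_univ_three]

lemma J_conjTranspose : Jᴴ = J := by
  ext i j; fin_cases i <;> fin_cases j <;> simp [J]

/-- The inverse of a unitary matrix of the Hermitian form. -/
def uinv (A : Matrix (Fin 3) (Fin 3) ℂ) : Matrix (Fin 3) (Fin 3) ℂ := J * Aᴴ * J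

lemma IsUnit21.uinv_mul {A : Matrix (Fin 3) (Fin 3) ℂ} (h : IsUnit21 A) : uinv A * A = 1 := by
  rw [uinv, Matrix.mul_assoc, Matrix.mul_assoc, ← Matrix.mul_assoc Aᴴ, h, J_mul_J]

lemma IsUnit21.mul_uinv {A : Matrix (Fin 3) (Fin 3) ℂ} (h : IsUnit21 A) : A * uinv A = 1 :=
  mul_eq_one_comm.mp h.uinv_mul

lemma IsUnit21.mul {A B : Matrix (Fin 3) (Fin 3) ℂ} (hA : IsUnit21 A) (hB : IsUnit21 B) :
    IsUnit21 (A * B) := by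
  unfold IsUnit21 at *
  calc (A * B)ᴴ * J * (A * B) = Bᴴ * (Aᴴ * J * A) * B := by
        simp only [Matrix.conjTranspose_mul, Matrix.mul_assoc]
    _ = J := by rw [hA, hB]

lemma isUnit21_one : IsUnit21 1 := by simp [IsUnit21]

lemma IsUnit21.pow {A : Matrix (Fin 3) (Fin 3) ℂ} (hA : IsUnit21 A) (n : ℕ) :
    IsUnit21 (A ^ n) := by
  induction n with
  | zero => simpa using isUnit21_one
  | succ n ih => rw [pow_succ]; exact ih.mul hA

lemma IsUnit21.uinv {A : Matrix (Fin 3) (Fin 3) ℂ} (h : IsUnit21 A) : IsUnit21 (uinv A) := by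
  have h1 := h.mul_uinv
  unfold IsUnit21 at *
  have h2 : (CRBundle.uinv A)ᴴ = J * A * J := by
    simp [CRBundle.uinv, Matrix.conjTranspose_mul, J_conjTranspose, Matrix.mul_assoc]
  rw [h2]
  calc J * A * J * J * CRBundle.uinv A = J * A * (J * J) * CRBundle.uinv A := by
        simp only [Matrix.mul_assoc]
    _ = J := by rw [J_mul_J, Matrix.mul_one, Matrix.mul_assoc, h1, Matrix.mul_one]

lemma IsUnit21.herm_mulVec {A : Matrix (Fin 3) (Fin 3) ℂ} (h : IsUnit21 A) (v u : Fin 3 → ℂ) :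
    herm (A *ᵥ v) (A *ᵥ u) = herm v u := by
  unfold herm
  rw [Matrix.star_mulVec, ← Matrix.dotProduct_mulVec, Matrix.mulVec_mulVec, Matrix.mulVec_mulVec]
  rw [h]

/-- A unitary matrix is invertible and preserves the form, so the image of a standard lift is again
a nonzero null vector. This is what makes `crMap` a genuine projective action. -/
lemma IsUnit21.exists_lift {A : Matrix (Fin 3) (Fin 3) ℂ} (h : IsUnit21 A) (P : Hbar) :
    ∃ c : ℂ, c ≠ 0 ∧ A *ᵥ lift P = c • lift (crMap A P) := by
  refine exists_smul_lift_stereo (fun h0 => lift_ne_zero P ?_) ?_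
  · have := congrArg (CRBundle.uinv A *ᵥ ·) h0
    simpa [Matrix.mulVec_mulVec, h.uinv_mul] using this
  · rw [h.herm_mulVec, herm_lift_self]

/-- Only the inner factor has to be unitary: `B` then maps a lift to a multiple of a lift, and
`stereo` does not see the multiple. -/
lemma crMap_mul (A : Matrix (Fin 3) (Fin 3) ℂ) {B : Matrix (Fin 3) (Fin 3) ℂ} (hB : IsUnit21 B) :
    crMap (A * B) = crMap A ∘ crMap B := by
  funext P
  obtain ⟨c, hc, h⟩ := hB.exists_lift P
  change stereo ((A * B) *ᵥ lift P) = stereo (A *ᵥ lift (crMap B P))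
  rw [← Matrix.mulVec_mulVec, h, Matrix.mulVec_smul, stereo_smul hc]

lemma crMap_one : crMap 1 = id := by
  funext P; simp [crMap, stereo_lift]

lemma crMap_smul {c : ℂ} (hc : c ≠ 0) (A : Matrix (Fin 3) (Fin 3) ℂ) :
    crMap (c • A) = crMap A := by
  funext P; simp [crMap, Matrix.smul_mulVec, stereo_smul hc]

lemma IsUnit21.crMap_uinv_crMap {A : Matrix (Fin 3) (Fin 3) ℂ} (h : IsUnit21 A) (P : Hbar) :
    crMap (CRBundle.uinv A) (crMap A P) = P := by
  have := congrFun (crMap_mul (CRBundle.uinv A) h) P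
  rw [h.uinv_mul, crMap_one] at this
  exact this.symm

lemma IsUnit21.crMap_crMap_uinv {A : Matrix (Fin 3) (Fin 3) ℂ} (h : IsUnit21 A) (P : Hbar) :
    crMap A (crMap (CRBundle.uinv A) P) = P := by
  have := congrFun (crMap_mul A h.uinv) P
  rw [h.mul_uinv, crMap_one] at this
  exact this.symm

lemma IsUnit21.crMap_injective {A : Matrix (Fin 3) (Fin 3) ℂ} (h : IsUnit21 A) :
    Function.Injective (crMap A) :=
  Function.LeftInverse.injective h.crMap_uinv_crMap

/-- The map of Heisenberg coordinates induced by a matrix. -/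
def cm (A : Matrix (Fin 3) (Fin 3) ℂ) (q : ℂ × ℝ) : ℂ × ℝ := chart (A *ᵥ lift (q : Hbar))

/-- The last coordinate of the image of the standard lift. -/
def den (A : Matrix (Fin 3) (Fin 3) ℂ) (q : ℂ × ℝ) : ℂ := (A *ᵥ lift (q : Hbar)) 2

lemma crMap_coe {A : Matrix (Fin 3) (Fin 3) ℂ} {q : ℂ × ℝ} (h : den A q ≠ 0) :
    crMap A (q : Hbar) = (cm A q : Hbar) := stereo_of_ne h

lemma crMap_coe_of_den_eq {A : Matrix (Fin 3) (Fin 3) ℂ} {q : ℂ × ℝ} (h : den A q = 0) :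
    crMap A (q : Hbar) = OnePoint.infty := stereo_of_eq h

lemma den_ne_zero {A : Matrix (Fin 3) (Fin 3) ℂ} {q Y : ℂ × ℝ}
    (h : crMap A (q : Hbar) = (Y : Hbar)) : den A q ≠ 0 := fun h0 => by
  rw [crMap_coe_of_den_eq h0] at h; exact OnePoint.infty_ne_coe _ h

lemma cm_eq {A : Matrix (Fin 3) (Fin 3) ℂ} {q Y : ℂ × ℝ}
    (h : crMap A (q : Hbar) = (Y : Hbar)) : cm A q = Y := by
  have := crMap_coe (den_ne_zero h)
  rw [h] at this
  exact (OnePoint.coe_injective this).symm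

lemma mulVec_lift_apply (A : Matrix (Fin 3) (Fin 3) ℂ) (q : ℂ × ℝ) (i : Fin 3) :
    (A *ᵥ lift (q : Hbar)) i = A i 0 * xc q + A i 1 * q.1 + A i 2 := by
  simp [lift_coe, Matrix.mulVec, dotProduct, Fin.sum_univ_three]

@[fun_prop]
lemma continuous_mulVec_lift (A : Matrix (Fin 3) (Fin 3) ℂ) (i : Fin 3) :
    Continuous fun q : ℂ × ℝ => (A *ᵥ lift (q : Hbar)) i := by
  simp only [mulVec_lift_apply]; fun_prop

lemma continuous_den (A : Matrix (Fin 3) (Fin 3) ℂ) : Continuous (den A) :=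
  continuous_mulVec_lift A 2

lemma continuousAt_cm {A : Matrix (Fin 3) (Fin 3) ℂ} {q : ℂ × ℝ} (h : den A q ≠ 0) :
    ContinuousAt (cm A) q := by
  have h1 : ContinuousAt (fun q : ℂ × ℝ => (A *ᵥ lift (q : Hbar)) 1 / (A *ᵥ lift (q : Hbar)) 2) q :=
    ((continuous_mulVec_lift A 1).continuousAt).div ((continuous_mulVec_lift A 2).continuousAt) h
  have h0 : ContinuousAt (fun q : ℂ × ℝ => (A *ᵥ lift (q : Hbar)) 0 / (A *ᵥ lift (q : Hbar)) 2) q :=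
    ((continuous_mulVec_lift A 0).continuousAt).div ((continuous_mulVec_lift A 2).continuousAt) h
  exact h1.prodMk (continuousAt_const.mul (Complex.continuous_im.continuousAt.comp h0))

lemma eventually_den_ne {A : Matrix (Fin 3) (Fin 3) ℂ} {q : ℂ × ℝ} (h : den A q ≠ 0) :
    ∀ᶠ q' in 𝓝 q, den A q' ≠ 0 :=
  (continuous_den A).continuousAt.eventually_ne h

/-! ### CR transformations preserve edges and marked triangles -/

/-- The oriented arc does not depend on the null vectors chosen over its end points: the rescaling
replaces `l` by `a l / b` and `s` by `|a|² s`, which keeps its sign. -/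
lemma edge_eq_of_smul {P Q : Hbar} {p q : Fin 3 → ℂ} {a b : ℂ} (ha : a ≠ 0) (hb : b ≠ 0)
    (hp : p = a • lift P) (hq : q = b • lift Q) :
    edge P Q = {X | X = Q ∨ ∃ (l : ℂ) (s : ℝ), 0 ≤ s ∧
      star l * herm p q = -Complex.I * s ∧ X = stereo (p + l • q)} := by
  have hh : herm p q = a * star b * herm (lift P) (lift Q) := by
    rw [hp, hq, herm_eq, herm_eq]; simp; ring
  have hpos : (0 : ℝ) < Complex.normSq a := Complex.normSq_pos.mpr ha
  have hna : ((Complex.normSq a : ℝ) : ℂ) = a * star a := (Complex.mul_conj a).symm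
  have hsa : star a ≠ 0 := star_ne_zero.mpr ha
  ext X
  refine or_congr Iff.rfl ⟨?_, ?_⟩
  · rintro ⟨l, s, hs, h1, h2⟩
    refine ⟨a * l / b, Complex.normSq a * s, by positivity, ?_, ?_⟩
    · have hsb : star b ≠ 0 := star_ne_zero.mpr hb
      rw [hh, star_div₀, star_mul]; push_cast; rw [hna]; field_simp
      linear_combination h1
    · rw [h2, ← stereo_smul ha, hp, hq, smul_add, smul_smul, smul_smul]
      congr 3; field_simp
  · rintro ⟨l, s, hs, h1, h2⟩
    refine ⟨l * b / a, s / Complex.normSq a, by positivity, ?_, ?_⟩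
    · rw [hh] at h1
      rw [star_div₀, star_mul]; push_cast; rw [hna]; field_simp
      linear_combination h1
    · have : p + l • q = a • (lift P + (l * b / a) • lift Q) := by
        rw [hp, hq, smul_add, smul_smul, smul_smul]; congr 2; field_simp
      rw [h2, this, stereo_smul ha]

/-- The form is preserved, so the same `l` and `s` serve for the image. The vector `p + l q` is null
because `l̄ ⟨p, q⟩` is purely imaginary, and it is nonzero because `P ≠ Q`; hence its class may be
mapped by applying `A` to it. -/
lemma IsUnit21.edge_image_subset {A : Matrix (Fin 3) (Fin 3) ℂ} (hA : IsUnit21 A) {P Q : Hbar}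
    (hPQ : P ≠ Q) : crMap A '' edge P Q ⊆ edge (crMap A P) (crMap A Q) := by
  obtain ⟨a, ha, hp⟩ := hA.exists_lift P
  obtain ⟨b, hb, hq⟩ := hA.exists_lift Q
  rw [edge_eq_of_smul ha hb hp hq]
  rintro _ ⟨X, rfl | ⟨l, s, hs, h1, rfl⟩, rfl⟩
  · exact Or.inl rfl
  · refine Or.inr ⟨l, s, hs, by rw [hA.herm_mulVec, h1], ?_⟩
    have hne : lift P + l • lift Q ≠ 0 → herm (lift P + l • lift Q) (lift P + l • lift Q) = 0 →
        crMap A (stereo (lift P + l • lift Q)) = stereo (A *ᵥ lift P + l • A *ᵥ lift Q) := by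
      intro h0 hn
      obtain ⟨c, hc, h⟩ := exists_smul_lift_stereo h0 hn
      rw [crMap, ← stereo_smul hc, ← Matrix.mulVec_smul, ← h, Matrix.mulVec_add,
        Matrix.mulVec_smul]
    by_cases h0 : lift P + l • lift Q = 0
    · exfalso
      have hl : l ≠ 0 := fun hl => lift_ne_zero P (by simpa [hl] using h0)
      have : lift P = (-l) • lift Q := by rw [neg_smul]; exact eq_neg_of_add_eq_zero_left h0
      apply hPQ
      rw [← stereo_lift P, this, stereo_smul (neg_ne_zero.mpr hl), stereo_lift]
    · apply hne h0
      have e1 := herm_lift_self P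
      have e2 := herm_lift_self Q
      have e3 : star (herm (lift P) (lift Q)) = herm (lift Q) (lift P) := by
        rw [herm_eq, herm_eq]; simp; ring
      have e4 : herm (lift P + l • lift Q) (lift P + l • lift Q) =
          herm (lift P) (lift P) + star l * herm (lift P) (lift Q) +
          l * herm (lift Q) (lift P) + l * star l * herm (lift Q) (lift Q) := by
        simp only [herm_eq]; simp; ring
      rw [e4, e1, e2, h1, ← e3]
      have := congrArg star h1
      simp only [star_mul, star_neg, Complex.star_def, Complex.conj_I, Complex.conj_conj,
        Complex.conj_ofReal] at this ⊢
      linear_combination this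

lemma IsUnit21.edge_image {A : Matrix (Fin 3) (Fin 3) ℂ} (hA : IsUnit21 A) {P Q : Hbar}
    (hPQ : P ≠ Q) : crMap A '' edge P Q = edge (crMap A P) (crMap A Q) := by
  refine (hA.edge_image_subset hPQ).antisymm fun X hX => ?_
  refine ⟨crMap (CRBundle.uinv A) X, ?_, hA.crMap_crMap_uinv X⟩
  have := hA.uinv.edge_image_subset (hA.crMap_injective.ne hPQ) ⟨X, hX, rfl⟩
  rwa [hA.crMap_uinv_crMap, hA.crMap_uinv_crMap] at this

lemma IsUnit21.triMinus_image {A : Matrix (Fin 3) (Fin 3) ℂ} (hA : IsUnit21 A) {P Q R : Hbar}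
    (hQR : Q ≠ R) (hP : P ∉ edge Q R) :
    crMap A '' triMinus P Q R = triMinus (crMap A P) (crMap A Q) (crMap A R) := by
  ext X
  simp only [triMinus, ← hA.edge_image hQR, Set.mem_image, Set.mem_ofPred_eq,
    exists_exists_and_eq_and]
  constructor
  · rintro ⟨X, ⟨Y, hY, hX⟩, rfl⟩
    refine ⟨Y, hY, ?_⟩
    rw [← hA.edge_image (show Y ≠ P from fun h => hP (h ▸ hY))]
    exact ⟨X, hX, rfl⟩
  · rintro ⟨Y, hY, hX⟩
    rw [← hA.edge_image (show Y ≠ P from fun h => hP (h ▸ hY))] at hX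
    obtain ⟨X, hX, rfl⟩ := hX
    exact ⟨X, ⟨Y, hY, hX⟩, rfl⟩

end

section

/-! ### Uniqueness of the ramification order -/

/-- The local multiplicity of a map at a point is at least `N`: some values are taken at least `N`
times in every neighbourhood. -/
def MultiplicityAtLeast {X Y : Type*} [TopologicalSpace X] (φ : X → Y) (x : X) (N : ℕ) : Prop :=
  ∀ V ∈ 𝓝 x, ∃ S : Finset X, (S : Set X) ⊆ V ∧ S.card = N ∧ ∀ y ∈ S, ∀ y' ∈ S, φ y = φ y'

lemma pt_injective {z z' : ℂ} {t t' : ℝ} (h : pt z t = pt z' t') : z = z' ∧ t = t' := by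
  have := OnePoint.coe_injective h
  simpa using this

/-- A map that is `(z, t) ↦ (z ^ N, t)` in a chart centred on the axis has local multiplicity at
least `N`. -/
lemma multiplicityAtLeast_of_chart {X : Type*} [TopologicalSpace X] {U : Set X} {x : X}
    {φ : X → Hbar} {ψ : X → ℂ × ℝ} {N : ℕ} (hN : 0 < N) (hx : x ∈ U)
    (hψ : Topology.IsOpenEmbedding (U.domRestrict ψ)) (h0 : (ψ x).1 = 0)
    (hφ : ∀ y ∈ U, φ y = pt ((ψ y).1 ^ N) (ψ y).2) : MultiplicityAtLeast φ x N := by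
  classical
  intro V hV
  have hW : ψ '' (U ∩ interior V) ∈ 𝓝 (ψ x) := by
    have : ψ '' (U ∩ interior V) = U.domRestrict ψ '' (Subtype.val ⁻¹' interior V) := by
      ext y; constructor
      · rintro ⟨a, ⟨ha, hb⟩, rfl⟩; exact ⟨⟨a, ha⟩, hb, rfl⟩
      · rintro ⟨⟨a, ha⟩, hb, rfl⟩; exact ⟨a, ⟨ha, hb⟩, rfl⟩
    rw [this]
    exact (hψ.isOpenMap _ (isOpen_interior.preimage continuous_subtype_val)).mem_nhds
      ⟨⟨x, hx⟩, mem_interior_iff_mem_nhds.mpr hV, rfl⟩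
  obtain ⟨ε, hε, hball⟩ := Metric.mem_nhds_iff.mp hW
  have hsub : ∀ z : ℂ, ‖z‖ < ε → ∃ y ∈ U ∩ V, ψ y = (z, (ψ x).2) := by
    intro z hz
    have : (z, (ψ x).2) ∈ Metric.ball (ψ x) ε := by
      rw [Metric.mem_ball, Prod.dist_eq, max_lt_iff]
      simpa [h0] using ⟨hz, hε⟩
    obtain ⟨y, ⟨hy, hy'⟩, he⟩ := hball this
    exact ⟨y, ⟨hy, interior_subset hy'⟩, he⟩
  have hinj : Set.InjOn ψ U := Set.injOn_iff_injective.mpr hψ.injective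
  set ζ : ℂ := Complex.exp (2 * Real.pi * Complex.I / N) with hζdef
  have hζ : IsPrimitiveRoot ζ N := Complex.isPrimitiveRoot_exp N hN.ne'
  have hnorm : ∀ k : ℕ, ‖((ε / 2 : ℝ) : ℂ) * ζ ^ k‖ < ε := by
    intro k
    rw [norm_mul, norm_pow, hζ.norm'_eq_one hN.ne', one_pow, mul_one, Complex.norm_real,
      Real.norm_of_nonneg (by positivity)]
    linarith
  -- The `N` points `(ε/2) ζᵏ`, at the height of `x`, have the common `N`-th power `(ε/2)ᴺ`.
  choose y hy hyψ using fun k : ℕ => hsub _ (hnorm k)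
  refine ⟨(Finset.range N).image y, ?_, ?_, ?_⟩
  · intro a ha
    obtain ⟨k, -, rfl⟩ := Finset.mem_image.mp (Finset.mem_coe.mp ha)
    exact (hy k).2
  · rw [Finset.card_image_of_injOn, Finset.card_range]
    intro k hk l hl hkl
    have h1 := hyψ k
    have hkl' : y k = y l := hkl
    rw [hkl', hyψ l] at h1
    have h2 : ζ ^ l = ζ ^ k :=
      mul_left_cancel₀ (by simpa using hε.ne') (Prod.ext_iff.mp h1).1
    exact (hζ.pow_inj (by simpa using hl) (by simpa using hk) h2).symm
  · have : ∀ a ∈ (Finset.range N).image y, φ a = pt (((ε / 2 : ℝ) : ℂ) ^ N) (ψ x).2 := by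
      intro a ha
      obtain ⟨k, -, rfl⟩ := Finset.mem_image.mp ha
      rw [hφ _ (hy k).1, hyψ k]
      simp only [mul_pow]
      rw [← pow_mul, mul_comm k N, pow_mul, hζ.pow_eq_one, one_pow, mul_one]
    intro a ha b hb
    rw [this a ha, this b hb]

/-- A map that is `(z, t) ↦ (z ^ N, t)` in a chart takes no value more than `N` times. -/
lemma card_le_of_chart {X : Type*} {U : Set X} {φ : X → Hbar} {ψ : X → ℂ × ℝ} {N : ℕ}
    (hN : 0 < N) (hψ : Function.Injective (U.domRestrict ψ))
    (hφ : ∀ y ∈ U, φ y = pt ((ψ y).1 ^ N) (ψ y).2) {S : Finset X} (hS : (S : Set X) ⊆ U)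
    (hval : ∀ y ∈ S, ∀ y' ∈ S, φ y = φ y') : S.card ≤ N := by
  classical
  rcases S.eq_empty_or_nonempty with rfl | ⟨y₀, hy₀⟩
  · simp
  have hinj : Set.InjOn ψ U := Set.injOn_iff_injective.mpr hψ
  have key : ∀ y ∈ S, (ψ y).1 ^ N = (ψ y₀).1 ^ N ∧ (ψ y).2 = (ψ y₀).2 := by
    intro y hy
    have := hval y hy y₀ hy₀
    rw [hφ y (hS hy), hφ y₀ (hS hy₀)] at this
    exact pt_injective this
  calc S.card = (S.image fun y => (ψ y).1).card := by
        rw [Finset.card_image_of_injOn]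
        intro a ha b hb hab
        exact hinj (hS ha) (hS hb) (Prod.ext hab ((key a ha).2.trans (key b hb).2.symm))
    _ ≤ ((Polynomial.nthRoots N ((ψ y₀).1 ^ N)).toFinset).card := by
        apply Finset.card_le_card
        intro z hz
        obtain ⟨y, hy, rfl⟩ := Finset.mem_image.mp hz
        rw [Multiset.mem_toFinset, Polynomial.mem_nthRoots hN]
        exact (key y hy).1
    _ ≤ N := (Multiset.toFinset_card_le _).trans (Polynomial.card_nthRoots _ _)

lemma isUnit21_G1 : IsUnit21 G1 := by
  have h2 := om_sq
  ext i j; fin_cases i <;> fin_cases j <;>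
    simp [J, G1, Matrix.mul_apply, Fin.sum_univ_three, Matrix.conjTranspose_apply] <;>
    (try simp only [← Complex.star_def, star_om]) <;> grind

lemma isUnit21_G2 : IsUnit21 G2 := by
  have h2 := om_sq
  ext i j; fin_cases i <;> fin_cases j <;>
    simp [J, G2, Matrix.mul_apply, Fin.sum_univ_three, Matrix.conjTranspose_apply] <;>
    (try simp only [← Complex.star_def, star_om]) <;> grind

lemma isUnit21_G3 : IsUnit21 G3 := by
  have h2 := om_sq
  ext i j; fin_cases i <;> fin_cases j <;>
    simp [J, G3, Matrix.mul_apply, Fin.sum_univ_three, Matrix.conjTranspose_apply] <;>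
    (try simp only [← Complex.star_def, star_om]) <;> grind

lemma isUnit21_G4 : IsUnit21 G4 := by
  have h2 := om_sq
  ext i j; fin_cases i <;> fin_cases j <;>
    simp [J, G4, Matrix.mul_apply, Fin.sum_univ_three, Matrix.conjTranspose_apply] <;>
    (try simp only [← Complex.star_def, star_om]) <;> grind

variable {m : ℕ} {w : ZMod m → Flip}

lemma IsCR.bijective {g : Hbar → Hbar} (h : IsCR g) : Function.Bijective g := by
  obtain ⟨A, hA, rfl⟩ := h
  have hA : IsUnit21 A := hA
  exact ⟨hA.crMap_injective, fun P => ⟨_, hA.crMap_crMap_uinv P⟩⟩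

/-- Crossing a face multiplies both developing transformations by the same `G` on the right, so the
transition `g' g⁻¹` is unchanged. It therefore descends to the glued space. -/
lemma comp_invFun_comp {g g' G : Hbar → Hbar} (hg : Function.Bijective g)
    (hgG : Function.Bijective (g ∘ G)) :
    (g' ∘ G) ∘ Function.invFun (g ∘ G) = g' ∘ Function.invFun g := by
  funext y
  simp only [Function.comp_apply]
  congr 1
  apply hg.1
  rw [Function.invFun_eq (hg.2 y)]
  exact Function.invFun_eq (hgG.2 y)

/-- Two developing maps differ, near a point, by an injective map of the CR sphere. -/
lemma IsDeveloping.exists_comp {U U' : Set (Space w)} {φ φ' : Space w → Hbar}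
    (hU : IsOpen U) (hU' : IsOpen U') (h : IsDeveloping w U φ) (h' : IsDeveloping w U' φ')
    {x : Space w} (hx : x ∈ U) (hx' : x ∈ U') :
    ∃ V, IsOpen V ∧ x ∈ V ∧ V ⊆ U ∧ V ⊆ U' ∧ ∃ H : Hbar → Hbar,
      ∀ y ∈ V, φ' y = H (φ y) := by
  classical
  obtain ⟨g, hcr, hloc, hglue, hval⟩ := h
  obtain ⟨g', hcr', hloc', hglue', hval'⟩ := h'
  -- The transition is needed on `U ∩ U'` only; the value `id` elsewhere is a default that lets the
  -- function be lifted to the whole quotient.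
  have hcomp : ∀ p q, Glue w p q →
      (if proj w p ∈ U ∩ U' then g' p ∘ Function.invFun (g p) else id) =
      (if proj w q ∈ U ∩ U' then g' q ∘ Function.invFun (g q) else id) := by
    intro p q hpq
    have he : proj w p = proj w q := Quot.sound hpq
    rw [he]
    split_ifs with hq
    · obtain ⟨F, G, hFG, hpF, hqG⟩ := hpq
      have hp : proj w p ∈ U ∩ U' := he ▸ hq
      have e1 := hglue p q hp.1 F G hFG hpF hqG
      have e2 := hglue' p q hp.2 F G hFG hpF hqG
      rw [e2, e1]
      exact comp_invFun_comp (hcr q hq.1).bijective (e1 ▸ (hcr p hp.1).bijective)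
    · rfl
  let H : Space w → Hbar → Hbar := Quot.lift _ hcomp
  have hH : ∀ p, proj w p ∈ U ∩ U' → H (proj w p) = g' p ∘ Function.invFun (g p) :=
    fun p hp => if_pos hp
  have hproj : Continuous (proj w) := continuous_quot_mk
  -- The transition is locally constant on the cells, so the set where it equals its value at `x` is
  -- open in the quotient.
  refine ⟨{y | y ∈ U ∩ U' ∧ H y = H x}, ?_, ⟨⟨hx, hx'⟩, rfl⟩, fun y hy => hy.1.1,
    fun y hy => hy.1.2, H x, ?_⟩
  · refine isOpen_coinduced.mpr (isOpen_iff_mem_nhds.mpr fun p hp => ?_)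
    have hp : proj w p ∈ U ∩ U' ∧ H (proj w p) = H x := hp
    have hop : ∀ᶠ p' in 𝓝 p, proj w p' ∈ U ∩ U' :=
      ((hU.inter hU').preimage hproj).mem_nhds hp.1
    filter_upwards [hop, hloc p hp.1.1, hloc' p hp.1.2] with p' h1 h2 h3
    refine ⟨h1, ?_⟩
    change H (proj w p') = H x
    rw [hH p' h1, h2, h3, ← hH p hp.1, hp.2]
  · rintro y ⟨hy, hyx⟩
    obtain ⟨p, rfl⟩ := Quot.exists_rep y
    change proj w p ∈ U ∩ U' at hy
    change H (proj w p) = H x at hyx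
    change φ' (proj w p) = H x (φ (proj w p))
    rw [← hyx, hH p hy, hval p hy.1, hval' p hy.2]
    simp only [Function.comp_apply]
    rw [Function.leftInverse_invFun (hcr p hy.1).bijective.1]

/-- Near `x` one has `φ' = H ∘ φ`, so `N` nearby points with the same value of `φ` have the same
value of `φ'`, and a chart of order `N'` allows at most `N'` such points. -/
lemma HasBranchedChart.le {x : Space w} {N N' : ℕ} (h : HasBranchedChart w x N)
    (h' : HasBranchedChart w x N') : N ≤ N' := by
  obtain ⟨hN, U, φ, ψ, hU, hx, hdev, hψ, h0, hφ⟩ := h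
  obtain ⟨hN', U', φ', ψ', hU', hx', hdev', hψ', -, hφ'⟩ := h'
  obtain ⟨V, hV, hxV, -, hVU', H, hH⟩ := hdev.exists_comp hU hU' hdev' hx hx'
  obtain ⟨S, hSV, rfl, hS⟩ := multiplicityAtLeast_of_chart hN hx hψ h0 hφ V (hV.mem_nhds hxV)
  refine card_le_of_chart hN' hψ'.injective hφ' (hSV.trans hVU') fun y hy y' hy' => ?_
  rw [hH y (hSV hy), hH y' (hSV hy'), hS y hy y' hy']

/-- The existence of a branched chart determines the ramification order. -/
lemma HasBranchedChart.isRamificationOrder {x : Space w} {N : ℕ} (h : HasBranchedChart w x N) :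
    IsRamificationOrder w x N :=
  ⟨h, fun _ h' => le_antisymm (h'.le h) (h.le h')⟩

end

section

/-! ### Gluing wedges around an axis -/

/-- The complex number `z` lies on the ray of angle `a`. -/
def OnRay (a : ℝ) (z : ℂ) : Prop := z = ‖z‖ * Complex.exp (a * Complex.I)

/-- The complex number `z` lies in the wedge between the rays of angles `a` and `b`. -/
def InWedge (a b : ℝ) (z : ℂ) : Prop := ∃ θ ∈ Set.Icc a b, OnRay θ z

lemma onRay_zero (a : ℝ) : OnRay a 0 := by simp [OnRay]

lemma OnRay.add_two_pi_mul {a : ℝ} {z : ℂ} (h : OnRay a z) (n : ℕ) :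
    OnRay (a + 2 * Real.pi * n) z := by
  unfold OnRay at *
  have : Complex.exp (((a + 2 * Real.pi * n : ℝ) : ℂ) * Complex.I) =
      Complex.exp (a * Complex.I) := by
    rw [Complex.exp_eq_exp_iff_exists_int]
    exact ⟨n, by push_cast; ring⟩
  rw [this]; exact h

/-- The `N`-th root of `z` with the argument determined by the branch of the argument of `z`
centred at `c`. -/
def wroot (N : ℕ) (c : ℝ) (z : ℂ) : ℂ :=
  ((‖z‖ ^ ((N : ℝ)⁻¹) : ℝ) : ℂ) *
    Complex.exp (((c + Complex.arg (z * Complex.exp (-(c * Complex.I)))) / N : ℝ) * Complex.I)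

lemma wroot_zero {N : ℕ} (hN : 0 < N) (c : ℝ) : wroot N c 0 = 0 := by
  have : ((N : ℝ)⁻¹) ≠ 0 := by positivity
  simp [wroot, Real.zero_rpow this]

/-- After rotation by `-c` the principal argument is `θ - c`, so the root has the prescribed angle
`θ / N`. -/
lemma wroot_eq {N : ℕ} (hN : 0 < N) {c θ : ℝ} {z : ℂ} (hθ : |θ - c| < Real.pi) (hz : OnRay θ z) :
    wroot N c z = ((‖z‖ ^ ((N : ℝ)⁻¹) : ℝ) : ℂ) * Complex.exp ((θ / N : ℝ) * Complex.I) := by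
  rcases eq_or_ne z 0 with rfl | h0
  · have : ((N : ℝ)⁻¹) ≠ 0 := by positivity
    simp [wroot, Real.zero_rpow this]
  · have hpos : 0 < ‖z‖ := norm_pos_iff.mpr h0
    have h1 : z * Complex.exp (-(c * Complex.I)) =
        ‖z‖ * Complex.exp (((θ - c : ℝ) : ℂ) * Complex.I) := by
      conv_lhs => rw [hz]
      rw [mul_assoc, ← Complex.exp_add]; congr 2; push_cast; ring
    rw [abs_lt] at hθ
    have h2 : Complex.arg (z * Complex.exp (-(c * Complex.I))) = θ - c := by
      rw [h1, Complex.arg_real_mul _ hpos, Complex.arg_exp_mul_I,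
        (toIocMod_eq_self _).mpr ⟨by linarith, by linarith⟩]
    rw [wroot, h2]; congr 3; ring_nf

lemma norm_wroot (N : ℕ) (c : ℝ) (z : ℂ) : ‖wroot N c z‖ = ‖z‖ ^ ((N : ℝ)⁻¹) := by
  rw [wroot, norm_mul, Complex.norm_exp_ofReal_mul_I, mul_one, Complex.norm_real,
    Real.norm_of_nonneg (by positivity)]

lemma wroot_pow {N : ℕ} (hN : 0 < N) (c : ℝ) (z : ℂ) : wroot N c z ^ N = z := by
  have hN' : (N : ℂ) ≠ 0 := by exact_mod_cast hN.ne'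
  rw [wroot, mul_pow, ← Complex.ofReal_pow, Real.rpow_inv_natCast_pow (norm_nonneg _) hN.ne',
    ← Complex.exp_nat_mul]
  have e : (N : ℂ) * (((c + Complex.arg (z * Complex.exp (-(c * Complex.I)))) / N : ℝ) *
      Complex.I) = c * Complex.I +
        Complex.arg (z * Complex.exp (-(c * Complex.I))) * Complex.I := by
    push_cast; field_simp
  have hn : ‖z * Complex.exp (-(c * Complex.I))‖ = ‖z‖ := by
    rw [norm_mul, ← neg_mul, ← Complex.ofReal_neg, Complex.norm_exp_ofReal_mul_I, mul_one]
  have := Complex.norm_mul_exp_arg_mul_I (z * Complex.exp (-(c * Complex.I)))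
  rw [hn] at this
  rw [e, Complex.exp_add, mul_left_comm, this, mul_left_comm, ← Complex.exp_add]
  simp

/-- Away from zero the argument is continuous on the slit plane. At a zero the argument may jump,
but the modulus `|f|^{1/N}` tends to `0`. -/
lemma continuousWithinAt_wroot {X : Type*} [TopologicalSpace X] {N : ℕ} (hN : 0 < N)
    {c : X → ℝ} {f : X → ℂ} {S : Set X} {x : X} (hc : ContinuousWithinAt c S x)
    (hf : ContinuousWithinAt f S x)
    (hx : f x = 0 ∨ f x * Complex.exp (-(c x * Complex.I)) ∈ Complex.slitPlane) :
    ContinuousWithinAt (fun y => wroot N (c y) (f y)) S x := by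
  have hN' : (0 : ℝ) ≤ ((N : ℝ)⁻¹) := by positivity
  have hnorm : ContinuousWithinAt (fun y => ‖f y‖ ^ ((N : ℝ)⁻¹)) S x :=
    hf.norm.rpow_const (Or.inr hN')
  rcases hx with h0 | hx
  · have : wroot N (c x) (f x) = 0 := by rw [h0, wroot_zero hN]
    change Tendsto _ _ (𝓝 (wroot N (c x) (f x)))
    rw [this]
    refine squeeze_zero_norm (fun y => (norm_wroot N (c y) (f y)).le) ?_
    have h := hnorm.tendsto
    rwa [h0, norm_zero, Real.zero_rpow (by positivity)] at h
  · unfold wroot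
    have hg : ContinuousWithinAt (fun y => f y * Complex.exp (-(c y * Complex.I))) S x := by
      refine hf.mul ?_
      exact (Complex.continuous_exp.comp (by fun_prop : Continuous fun s : ℝ =>
        -((s : ℂ) * Complex.I))).continuousAt.comp_continuousWithinAt hc
    have harg : ContinuousWithinAt (fun y => Complex.arg (f y *
        Complex.exp (-(c y * Complex.I)))) S x :=
      ContinuousAt.comp_continuousWithinAt (g := Complex.arg) (Complex.continuousAt_arg hx) hg
    have h1 : ContinuousWithinAt (fun y => (c y + Complex.arg (f y *
        Complex.exp (-(c y * Complex.I)))) / N) S x := (hc.add harg).div_const _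
    refine (Complex.continuous_ofReal.continuousAt.comp_continuousWithinAt hnorm).mul ?_
    exact (Complex.continuous_exp.comp (by fun_prop : Continuous fun s : ℝ =>
        ((s : ℂ) * Complex.I))).continuousAt.comp_continuousWithinAt h1

/-- Data exhibiting, in the quotient of a space `P` by the relation generated by `r`, a union of `K`
wedges glued cyclically around an axis, with total angle `2 π N`. The piece `O k` is identified by
`d k`, with inverse `e k`, with the wedge between the rays of angles `β k Y` and `β (k + 1) Y` at
the points `Y` of `Ω`. -/
structure WedgeCycle {P : Type*} [TopologicalSpace P] (r : P → P → Prop) (K N : ℕ) where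
  Ω : Set (ℂ × ℝ)
  O : ℕ → Set P
  d : ℕ → P → ℂ × ℝ
  e : ℕ → ℂ × ℝ → P
  β : ℕ → ℂ × ℝ → ℝ
  C : ℝ
  N_pos : 0 < N
  isOpen_Ω : IsOpen Ω
  isOpen_O : ∀ k < K, IsOpen (O k)
  disj : ∀ k < K, ∀ l < K, ∀ p, p ∈ O k → p ∈ O l → k = l
  d_cont : ∀ k < K, ContinuousOn (d k) (O k)
  d_mem : ∀ k < K, ∀ p ∈ O k, d k p ∈ Ω
  d_wedge : ∀ k < K, ∀ p ∈ O k, InWedge (β k (d k p)) (β (k + 1) (d k p)) (d k p).1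
  e_mem : ∀ k < K, ∀ Y ∈ Ω, InWedge (β k Y) (β (k + 1) Y) Y.1 → e k Y ∈ O k
  d_e : ∀ k < K, ∀ Y ∈ Ω, InWedge (β k Y) (β (k + 1) Y) Y.1 → d k (e k Y) = Y
  e_d : ∀ k < K, ∀ p ∈ O k, e k (d k p) = p
  e_cont : ∀ k < K, ContinuousOn (e k) {Y | Y ∈ Ω ∧ InWedge (β k Y) (β (k + 1) Y) Y.1}
  β_cont : ∀ k ≤ K, ContinuousOn (β k) Ω
  β_lt : ∀ k < K, ∀ Y ∈ Ω, β k Y < β (k + 1) Y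
  β_width : ∀ k < K, ∀ Y ∈ Ω, β (k + 1) Y < β k Y + 2 * Real.pi
  β_last : ∀ Y ∈ Ω, β K Y = β 0 Y + 2 * Real.pi * N
  -- The uniform bound confines the angles to a compact interval; this is what makes the pieces of
  -- the model closed.
  β_bdd : ∀ k ≤ K, ∀ Y ∈ Ω, β k Y ∈ Set.Icc (-C) C
  -- For `k = K - 1` the next index is `0`, whose angle differs from `β K` by `2πN` but defines the
  -- same ray.
  glue : ∀ k < K, ∀ l < K, (k + 1) % K = l → ∀ Y ∈ Ω, OnRay (β l Y) Y.1 →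
    Quot.mk r (e k Y) = Quot.mk r (e l Y)
  -- Saturation: every identification of a point of a piece is with a neighbouring piece, along
  -- their common sheet.
  sat : ∀ k < K, ∀ p ∈ O k, ∀ q, r p q ∨ r q p → ∃ l < K, q ∈ O l ∧ d l q = d k p ∧
    (((k + 1) % K = l ∧ OnRay (β l (d k p)) (d k p).1) ∨
      ((l + 1) % K = k ∧ OnRay (β k (d k p)) (d k p).1))

/-! ### Cyclically glued wedges as an `N`-fold branched cover -/

namespace WedgeCycle

variable {P : Type*} [TopologicalSpace P] {r : P → P → Prop} {K N : ℕ} (A : WedgeCycle r K N)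

/-- The lift of the point `Y` of the `k`-th wedge to the `N`-fold branched covering. -/
def s (k : ℕ) (Y : ℂ × ℝ) : ℂ × ℝ := (wroot N ((A.β k Y + A.β (k + 1) Y) / 2) Y.1, Y.2)

lemma s_eq {k : ℕ} (hk : k < K) {Y : ℂ × ℝ} (hY : Y ∈ A.Ω) {θ : ℝ}
    (hθ : θ ∈ Set.Icc (A.β k Y) (A.β (k + 1) Y)) (hr : OnRay θ Y.1) :
    A.s k Y = (((‖Y.1‖ ^ ((N : ℝ)⁻¹) : ℝ) : ℂ) * Complex.exp ((θ / N : ℝ) * Complex.I), Y.2) := by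
  rw [s, wroot_eq A.N_pos _ hr]
  have := A.β_lt k hk Y hY
  have := A.β_width k hk Y hY
  rw [abs_lt]; constructor <;> linarith [hθ.1, hθ.2]

lemma s_pow (k : ℕ) (Y : ℂ × ℝ) : ((A.s k Y).1 ^ N, (A.s k Y).2) = Y :=
  Prod.ext (wroot_pow A.N_pos _ _) rfl

lemma exp_div_add (θ : ℝ) (hN : 0 < N) :
    Complex.exp (((θ + 2 * Real.pi * N) / N : ℝ) * Complex.I) =
      Complex.exp ((θ / N : ℝ) * Complex.I) := by
  rw [Complex.exp_eq_exp_iff_exists_int]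
  have : (N : ℂ) ≠ 0 := by exact_mod_cast hN.ne'
  exact ⟨1, by push_cast; field_simp⟩

lemma β_of_eq {k : ℕ} (hk : k = K) {Y : ℂ × ℝ} (hY : Y ∈ A.Ω) :
    A.β k Y = A.β 0 Y + 2 * Real.pi * N := by
  rw [← A.β_last Y hY]; exact congrArg (A.β · Y) hk

/-- The roots on two neighbouring wedges agree on the common ray because both have angle `β / N`
there. At the closing ray the angles differ by `2πN`, which becomes a full turn after division by
`N`. -/
lemma s_succ {k l : ℕ} (hk : k < K) (hl : l < K) (hkl : (k + 1) % K = l) {Y : ℂ × ℝ}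
    (hY : Y ∈ A.Ω) (hr : OnRay (A.β l Y) Y.1) : A.s k Y = A.s l Y := by
  have h1 := A.β_lt k hk Y hY
  have h2 := A.β_lt l hl Y hY
  rw [A.s_eq hl hY ⟨le_rfl, h2.le⟩ hr]
  rcases Nat.lt_or_ge (k + 1) K with h | h
  · rw [Nat.mod_eq_of_lt h] at hkl
    subst hkl
    exact A.s_eq hk hY ⟨h1.le, le_rfl⟩ hr
  · have hK : k + 1 = K := by omega
    have hl0 : l = 0 := by rw [← hkl, hK, Nat.mod_self]
    subst hl0
    have hr' := hr.add_two_pi_mul N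
    rw [← A.β_of_eq hK hY] at hr'
    rw [A.s_eq hk hY ⟨h1.le, le_rfl⟩ hr', A.β_of_eq hK hY, exp_div_add _ A.N_pos]

lemma β_strictMono {Y : ℂ × ℝ} (hY : Y ∈ A.Ω) {k l : ℕ} (hkl : k < l) (hl : l ≤ K) :
    A.β k Y < A.β l Y := by
  induction l, hkl using Nat.le_induction with
  | base => exact A.β_lt k (by omega) Y hY
  | succ l h ih => exact (ih (by omega)).trans (A.β_lt l (by omega) Y hY)

lemma β_mono {Y : ℂ × ℝ} (hY : Y ∈ A.Ω) {k l : ℕ} (hkl : k ≤ l) (hl : l ≤ K) :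
    A.β k Y ≤ A.β l Y := by
  rcases hkl.eq_or_lt with rfl | h
  · exact le_rfl
  · exact (A.β_strictMono hY h hl).le

lemma mk_e_eq_of_angle_eq {Y : ℂ × ℝ} (hY : Y ∈ A.Ω) {k l : ℕ} (hkl : k < l) (hl : l < K) {θ : ℝ}
    (h1 : θ ≤ A.β (k + 1) Y) (h2 : A.β l Y ≤ θ) (hr : OnRay θ Y.1) :
    Quot.mk r (A.e k Y) = Quot.mk r (A.e l Y) := by
  have h3 : l = k + 1 := by
    by_contra h
    have := A.β_strictMono hY (show k + 1 < l by omega) hl.le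
    linarith
  subst h3
  have h4 : θ = A.β (k + 1) Y := le_antisymm h1 h2
  exact A.glue k (by omega) _ hl (Nat.mod_eq_of_lt hl) Y hY (h4 ▸ hr)

lemma mk_e_eq_zero {Y : ℂ × ℝ} (hY : Y ∈ A.Ω) (h0 : Y.1 = 0) {k : ℕ} (hk : k < K) :
    Quot.mk r (A.e k Y) = Quot.mk r (A.e 0 Y) := by
  induction k with
  | zero => rfl
  | succ k ih =>
    rw [← ih (by omega)]
    exact (A.glue k (by omega) _ hk (Nat.mod_eq_of_lt hk) Y hY (h0 ▸ onRay_zero _)).symm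

/-- Injectivity of the chart. Off the axis, equal roots force the angles to agree modulo `2πN`, and
all angles lie in an interval of exactly that length. Either they coincide, and then the pieces are
equal or consecutive since every wedge has positive width, or they are the two ends of the interval,
which are glued. -/
lemma mk_e_eq {Y : ℂ × ℝ} (hY : Y ∈ A.Ω) {k l : ℕ} (hk : k < K) (hl : l < K)
    (hwk : InWedge (A.β k Y) (A.β (k + 1) Y) Y.1) (hwl : InWedge (A.β l Y) (A.β (l + 1) Y) Y.1)
    (hs : A.s k Y = A.s l Y) : Quot.mk r (A.e k Y) = Quot.mk r (A.e l Y) := by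
  by_cases h0 : Y.1 = 0
  · rw [A.mk_e_eq_zero hY h0 hk, A.mk_e_eq_zero hY h0 hl]
  obtain ⟨θ, hθ, hr⟩ := hwk
  obtain ⟨θ', hθ', hr'⟩ := hwl
  rw [A.s_eq hk hY hθ hr, A.s_eq hl hY hθ' hr'] at hs
  have hpos : (0 : ℝ) < ‖Y.1‖ ^ ((N : ℝ)⁻¹) := Real.rpow_pos_of_pos (norm_pos_iff.mpr h0) _
  have hexp := mul_left_cancel₀ (Complex.ofReal_ne_zero.mpr hpos.ne') (Prod.ext_iff.mp hs).1
  rw [Complex.exp_eq_exp_iff_exists_int] at hexp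
  obtain ⟨n, hn⟩ := hexp
  have hNr : (0 : ℝ) < N := by exact_mod_cast A.N_pos
  have hn' : θ = θ' + n * (2 * Real.pi * N) := by
    have h1 : ((θ / N : ℝ) : ℂ) = ((θ' / N + n * (2 * Real.pi) : ℝ) : ℂ) := by
      apply mul_right_cancel₀ Complex.I_ne_zero
      rw [hn]; push_cast; ring
    have h2 := Complex.ofReal_injective h1
    field_simp at h2
    linarith
  have hbound : ∀ {k : ℕ} {θ : ℝ}, k < K → θ ∈ Set.Icc (A.β k Y) (A.β (k + 1) Y) →
      A.β 0 Y ≤ θ ∧ θ ≤ A.β 0 Y + 2 * Real.pi * N := by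
    intro k θ hk hθ
    rw [← A.β_last Y hY]
    exact ⟨(A.β_mono hY (Nat.zero_le k) hk.le).trans hθ.1,
      hθ.2.trans (A.β_mono hY (by omega) le_rfl)⟩
  have hb := hbound hk hθ
  have hb' := hbound hl hθ'
  have hT : 0 < 2 * Real.pi * N := by positivity
  -- the case in which the two angles are at the two ends
  have hends : ∀ {k l : ℕ} {θ θ' : ℝ}, k < K → l < K → θ ∈ Set.Icc (A.β k Y) (A.β (k + 1) Y) →
      θ' ∈ Set.Icc (A.β l Y) (A.β (l + 1) Y) → OnRay θ Y.1 → θ ≤ A.β 0 Y →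
      A.β 0 Y + 2 * Real.pi * N ≤ θ' → Quot.mk r (A.e l Y) = Quot.mk r (A.e k Y) := by
    intro k l θ θ' hk hl hθ hθ' hr h1 h2
    have hk0 : k = 0 := by
      by_contra h
      have := A.β_strictMono hY (show 0 < k by omega) hk.le
      linarith [hθ.1]
    have hlK : l + 1 = K := by
      by_contra h
      have := A.β_strictMono hY (show l + 1 < K by omega) le_rfl
      rw [A.β_last Y hY] at this
      linarith [hθ'.2]
    subst hk0
    have : θ = A.β 0 Y := le_antisymm h1 hθ.1
    exact A.glue l hl 0 hk (by rw [hlK, Nat.mod_self]) Y hY (this ▸ hr)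
  rcases lt_trichotomy n 0 with hneg | rfl | hpos'
  · have : (n : ℝ) ≤ -1 := by exact_mod_cast Int.le_sub_one_of_lt hneg
    have h3 : (n : ℝ) * (2 * Real.pi * N) ≤ -1 * (2 * Real.pi * N) :=
      mul_le_mul_of_nonneg_right this hT.le
    exact (hends hk hl hθ hθ' hr (by linarith [hb'.2]) (by linarith [hb.1])).symm
  · have h4 : θ = θ' := by simpa using hn'
    subst h4
    rcases lt_trichotomy k l with h | rfl | h
    · exact A.mk_e_eq_of_angle_eq hY h hl hθ.2 hθ'.1 hr
    · rfl
    · exact (A.mk_e_eq_of_angle_eq hY h hk hθ'.2 hθ.1 hr).symm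
  · have : (1 : ℝ) ≤ n := by exact_mod_cast hpos'
    have h3 : 1 * (2 * Real.pi * N) ≤ (n : ℝ) * (2 * Real.pi * N) :=
      mul_le_mul_of_nonneg_right this hT.le
    exact hends hl hk hθ' hθ hr' (by linarith [hb.2]) (by linarith [hb'.1])

/-- The domain of the model: the preimage of `Ω` under the standard branching map. -/
def V : Set (ℂ × ℝ) := {v | (v.1 ^ N, v.2) ∈ A.Ω}

lemma isOpen_V : IsOpen A.V :=
  A.isOpen_Ω.preimage (by fun_prop : Continuous fun v : ℂ × ℝ => (v.1 ^ N, v.2))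

/-- The point `v` of the model lies in the lift of the `k`-th wedge. -/
def InPiece (k : ℕ) (v : ℂ × ℝ) : Prop :=
  ∃ θ ∈ Set.Icc (A.β k (v.1 ^ N, v.2)) (A.β (k + 1) (v.1 ^ N, v.2)), OnRay (θ / N) v.1

lemma InPiece.inWedge {k : ℕ} {v : ℂ × ℝ} (h : A.InPiece k v) :
    InWedge (A.β k (v.1 ^ N, v.2)) (A.β (k + 1) (v.1 ^ N, v.2)) (v.1 ^ N) := by
  obtain ⟨θ, hθ, hr⟩ := h
  refine ⟨θ, hθ, ?_⟩
  have hN : (N : ℂ) ≠ 0 := by exact_mod_cast A.N_pos.ne'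
  unfold OnRay at *
  rw [norm_pow]
  conv_lhs => rw [hr]
  rw [mul_pow, ← Complex.exp_nat_mul]
  push_cast
  congr 2
  field_simp

lemma InPiece.s_eq {k : ℕ} (hk : k < K) {v : ℂ × ℝ} (hv : v ∈ A.V) (h : A.InPiece k v) :
    A.s k (v.1 ^ N, v.2) = v := by
  obtain ⟨θ, hθ, hr⟩ := h
  have hw : OnRay θ (v.1 ^ N) := by
    have hN : (N : ℂ) ≠ 0 := by exact_mod_cast A.N_pos.ne'
    unfold OnRay at *
    rw [norm_pow]
    conv_lhs => rw [hr]
    rw [mul_pow, ← Complex.exp_nat_mul]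
    push_cast
    congr 2
    field_simp
  rw [A.s_eq hk hv hθ hw]
  refine Prod.ext ?_ rfl
  simp only [norm_pow]
  rw [Real.pow_rpow_inv_natCast (norm_nonneg _) A.N_pos.ne']
  exact hr.symm

lemma inPiece_s {k : ℕ} (hk : k < K) {Y : ℂ × ℝ} (hY : Y ∈ A.Ω)
    (hw : InWedge (A.β k Y) (A.β (k + 1) Y) Y.1) : A.InPiece k (A.s k Y) := by
  obtain ⟨θ, hθ, hr⟩ := hw
  refine ⟨θ, by rwa [A.s_pow], ?_⟩
  rw [A.s_eq hk hY hθ hr]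
  simp only [OnRay]
  rw [norm_mul, Complex.norm_exp_ofReal_mul_I, mul_one, Complex.norm_real,
    Real.norm_of_nonneg (by positivity)]

lemma exists_le_lt {b : ℕ → ℝ} {K : ℕ} {θ : ℝ} (h0 : b 0 ≤ θ) (hK : θ < b K) :
    ∃ k < K, b k ≤ θ ∧ θ < b (k + 1) := by
  induction K with
  | zero => linarith
  | succ K ih =>
    rcases lt_or_ge θ (b K) with h | h
    · obtain ⟨k, hk, h'⟩ := ih h
      exact ⟨k, by omega, h'⟩
    · exact ⟨K, by omega, h, hK⟩

lemma exists_inPiece {v : ℂ × ℝ} (hv : v ∈ A.V) : ∃ k < K, A.InPiece k v := by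
  have hT : 0 < 2 * Real.pi * N := by have := A.N_pos; positivity
  set Y : ℂ × ℝ := (v.1 ^ N, v.2) with hYdef
  have hY : Y ∈ A.Ω := hv
  -- The angle `N arg v` of `vᴺ` may be changed only by multiples of `2πN`, since the angle of `v`
  -- itself matters modulo `2π`.
  obtain ⟨n, hn, -⟩ := existsUnique_add_zsmul_mem_Ico hT (N * Complex.arg v.1) (A.β 0 Y)
  rw [← A.β_last Y hY] at hn
  obtain ⟨k, hk, h1, h2⟩ := exists_le_lt (b := fun k => A.β k Y) hn.1 hn.2
  refine ⟨k, hk, _, ⟨h1, h2.le⟩, ?_⟩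
  have hN : (N : ℂ) ≠ 0 := by exact_mod_cast A.N_pos.ne'
  unfold OnRay
  conv_lhs => rw [← Complex.norm_mul_exp_arg_mul_I v.1]
  congr 1
  rw [Complex.exp_eq_exp_iff_exists_int]
  refine ⟨-n, ?_⟩
  simp only [zsmul_eq_mul]
  push_cast
  field_simp
  ring

/-- The conditions on a point together with an angle are closed, and the piece is their projection
along the compact interval `[-C, C]`. -/
lemma isClosed_inPiece {k : ℕ} (hk : k < K) :
    IsClosed {v : A.V | A.InPiece k v} := by
  have hN := A.N_pos
  let S : Set (A.V × Set.Icc (-A.C) A.C) := {x | (x.2 : ℝ) ∈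
      Set.Icc (A.β k (x.1.1.1 ^ N, x.1.1.2)) (A.β (k + 1) (x.1.1.1 ^ N, x.1.1.2)) ∧
    OnRay ((x.2 : ℝ) / N) x.1.1.1}
  have hb : ∀ l ≤ K, Continuous fun v : A.V => A.β l (v.1.1 ^ N, v.1.2) := fun l hl =>
    (A.β_cont l hl).comp_continuous (by fun_prop) fun v => v.2
  have hS : IsClosed S := by
    refine IsClosed.inter (IsClosed.inter ?_ ?_) ?_
    · exact isClosed_le ((hb k hk.le).comp continuous_fst) (by fun_prop)
    · exact isClosed_le (by fun_prop) ((hb (k + 1) hk).comp continuous_fst)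
    · exact isClosed_eq (by fun_prop) (by fun_prop)
  have : {v : A.V | A.InPiece k v} = Prod.fst '' S := by
    ext v
    constructor
    · rintro ⟨θ, hθ, hr⟩
      exact ⟨(v, ⟨θ, (A.β_bdd k hk.le _ v.2).1.trans hθ.1,
        hθ.2.trans (A.β_bdd (k + 1) hk _ v.2).2⟩), ⟨hθ, hr⟩, rfl⟩
    · rintro ⟨⟨v, θ⟩, ⟨hθ, hr⟩, rfl⟩
      exact ⟨θ, hθ, hr⟩
  rw [this]
  exact isClosedMap_fst_of_compactSpace _ hS

lemma continuousOn_s {k : ℕ} (hk : k < K) :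
    ContinuousOn (A.s k) {Y | Y ∈ A.Ω ∧ InWedge (A.β k Y) (A.β (k + 1) Y) Y.1} := by
  rintro Y ⟨hY, hw⟩
  have hsub : {Y | Y ∈ A.Ω ∧ InWedge (A.β k Y) (A.β (k + 1) Y) Y.1} ⊆ A.Ω := fun _ h => h.1
  refine ContinuousWithinAt.prodMk (continuousWithinAt_wroot A.N_pos ?_
    continuous_fst.continuousWithinAt ?_) continuous_snd.continuousWithinAt
  · exact ((((A.β_cont k hk.le).mono hsub).add ((A.β_cont (k + 1) hk).mono hsub)).div_const 2)
      Y ⟨hY, hw⟩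
  · rcases eq_or_ne Y.1 0 with h0 | h0
    · exact Or.inl h0
    right
    obtain ⟨θ, hθ, hr⟩ := hw
    have h1 := A.β_lt k hk Y hY
    have h2 := A.β_width k hk Y hY
    have hpos : 0 < ‖Y.1‖ := norm_pos_iff.mpr h0
    set c := (A.β k Y + A.β (k + 1) Y) / 2 with hc
    have h3 : Y.1 * Complex.exp (-(c * Complex.I)) =
        ‖Y.1‖ * Complex.exp (((θ - c : ℝ) : ℂ) * Complex.I) := by
      conv_lhs => rw [hr]
      rw [mul_assoc, ← Complex.exp_add]; congr 2; push_cast; ring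
    rw [Complex.mem_slitPlane_iff_arg, h3, Complex.arg_real_mul _ hpos, Complex.arg_exp_mul_I,
      (toIocMod_eq_self _).mpr ⟨by linarith [hθ.1], by linarith [hθ.2]⟩]
    refine ⟨by linarith [hθ.2], mul_ne_zero ?_ (Complex.exp_ne_zero _)⟩
    exact_mod_cast hpos.ne'

open Classical in
/-- The map from the union of the pieces to the model. -/
def toModel (p : P) : ℂ × ℝ :=
  if h : ∃ k < K, p ∈ A.O k then A.s h.choose (A.d h.choose p) else 0

lemma toModel_eq {k : ℕ} (hk : k < K) {p : P} (hp : p ∈ A.O k) :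
    A.toModel p = A.s k (A.d k p) := by
  have h : ∃ k < K, p ∈ A.O k := ⟨k, hk, hp⟩
  have he : h.choose = k := A.disj _ h.choose_spec.1 k hk p h.choose_spec.2 hp
  rw [toModel, dif_pos h, he]

/-- By saturation a relation never joins a piece to its complement, so the default value `0` outside
the pieces is harmless. -/
lemma toModel_eq_of_rel {p q : P} (h : r p q) : A.toModel p = A.toModel q := by
  have key : ∀ p q, (r p q ∨ r q p) → ∀ k < K, p ∈ A.O k → A.toModel p = A.toModel q := by
    intro p q hpq k hk hp
    obtain ⟨l, hl, hq, hd, h⟩ := A.sat k hk p hp q hpq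
    rw [A.toModel_eq hk hp, A.toModel_eq hl hq, hd]
    rcases h with ⟨h1, h2⟩ | ⟨h1, h2⟩
    · exact A.s_succ hk hl h1 (A.d_mem k hk p hp) h2
    · exact (A.s_succ hl hk h1 (A.d_mem k hk p hp) h2).symm
  by_cases hp : ∃ k < K, p ∈ A.O k
  · obtain ⟨k, hk, hp⟩ := hp
    exact key p q (Or.inl h) k hk hp
  · by_cases hq : ∃ k < K, q ∈ A.O k
    · obtain ⟨k, hk, hq⟩ := hq
      exact (key q p (Or.inr h) k hk hq).symm
    · rw [toModel, toModel, dif_neg hp, dif_neg hq]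

/-- The neighbourhood of the axis in the glued space. -/
def nbhd : Set (Quot r) := {x | ∃ k < K, ∃ p ∈ A.O k, Quot.mk r p = x}

/-- The chart of the glued space near the axis. -/
def glued : Quot r → ℂ × ℝ := Quot.lift A.toModel fun _ _ h => A.toModel_eq_of_rel h

/-- Equality in the quotient is the generated equivalence relation; `sat` handles one step and
induction the rest. Thus the preimage of `nbhd` is exactly the union of the open pieces. -/
lemma mem_nbhd_iff {p : P} : Quot.mk r p ∈ A.nbhd ↔ ∃ k < K, p ∈ A.O k := by
  constructor
  · rintro ⟨k, hk, q, hq, he⟩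
    have step : ∀ a b, (r a b ∨ r b a) → (∃ k < K, a ∈ A.O k) → ∃ k < K, b ∈ A.O k := by
      rintro a b hab ⟨k, hk, ha⟩
      obtain ⟨l, hl, hb, -⟩ := A.sat k hk a ha b hab
      exact ⟨l, hl, hb⟩
    have : ∀ a b, Relation.EqvGen r a b → ((∃ k < K, a ∈ A.O k) ↔ ∃ k < K, b ∈ A.O k) := by
      intro a b h
      induction h with
      | rel a b h => exact ⟨step a b (Or.inl h), step b a (Or.inr h)⟩
      | refl a => exact Iff.rfl
      | symm a b _ ih => exact ih.symm
      | trans a b c _ _ ih1 ih2 => exact ih1.trans ih2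
    exact (this q p (Quot.eqvGen_exact he)).mp ⟨k, hk, hq⟩
  · rintro ⟨k, hk, hp⟩
    exact ⟨k, hk, p, hp, rfl⟩

lemma isOpen_nbhd : IsOpen A.nbhd := by
  refine isOpen_coinduced.mpr ?_
  have : Quot.mk r ⁻¹' A.nbhd = ⋃ k, ⋃ _ : k < K, A.O k := by
    ext p; rw [Set.mem_preimage, mem_nbhd_iff]; simp
  rw [this]
  exact isOpen_iUnion fun k => isOpen_iUnion fun hk => A.isOpen_O k hk

lemma glued_mk {k : ℕ} (hk : k < K) {p : P} (hp : p ∈ A.O k) :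
    A.glued (Quot.mk r p) = A.s k (A.d k p) := A.toModel_eq hk hp

lemma glued_pow {k : ℕ} (hk : k < K) {p : P} (hp : p ∈ A.O k) :
    ((A.glued (Quot.mk r p)).1 ^ N, (A.glued (Quot.mk r p)).2) = A.d k p := by
  rw [A.glued_mk hk hp, A.s_pow]

lemma continuousOn_glued : ContinuousOn A.glued A.nbhd := by
  refine (continuousOn_open_iff A.isOpen_nbhd).mpr fun B hB => isOpen_coinduced.mpr ?_
  have : Quot.mk r ⁻¹' (A.nbhd ∩ A.glued ⁻¹' B) =
      ⋃ k, ⋃ _ : k < K, (A.O k ∩ (fun p => A.s k (A.d k p)) ⁻¹' B) := by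
    ext p
    simp only [Set.mem_preimage, Set.mem_inter_iff, mem_nbhd_iff, Set.mem_iUnion, exists_prop]
    constructor
    · rintro ⟨⟨k, hk, hp⟩, hB⟩
      exact ⟨k, hk, hp, A.glued_mk hk hp ▸ hB⟩
    · rintro ⟨k, hk, hp, hB⟩
      exact ⟨⟨k, hk, hp⟩, (A.glued_mk hk hp).symm ▸ hB⟩
  rw [this]
  refine isOpen_iUnion fun k => isOpen_iUnion fun hk => ?_
  refine ContinuousOn.isOpen_inter_preimage ?_ (A.isOpen_O k hk) hB
  exact (A.continuousOn_s hk).comp (A.d_cont k hk)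
    fun p hp => ⟨A.d_mem k hk p hp, A.d_wedge k hk p hp⟩

/-- The inverse of the chart. -/
def unglue (v : A.V) : Quot r :=
  Quot.mk r (A.e (A.exists_inPiece v.2).choose (v.1.1 ^ N, v.1.2))

lemma unglue_eq {k : ℕ} (hk : k < K) {v : A.V} (h : A.InPiece k v) :
    A.unglue v = Quot.mk r (A.e k (v.1.1 ^ N, v.1.2)) := by
  have hc := (A.exists_inPiece v.2).choose_spec
  refine A.mk_e_eq v.2 hc.1 hk hc.2.inWedge h.inWedge ?_
  rw [InPiece.s_eq A hc.1 v.2 hc.2, InPiece.s_eq A hk v.2 h]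

/-- The inverse is continuous on each of finitely many closed pieces that cover the model, and by
`unglue_eq` it does not depend on the piece chosen. -/
lemma continuous_unglue : Continuous A.unglue := by
  have hlf : LocallyFinite fun k : Fin K => {v : A.V | A.InPiece k v} := locallyFinite_of_finite _
  refine hlf.continuous ?_ (fun k => A.isClosed_inPiece k.2) fun k => ?_
  · ext v
    obtain ⟨k, hk, h⟩ := A.exists_inPiece v.2
    simp only [Set.mem_iUnion, Set.mem_univ, iff_true]
    exact ⟨⟨k, hk⟩, h⟩
  · refine ContinuousOn.congr (f := fun v : A.V => Quot.mk r (A.e k (v.1.1 ^ N, v.1.2))) ?_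
      fun v hv => A.unglue_eq k.2 hv
    refine continuous_quot_mk.comp_continuousOn ((A.e_cont k k.2).comp ?_ ?_)
    · exact Continuous.continuousOn (by fun_prop)
    · intro v hv
      exact ⟨v.2, InPiece.inWedge A hv⟩

lemma glued_mem {x : Quot r} (hx : x ∈ A.nbhd) : A.glued x ∈ A.V := by
  obtain ⟨k, hk, p, hp, rfl⟩ := hx
  change ((A.glued (Quot.mk r p)).1 ^ N, (A.glued (Quot.mk r p)).2) ∈ A.Ω
  rw [A.glued_pow hk hp]
  exact A.d_mem k hk p hp

lemma unglue_glued {x : Quot r} (hx : x ∈ A.nbhd) : A.unglue ⟨A.glued x, A.glued_mem hx⟩ = x := by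
  obtain ⟨k, hk, p, hp, rfl⟩ := hx
  have h : A.InPiece k (A.glued (Quot.mk r p)) := by
    rw [A.glued_mk hk hp]
    exact A.inPiece_s hk (A.d_mem k hk p hp) (A.d_wedge k hk p hp)
  rw [A.unglue_eq hk h]
  simp only
  rw [A.glued_pow hk hp, A.e_d k hk p hp]

lemma unglue_mem (v : A.V) : A.unglue v ∈ A.nbhd := by
  obtain ⟨k, hk, h⟩ := A.exists_inPiece v.2
  rw [A.unglue_eq hk h]
  exact ⟨k, hk, _, A.e_mem k hk _ v.2 h.inWedge, rfl⟩

lemma glued_unglue (v : A.V) : A.glued (A.unglue v) = v := by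
  obtain ⟨k, hk, h⟩ := A.exists_inPiece v.2
  rw [A.unglue_eq hk h, A.glued_mk hk (A.e_mem k hk _ v.2 h.inWedge),
    A.d_e k hk _ v.2 h.inWedge, InPiece.s_eq A hk v.2 h]

lemma isOpenEmbedding_glued : Topology.IsOpenEmbedding (A.nbhd.domRestrict A.glued) := by
  refine .of_continuous_injective_isOpenMap ?_ ?_ ?_
  · exact continuousOn_iff_continuous_domRestrict.mp A.continuousOn_glued
  · rintro ⟨x, hx⟩ ⟨y, hy⟩ hxy
    have hxy : A.glued x = A.glued y := hxy
    apply Subtype.ext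
    change x = y
    rw [← A.unglue_glued hx, ← A.unglue_glued hy]
    congr 1
    exact Subtype.ext hxy
  · intro W hW
    have : A.nbhd.domRestrict A.glued '' W =
        Subtype.val '' ((fun v : A.V => (⟨A.unglue v, A.unglue_mem v⟩ : A.nbhd)) ⁻¹' W) := by
      ext v
      constructor
      · rintro ⟨⟨x, hx⟩, hW, rfl⟩
        refine ⟨⟨A.glued x, A.glued_mem hx⟩, ?_, rfl⟩
        have : (⟨A.unglue ⟨A.glued x, A.glued_mem hx⟩, A.unglue_mem _⟩ : A.nbhd) = ⟨x, hx⟩ :=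
          Subtype.ext (A.unglue_glued hx)
        rw [Set.mem_preimage, this]
        exact hW
      · rintro ⟨v, hv, rfl⟩
        exact ⟨_, hv, A.glued_unglue v⟩
    rw [this]
    refine A.isOpen_V.isOpenMap_subtype_val _ (hW.preimage ?_)
    exact A.continuous_unglue.subtype_mk _

end WedgeCycle

end

section

/-! ### Rays and wedges through multipliers -/

/-- The point `Y` lies on the curved half-plane of multiplier `γ` bounded by the axis: the product of
its first coordinate with the multiplier is a nonnegative real number. -/
def OnSheet (γ : ℂ × ℝ → ℂ) (Y : ℂ × ℝ) : Prop := (Y.1 * γ Y).im = 0 ∧ 0 ≤ (Y.1 * γ Y).re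

/-- A multiplier of argument `-a` rotates the ray of angle `a` onto the positive real axis, so the
position of `z` relative to that ray is read off from the sine and cosine of `θ - a`. -/
lemma mul_polar {z g : ℂ} {r a θ : ℝ} (hg : g = r * Complex.exp (-(a * Complex.I)))
    (hz : OnRay θ z) : z * g = ((‖z‖ * r : ℝ) : ℂ) * Complex.exp ((θ - a : ℝ) * Complex.I) := by
  unfold OnRay at hz
  conv_lhs => rw [hz, hg]
  have : Complex.exp ((θ - a : ℝ) * Complex.I) =
      Complex.exp (θ * Complex.I) * Complex.exp (-(a * Complex.I)) := by
    rw [← Complex.exp_add]; congr 1; push_cast; ring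
  rw [this]; push_cast; ring

lemma mul_polar_im {z g : ℂ} {r a θ : ℝ} (hg : g = r * Complex.exp (-(a * Complex.I)))
    (hz : OnRay θ z) : (z * g).im = ‖z‖ * r * Real.sin (θ - a) := by
  rw [mul_polar hg hz, Complex.im_ofReal_mul, Complex.exp_ofReal_mul_I_im]

lemma mul_polar_re {z g : ℂ} {r a θ : ℝ} (hg : g = r * Complex.exp (-(a * Complex.I)))
    (hz : OnRay θ z) : (z * g).re = ‖z‖ * r * Real.cos (θ - a) := by
  rw [mul_polar hg hz, Complex.re_ofReal_mul, Complex.exp_ofReal_mul_I_re]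

lemma exists_onRay_mem_Ico (z : ℂ) (a : ℝ) : ∃ θ ∈ Set.Ico a (a + 2 * Real.pi), OnRay θ z := by
  obtain ⟨n, hn, -⟩ := existsUnique_add_zsmul_mem_Ico Real.two_pi_pos z.arg a
  refine ⟨_, hn, ?_⟩
  unfold OnRay
  conv_lhs => rw [← Complex.norm_mul_exp_arg_mul_I z]
  congr 1
  rw [Complex.exp_eq_exp_iff_exists_int]
  refine ⟨-n, ?_⟩
  simp only [zsmul_eq_mul]; push_cast; ring

lemma onRay_iff {z g : ℂ} {r a : ℝ} (hr : 0 < r) (hg : g = r * Complex.exp (-(a * Complex.I))) :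
    OnRay a z ↔ (z * g).im = 0 ∧ 0 ≤ (z * g).re := by
  constructor
  · intro h
    rw [mul_polar_im hg h, mul_polar_re hg h]
    simp only [sub_self, Real.sin_zero, Real.cos_zero, mul_zero, mul_one, true_and]
    positivity
  · rintro ⟨h1, h2⟩
    rcases eq_or_ne z 0 with rfl | h0
    · exact onRay_zero _
    have hpos : 0 < ‖z‖ * r := by positivity
    have h3 : z * g = ((z * g).re : ℂ) := Complex.ext (by simp) (by simp [h1])
    have hn : ‖z * g‖ = ‖z‖ * r := by
      rw [norm_mul, hg, norm_mul, ← neg_mul, ← Complex.ofReal_neg,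
        Complex.norm_exp_ofReal_mul_I, mul_one, Complex.norm_real, Real.norm_of_nonneg hr.le]
    have h4 : (z * g).re = ‖z‖ * r := by
      rw [← hn, h3, Complex.norm_real, Complex.ofReal_re, Real.norm_of_nonneg h2]
    rw [h4, hg] at h3
    unfold OnRay
    have hr' : (r : ℂ) ≠ 0 := by exact_mod_cast hr.ne'
    have h5 : z * Complex.exp (-(a * Complex.I)) = ‖z‖ := by
      apply mul_left_cancel₀ hr'
      push_cast at h3
      linear_combination h3
    rw [← h5, mul_assoc, ← Complex.exp_add]; simp

/-- A wedge of width at most `π` is an intersection of two half-planes. Width exactly `π` is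
allowed, as the slabs require; the two half-planes then coincide. -/
lemma inWedge_iff {z g g' : ℂ} {r r' a a' : ℝ} (hr : 0 < r) (hr' : 0 < r')
    (hg : g = r * Complex.exp (-(a * Complex.I))) (hg' : g' = r' * Complex.exp (-(a' * Complex.I)))
    (h1 : a < a') (h2 : a' ≤ a + Real.pi) :
    InWedge a a' z ↔ 0 ≤ (z * g).im ∧ (z * g').im ≤ 0 := by
  constructor
  · rintro ⟨θ, hθ, hz⟩
    rw [mul_polar_im hg hz, mul_polar_im hg' hz]
    constructor
    · have := Real.sin_nonneg_of_nonneg_of_le_pi (x := θ - a) (by linarith [hθ.1])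
        (by linarith [hθ.2])
      positivity
    · have := Real.sin_nonpos_of_nonpos_of_neg_pi_le (x := θ - a') (by linarith [hθ.2])
        (by linarith [hθ.1])
      exact mul_nonpos_of_nonneg_of_nonpos (by positivity) this
  · rintro ⟨h3, h4⟩
    rcases eq_or_ne z 0 with rfl | h0
    · exact ⟨a, ⟨le_rfl, h1.le⟩, onRay_zero _⟩
    have hpos : 0 < ‖z‖ := norm_pos_iff.mpr h0
    obtain ⟨θ, hθ, hz⟩ := exists_onRay_mem_Ico z a
    rw [mul_polar_im hg hz] at h3
    rw [mul_polar_im hg' hz] at h4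
    have h3' : 0 ≤ Real.sin (θ - a) := nonneg_of_mul_nonneg_right h3 (by positivity)
    have h4' : Real.sin (θ - a') ≤ 0 := by
      by_contra h; push Not at h
      have : 0 < ‖z‖ * r' * Real.sin (θ - a') := by positivity
      linarith
    refine ⟨θ, ⟨hθ.1, ?_⟩, hz⟩
    by_contra h; push Not at h
    rcases lt_or_ge (θ - a') Real.pi with h5 | h5
    · have := Real.sin_pos_of_pos_of_lt_pi (x := θ - a') (by linarith) h5
      linarith
    · have h6 : Real.sin (θ - a) = -Real.sin (θ - a - Real.pi) := by
        rw [Real.sin_sub_pi]; ring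
      have := Real.sin_pos_of_pos_of_lt_pi (x := θ - a - Real.pi) (by linarith)
        (by linarith [hθ.2])
      linarith

/-! ### Cycles of cells around an edge -/

variable {m : ℕ} {w : ZMod m → Flip}

/-- Local data for `K` realised cells that are arranged cyclically around an edge point. The cell
`cell k` contains the edge point with Heisenberg coordinates `q k`; the CR transformation of
`D k` develops it to the point `(0, t₀)` of the axis, and the cell to the wedge between the sheets
of multipliers `γ k` and `γ (k + 1)`, which leave the axis at `(0, t₀)` in the directions `b k` and
`b (k + 1)`. -/
structure EdgeCycle (w : ZMod m → Flip) (K N : ℕ) (t₀ : ℝ) where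
  cell : ℕ → Cell w
  D : ℕ → Matrix (Fin 3) (Fin 3) ℂ
  q : ℕ → ℂ × ℝ
  γ : ℕ → ℂ × ℝ → ℂ
  b : ℕ → ℝ
  K_pos : 0 < K
  N_pos : 0 < N
  unit : ∀ k < K, IsUnit21 (D k)
  dev : ∀ k < K, crMap (D k) (q k) = pt 0 t₀
  not_vertex : ∀ k < K, (q k : Hbar) ∉ (cell k).vertices
  -- A cell may occur several times around the edge, but then with different edge points.
  inj : ∀ k < K, ∀ l < K, cell k = cell l → q k = q l → k = l
  γ_cont : ∀ k ≤ K, Continuous (γ k)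
  γ_base : ∀ k ≤ K, ∃ r : ℝ, 0 < r ∧ γ k (0, t₀) = r * Complex.exp (-(b k * Complex.I))
  b_lt : ∀ k < K, b k < b (k + 1)
  -- A width below `π` persists at nearby points. Width exactly `π` would not be stable, so it is
  -- admitted only when the two sheets are halves of one surface, with opposite multipliers.
  b_width : ∀ k < K, b (k + 1) < b k + Real.pi ∨
    ((∀ Y, γ (k + 1) Y = -γ k Y) ∧ b (k + 1) = b k + Real.pi)
  γ_last : γ K = γ 0
  b_last : b K = b 0 + 2 * Real.pi * N
  body : ∀ k < K, ∀ᶠ x : ℂ × ℝ in 𝓝 (q k), (x : Hbar) ∈ (cell k).body ↔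
    0 ≤ ((cm (D k) x).1 * γ k (cm (D k) x)).im ∧
      ((cm (D k) x).1 * γ (k + 1) (cm (D k) x)).im ≤ 0
  -- The fields `out` and `inn` say that near the edge no face pairing leaves the cycle; `link` says
  -- that consecutive cells are indeed paired, in one direction or the other.
  out : ∀ k < K, ∀ᶠ x : ℂ × ℝ in 𝓝 (q k), ∀ d F G, FacePairing w (cell k) d F G → (x : Hbar) ∈ F →
    ∃ l < K, d = cell l ∧ crMap (D k) = crMap (D l) ∘ G ∧
      (((k + 1) % K = l ∧ OnSheet (γ l) (cm (D k) x)) ∨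
        ((l + 1) % K = k ∧ OnSheet (γ k) (cm (D k) x)))
  inn : ∀ k < K, ∀ᶠ x : ℂ × ℝ in 𝓝 (q k), ∀ d F G, FacePairing w d (cell k) F G →
    (x : Hbar) ∈ G '' F →
    ∃ l < K, d = cell l ∧ crMap (D l) = crMap (D k) ∘ G ∧
      (((k + 1) % K = l ∧ OnSheet (γ l) (cm (D k) x)) ∨
        ((l + 1) % K = k ∧ OnSheet (γ k) (cm (D k) x)))
  link : ∀ k < K, ∀ l < K, (k + 1) % K = l →
    (∃ F G, FacePairing w (cell k) (cell l) F G ∧ crMap (D k) = crMap (D l) ∘ G ∧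
      ∀ᶠ x : ℂ × ℝ in 𝓝 (q k), OnSheet (γ l) (cm (D k) x) → (x : Hbar) ∈ F) ∨
    (∃ F G, FacePairing w (cell l) (cell k) F G ∧ crMap (D l) = crMap (D k) ∘ G ∧
      ∀ᶠ x : ℂ × ℝ in 𝓝 (q l), OnSheet (γ l) (cm (D l) x) → (x : Hbar) ∈ F)

namespace EdgeCycle

variable {K N : ℕ} {t₀ : ℝ} (A : EdgeCycle w K N t₀)

/-- The angle of the `k`-th sheet over the point `Y`. -/
def β (k : ℕ) (Y : ℂ × ℝ) : ℝ := A.b k - Complex.arg (A.γ k Y / A.γ k (0, t₀))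

lemma γ_base_ne {k : ℕ} (hk : k ≤ K) : A.γ k (0, t₀) ≠ 0 := by
  obtain ⟨r, hr, h⟩ := A.γ_base k hk
  rw [h]
  exact mul_ne_zero (by exact_mod_cast hr.ne') (Complex.exp_ne_zero _)

lemma β_base {k : ℕ} (hk : k ≤ K) : A.β k (0, t₀) = A.b k := by
  rw [β, div_self (A.γ_base_ne hk)]; simp

lemma ratio_continuous {k : ℕ} (hk : k ≤ K) :
    Continuous fun Y => A.γ k Y / A.γ k (0, t₀) := (A.γ_cont k hk).div_const _

lemma β_continuousAt {k : ℕ} (hk : k ≤ K) {Y : ℂ × ℝ}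
    (hY : A.γ k Y / A.γ k (0, t₀) ∈ Complex.slitPlane) : ContinuousAt (A.β k) Y := by
  refine continuousAt_const.sub ?_
  exact ContinuousAt.comp (g := Complex.arg) (Complex.continuousAt_arg hY)
    (A.ratio_continuous hk).continuousAt

lemma eventually_slit {k : ℕ} (hk : k ≤ K) :
    ∀ᶠ Y in 𝓝 ((0, t₀) : ℂ × ℝ), A.γ k Y / A.γ k (0, t₀) ∈ Complex.slitPlane := by
  refine (A.ratio_continuous hk).continuousAt.eventually_mem
    (Complex.isOpen_slitPlane.mem_nhds ?_)
  rw [div_self (A.γ_base_ne hk)]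
  exact Complex.one_mem_slitPlane

lemma γ_polar {k : ℕ} (hk : k ≤ K) {Y : ℂ × ℝ} (hY : A.γ k Y ≠ 0) :
    ∃ r : ℝ, 0 < r ∧ A.γ k Y = r * Complex.exp (-(A.β k Y * Complex.I)) := by
  obtain ⟨r, hr, h⟩ := A.γ_base k hk
  have h0 := A.γ_base_ne hk
  refine ⟨‖A.γ k Y / A.γ k (0, t₀)‖ * r, by have := div_ne_zero hY h0; positivity, ?_⟩
  have h1 := Complex.norm_mul_exp_arg_mul_I (A.γ k Y / A.γ k (0, t₀))
  have h2 : A.γ k Y = (A.γ k Y / A.γ k (0, t₀)) * A.γ k (0, t₀) := by field_simp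
  have h3 : Complex.exp (-(A.β k Y * Complex.I)) =
      Complex.exp (Complex.arg (A.γ k Y / A.γ k (0, t₀)) * Complex.I) *
        Complex.exp (-(A.b k * Complex.I)) := by
    rw [← Complex.exp_add, β]; congr 1; push_cast; ring
  rw [h3]
  calc A.γ k Y = (A.γ k Y / A.γ k (0, t₀)) * A.γ k (0, t₀) := h2
    _ = (‖A.γ k Y / A.γ k (0, t₀)‖ * Complex.exp (Complex.arg (A.γ k Y / A.γ k (0, t₀)) *
          Complex.I)) * (r * Complex.exp (-(A.b k * Complex.I))) := by rw [h1, ← h]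
    _ = _ := by push_cast; ring

lemma β_width_of {k : ℕ} (hk : k < K) : A.b (k + 1) < A.b k + Real.pi ∨
    ∀ Y, A.β (k + 1) Y = A.β k Y + Real.pi := by
  rcases A.b_width k hk with h | ⟨h1, h2⟩
  · exact Or.inl h
  · right; intro Y; rw [β, β, h1, h1, h2, neg_div_neg_eq]; ring

lemma eventually_β {k : ℕ} (hk : k < K) : ∀ᶠ Y in 𝓝 ((0, t₀) : ℂ × ℝ),
    A.β k Y < A.β (k + 1) Y ∧ A.β (k + 1) Y ≤ A.β k Y + Real.pi := by
  have slit : ∀ k ≤ K, A.γ k (0, t₀) / A.γ k (0, t₀) ∈ Complex.slitPlane := by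
    intro k hk
    rw [div_self (A.γ_base_ne hk)]; exact Complex.one_mem_slitPlane
  have c1 := A.β_continuousAt hk.le (slit k hk.le)
  have c2 := A.β_continuousAt hk (slit (k + 1) hk)
  have h1 : ∀ᶠ Y in 𝓝 ((0, t₀) : ℂ × ℝ), A.β k Y < A.β (k + 1) Y := by
    refine c1.eventually_lt c2 ?_
    rw [A.β_base hk.le, A.β_base hk]; exact A.b_lt k hk
  rcases A.β_width_of hk with h | h
  · have h2 : ∀ᶠ Y in 𝓝 ((0, t₀) : ℂ × ℝ), A.β (k + 1) Y < A.β k Y + Real.pi := by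
      refine c2.eventually_lt (c1.add continuousAt_const) ?_
      rw [A.β_base hk.le, A.β_base hk]; exact h
    filter_upwards [h1, h2] with Y h1 h2 using ⟨h1, h2.le⟩
  · filter_upwards [h1] with Y h1 using ⟨h1, (h Y).le⟩

lemma β_last (Y : ℂ × ℝ) : A.β K Y = A.β 0 Y + 2 * Real.pi * N := by
  rw [β, β, A.γ_last, A.b_last]; ring

/-- The edge point of the `k`-th cell over `Y`. -/
def back (k : ℕ) (Y : ℂ × ℝ) : ℂ × ℝ := cm (uinv (A.D k)) Y

lemma crMap_uinv_base {k : ℕ} (hk : k < K) :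
    crMap (uinv (A.D k)) (((0, t₀) : ℂ × ℝ) : Hbar) = (A.q k : Hbar) := by
  have h := A.dev k hk
  have : (((0, t₀) : ℂ × ℝ) : Hbar) = crMap (A.D k) (A.q k) := h.symm
  rw [this, (A.unit k hk).crMap_uinv_crMap]

lemma back_base {k : ℕ} (hk : k < K) : A.back k (0, t₀) = A.q k := cm_eq (A.crMap_uinv_base hk)

lemma tendsto_back {k : ℕ} (hk : k < K) : Tendsto (A.back k) (𝓝 (0, t₀)) (𝓝 (A.q k)) := by
  rw [← A.back_base hk]
  exact continuousAt_cm (den_ne_zero (A.crMap_uinv_base hk))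

/-- The conditions, satisfied near the base point of the axis, that make `Y` belong to the common
domain of the developed cells. -/
structure Good (k : ℕ) (Y : ℂ × ℝ) : Prop where
  den : den (uinv (A.D k)) Y ≠ 0
  body : (A.back k Y : Hbar) ∈ (A.cell k).body ↔
    InWedge (A.β k Y) (A.β (k + 1) Y) Y.1
  not_vertex : (A.back k Y : Hbar) ∉ (A.cell k).vertices
  out : ∀ d F G, FacePairing w (A.cell k) d F G → (A.back k Y : Hbar) ∈ F →
    ∃ l < K, d = A.cell l ∧ crMap (A.D k) = crMap (A.D l) ∘ G ∧
      (((k + 1) % K = l ∧ OnRay (A.β l Y) Y.1) ∨ ((l + 1) % K = k ∧ OnRay (A.β k Y) Y.1))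
  inn : ∀ d F G, FacePairing w d (A.cell k) F G → (A.back k Y : Hbar) ∈ G '' F →
    ∃ l < K, d = A.cell l ∧ crMap (A.D l) = crMap (A.D k) ∘ G ∧
      (((k + 1) % K = l ∧ OnRay (A.β l Y) Y.1) ∨ ((l + 1) % K = k ∧ OnRay (A.β k Y) Y.1))
  link : ∀ l < K, (k + 1) % K = l → OnRay (A.β l Y) Y.1 →
    (∃ F G, FacePairing w (A.cell k) (A.cell l) F G ∧ crMap (A.D k) = crMap (A.D l) ∘ G ∧
      (A.back k Y : Hbar) ∈ F) ∨
    (∃ F G, FacePairing w (A.cell l) (A.cell k) F G ∧ crMap (A.D l) = crMap (A.D k) ∘ G ∧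
      (A.back l Y : Hbar) ∈ F)
  lt : A.β k Y < A.β (k + 1) Y
  width : A.β (k + 1) Y ≤ A.β k Y + Real.pi

lemma isClosed_vertices (c : Cell w) : IsClosed c.vertices := by
  cases c
  · exact (Set.toFinite {P1, P2, P3, P4}).isClosed
  · exact (Set.toFinite {P1, P2, P4}).isClosed

/-- All conditions hold near `q k` and are pulled back by `back k`, which is continuous at the base
point and sends it to `q k`. Near the base point the multipliers do not vanish, so conditions on
sheets turn into conditions on angles. -/
lemma eventually_good {k : ℕ} (hk : k < K) : ∀ᶠ Y in 𝓝 ((0, t₀) : ℂ × ℝ), A.Good k Y := by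
  have hden := eventually_den_ne (den_ne_zero (A.crMap_uinv_base hk))
  have hb := A.tendsto_back hk
  have hslit : ∀ᶠ Y in 𝓝 ((0, t₀) : ℂ × ℝ), ∀ k ≤ K,
      A.γ k Y / A.γ k (0, t₀) ∈ Complex.slitPlane := by
    have : ∀ᶠ Y in 𝓝 ((0, t₀) : ℂ × ℝ), ∀ k ∈ Set.Iic K,
      A.γ k Y / A.γ k (0, t₀) ∈ Complex.slitPlane :=
      (eventually_all_finite (Set.finite_Iic K)).mpr fun k hk => A.eventually_slit hk
    exact this
  have hvert : ∀ᶠ Y in 𝓝 ((0, t₀) : ℂ × ℝ), (A.back k Y : Hbar) ∉ (A.cell k).vertices :=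
    hb.eventually ((OnePoint.continuous_coe.continuousAt).eventually_mem
      ((isClosed_vertices (A.cell k)).isOpen_compl.mem_nhds (A.not_vertex k hk)))
  have hlink : ∀ᶠ Y in 𝓝 ((0, t₀) : ℂ × ℝ),
      ∀ l < K, (k + 1) % K = l → OnSheet (A.γ l) Y →
    (∃ F G, FacePairing w (A.cell k) (A.cell l) F G ∧ crMap (A.D k) = crMap (A.D l) ∘ G ∧
      (A.back k Y : Hbar) ∈ F) ∨
    (∃ F G, FacePairing w (A.cell l) (A.cell k) F G ∧ crMap (A.D l) = crMap (A.D k) ∘ G ∧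
      (A.back l Y : Hbar) ∈ F) := by
    have hcm : ∀ l < K, ∀ᶠ Y in 𝓝 ((0, t₀) : ℂ × ℝ), cm (A.D l) (A.back l Y) = Y := by
      intro l hl
      filter_upwards [eventually_den_ne (den_ne_zero (A.crMap_uinv_base hl))] with Y hY
      refine cm_eq ?_
      rw [back, ← crMap_coe hY, (A.unit l hl).crMap_crMap_uinv]
    have hl : (k + 1) % K < K := Nat.mod_lt _ A.K_pos
    rcases A.link k hk _ hl rfl with ⟨F, G, h1, h2, h3⟩ | ⟨F, G, h1, h2, h3⟩
    · filter_upwards [hb.eventually h3, hcm k hk] with Y h3 h4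
      rintro l - rfl hs
      rw [h4] at h3
      exact Or.inl ⟨F, G, h1, h2, h3 hs⟩
    · filter_upwards [(A.tendsto_back hl).eventually h3, hcm _ hl] with Y h3 h4
      rintro l - rfl hs
      rw [h4] at h3
      exact Or.inr ⟨F, G, h1, h2, h3 hs⟩
  filter_upwards [hden, hb.eventually (A.body k hk), hvert, hb.eventually (A.out k hk),
    hb.eventually (A.inn k hk), hlink, A.eventually_β hk, hslit] with
    Y h1 h2 h3 h4 h5 h6 h7 h8
  have hcm : cm (A.D k) (A.back k Y) = Y := by
    refine cm_eq ?_
    rw [back, ← crMap_coe h1, (A.unit k hk).crMap_crMap_uinv]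
  rw [hcm] at h2 h4 h5
  have hray : ∀ k ≤ K, (OnRay (A.β k Y) Y.1 ↔ OnSheet (A.γ k) Y) := by
    intro k hk
    have h0 : A.γ k Y ≠ 0 := fun h => Complex.zero_notMem_slitPlane (by simpa [h] using h8 k hk)
    obtain ⟨r, hr, hg⟩ := A.γ_polar hk h0
    exact onRay_iff hr hg
  refine ⟨h1, ?_, h3, ?_, ?_, ?_, h7.1, h7.2⟩
  · rw [h2]
    have h0 : ∀ k ≤ K, A.γ k Y ≠ 0 :=
      fun k hk h => Complex.zero_notMem_slitPlane (by simpa [h] using h8 k hk)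
    obtain ⟨r, hr, hg⟩ := A.γ_polar hk.le (h0 k hk.le)
    obtain ⟨r', hr', hg'⟩ := A.γ_polar hk (h0 (k + 1) hk)
    exact (inWedge_iff hr hr' hg hg' h7.1 h7.2).symm
  · intro d F G hF hx
    obtain ⟨l, hl, e1, e2, e3⟩ := h4 d F G hF hx
    exact ⟨l, hl, e1, e2, by rwa [hray l hl.le, hray k hk.le]⟩
  · intro d F G hF hx
    obtain ⟨l, hl, e1, e2, e3⟩ := h5 d F G hF hx
    exact ⟨l, hl, e1, e2, by rwa [hray l hl.le, hray k hk.le]⟩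
  · intro l hl hkl hr
    exact h6 l hl hkl ((hray l hl.le).mp hr)

/-- A neighbourhood of the base point of the axis that is small enough for all developed cells. -/
lemma exists_domain : ∃ Ω : Set (ℂ × ℝ), IsOpen Ω ∧ (0, t₀) ∈ Ω ∧
    (∀ k < K, ∀ Y ∈ Ω, A.Good k Y) ∧
    (∀ k ≤ K, ∀ Y ∈ Ω, A.γ k Y / A.γ k (0, t₀) ∈ Complex.slitPlane) ∧
    (∀ k < K, ∀ l < K, A.q k ≠ A.q l → ∀ Y ∈ Ω, ∀ Y' ∈ Ω, A.back k Y ≠ A.back l Y') := by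
  have h1 : ∀ᶠ Y in 𝓝 ((0, t₀) : ℂ × ℝ), ∀ k ∈ Set.Iio K, A.Good k Y :=
    (eventually_all_finite (Set.finite_Iio K)).mpr fun k hk => A.eventually_good hk
  have h2 : ∀ᶠ Y in 𝓝 ((0, t₀) : ℂ × ℝ), ∀ k ∈ Set.Iic K,
      A.γ k Y / A.γ k (0, t₀) ∈ Complex.slitPlane :=
    (eventually_all_finite (Set.finite_Iic K)).mpr fun k hk => A.eventually_slit hk
  -- Different edge points of one and the same cell get disjoint neighbourhoods; this makes the
  -- pieces disjoint.
  have h3 : ∀ k ∈ Set.Iio K, ∀ l ∈ Set.Iio K, ∃ s ∈ 𝓝 ((0, t₀) : ℂ × ℝ),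
      A.q k ≠ A.q l → ∀ Y ∈ s, ∀ Y' ∈ s, A.back k Y ≠ A.back l Y' := by
    intro k hk l hl
    by_cases h : A.q k = A.q l
    · exact ⟨Set.univ, univ_mem, fun h' => (h' h).elim⟩
    · obtain ⟨u, v, hu, hv, hku, hlv, huv⟩ := t2_separation h
      refine ⟨A.back k ⁻¹' u ∩ A.back l ⁻¹' v, inter_mem (A.tendsto_back hk (hu.mem_nhds hku))
        (A.tendsto_back hl (hv.mem_nhds hlv)), fun _ Y hY Y' hY' he => ?_⟩
      exact Set.disjoint_left.mp huv hY.1 (he ▸ hY'.2)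
  choose! s hs hs' using h3
  have h4 : ∀ᶠ Y in 𝓝 ((0, t₀) : ℂ × ℝ), ∀ k ∈ Set.Iio K, ∀ l ∈ Set.Iio K, Y ∈ s k l :=
    (eventually_all_finite (Set.finite_Iio K)).mpr fun k hk =>
      (eventually_all_finite (Set.finite_Iio K)).mpr fun l hl => hs k hk l hl
  obtain ⟨Ω, hΩ, hopen, hmem⟩ := eventually_nhds_iff.mp (h1.and (h2.and h4))
  refine ⟨Ω, hopen, hmem, fun k hk Y hY => (hΩ Y hY).1 k hk,
    fun k hk Y hY => (hΩ Y hY).2.1 k hk, fun k hk l hl hne Y hY Y' hY' => ?_⟩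
  exact hs' k hk l hl hne Y ((hΩ Y hY).2.2 k hk l hl) Y' ((hΩ Y' hY').2.2 k hk l hl)

end EdgeCycle

end

/-! ### From the cells around an edge to a branched chart -/

section

/-- The Heisenberg coordinates of a finite point of the CR sphere. -/
def toFin : Hbar → ℂ × ℝ := fun P => Option.getD P 0

lemma toFin_coe (x : ℂ × ℝ) : toFin (x : Hbar) = x := rfl

variable {m : ℕ} {w : ZMod m → Flip}

namespace EdgeCycle

variable {K N : ℕ} {t₀ : ℝ} (A : EdgeCycle w K N t₀)

open Classical in
/-- The point of the `k`-th cell over `Y` (or, for `Y` outside the wedge, any point `p₀`). -/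
def pointOver (p₀ : Pts w) (k : ℕ) (Y : ℂ × ℝ) : Pts w :=
  if h : (A.back k Y : Hbar) ∈ (A.cell k).body ∧ (A.back k Y : Hbar) ∉ (A.cell k).vertices then
    ⟨A.cell k, ⟨_, h⟩⟩ else p₀

/-- The part of the `k`-th cell over `Ω`. -/
def part (Ω : Set (ℂ × ℝ)) (k : ℕ) : Set (Pts w) :=
  {p | p.1 = A.cell k ∧ ∃ Y ∈ Ω, p.2.1 = (A.back k Y : Hbar)}

variable {A}

lemma crMap_back {k : ℕ} (hk : k < K) {Y : ℂ × ℝ} (h : A.Good k Y) :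
    crMap (A.D k) (A.back k Y : Hbar) = (Y : Hbar) := by
  rw [back, ← crMap_coe h.den, (A.unit k hk).crMap_crMap_uinv]

lemma pointOver_eq {p₀ : Pts w} {k : ℕ} {Y : ℂ × ℝ}
    (h : A.Good k Y) (hw : InWedge (A.β k Y) (A.β (k + 1) Y) Y.1) :
    A.pointOver p₀ k Y = ⟨A.cell k, ⟨_, h.body.mpr hw, h.not_vertex⟩⟩ :=
  dif_pos (⟨h.body.mpr hw, h.not_vertex⟩ :
    (A.back k Y : Hbar) ∈ (A.cell k).body ∧ (A.back k Y : Hbar) ∉ (A.cell k).vertices)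

variable (A)

/-- The image of `Ω` under the inverse developing map is the preimage of `Ω` under the developing
map, restricted to the open set where the latter takes finite values. -/
lemma isOpen_part {Ω : Set (ℂ × ℝ)} (hΩ : IsOpen Ω) {k : ℕ} (hk : k < K)
    (hgood : ∀ Y ∈ Ω, A.Good k Y) : IsOpen (A.part Ω k) := by
  have hS : IsOpen {P : Hbar | ∃ Y ∈ Ω, P = (A.back k Y : Hbar)} := by
    have : {P : Hbar | ∃ Y ∈ Ω, P = (A.back k Y : Hbar)} =
        (fun x : ℂ × ℝ => (x : Hbar)) '' ({x | den (A.D k) x ≠ 0} ∩ cm (A.D k) ⁻¹' Ω) := by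
      ext P
      constructor
      · rintro ⟨Y, hY, rfl⟩
        have h := crMap_back hk (hgood Y hY)
        refine ⟨_, ⟨den_ne_zero h, ?_⟩, rfl⟩
        rw [Set.mem_preimage, cm_eq h]; exact hY
      · rintro ⟨x, ⟨hx, hY⟩, rfl⟩
        refine ⟨_, hY, ?_⟩
        have h := crMap_coe hx
        have h2 := (A.unit k hk).crMap_uinv_crMap (x : Hbar)
        rw [h] at h2
        rw [back, cm_eq h2]
    rw [this]
    refine OnePoint.isOpenEmbedding_coe.isOpenMap _ ?_
    have hopen : IsOpen {x | den (A.D k) x ≠ 0} :=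
      isOpen_ne_fun (continuous_den _) continuous_const
    refine ContinuousOn.isOpen_inter_preimage ?_ hopen hΩ
    exact fun x hx => (continuousAt_cm hx).continuousWithinAt
  rw [part, isOpen_sigma_iff]
  intro c
  by_cases hc : c = A.cell k
  · have : (Sigma.mk c ⁻¹' {p : Pts w | p.1 = A.cell k ∧ ∃ Y ∈ Ω, p.2.1 = (A.back k Y : Hbar)}) =
        Subtype.val ⁻¹' {P : Hbar | ∃ Y ∈ Ω, P = (A.back k Y : Hbar)} := by
      ext P; exact ⟨fun h => h.2, fun h => ⟨hc, h⟩⟩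
    rw [this]
    exact hS.preimage continuous_subtype_val
  · convert isOpen_empty
    ext P
    exact ⟨fun h => hc h.1, fun h => h.elim⟩

/-- A common domain of the developed cells. -/
def dom : Set (ℂ × ℝ) := A.exists_domain.choose

lemma isOpen_dom : IsOpen A.dom := A.exists_domain.choose_spec.1

lemma base_mem_dom : (0, t₀) ∈ A.dom := A.exists_domain.choose_spec.2.1

lemma good {k : ℕ} (hk : k < K) {Y : ℂ × ℝ} (hY : Y ∈ A.dom) : A.Good k Y :=
  A.exists_domain.choose_spec.2.2.1 k hk Y hY

/-- The wedges formed by the developed cells. -/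
def wedgeCycle (p₀ : Pts w) : WedgeCycle (Glue w) K N where
  Ω := A.dom
  O := A.part A.dom
  d k p := toFin (crMap (A.D k) p.2.1)
  e := A.pointOver p₀
  β := A.β
  -- Each angle is some `b k` minus a principal argument, hence differs from `b k` by at most `π`.
  C := (∑ k ∈ Finset.range (K + 1), |A.b k|) + Real.pi
  N_pos := A.N_pos
  isOpen_Ω := A.isOpen_dom
  isOpen_O k hk := A.isOpen_part A.isOpen_dom hk fun Y hY => A.good hk hY
  disj := by
    rintro k hk l hl p ⟨hpk, Y, hY, e⟩ ⟨hpl, Y', hY', e'⟩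
    have hs := A.exists_domain.choose_spec.2.2.2.2
    by_contra hne
    refine hs k hk l hl (fun hq => hne (A.inj k hk l hl (hpk.symm.trans hpl) hq)) Y hY Y' hY' ?_
    exact OnePoint.coe_injective (e.symm.trans e')
  d_cont := by
    rintro k hk p ⟨hp, Y, hY, e⟩
    have h := crMap_back hk (A.good hk hY)
    refine ContinuousAt.continuousWithinAt ?_
    have h1 : ContinuousAt (fun P : Hbar => toFin (crMap (A.D k) P)) p.2.1 := by
      rw [e, OnePoint.continuousAt_coe]
      have h2 : ContinuousAt (cm (A.D k)) (A.back k Y) := continuousAt_cm (den_ne_zero h)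
      refine h2.congr ?_
      filter_upwards [eventually_den_ne (den_ne_zero h)] with x hx
      rw [Function.comp_apply, crMap_coe hx, toFin_coe]
    have h3 : Continuous fun p : Pts w => p.2.1 :=
      continuous_sigma fun c => continuous_subtype_val
    exact ContinuousAt.comp (f := fun p : Pts w => p.2.1) h1 h3.continuousAt
  d_mem := by
    rintro k hk p ⟨hp, Y, hY, e⟩
    rw [e, crMap_back hk (A.good hk hY), toFin_coe]
    exact hY
  d_wedge := by
    rintro k hk ⟨c, P, hP⟩ ⟨rfl, Y, hY, e⟩
    have hg := A.good hk hY
    simp only at e ⊢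
    subst e
    rw [crMap_back hk hg, toFin_coe]
    exact hg.body.mp hP.1
  e_mem := by
    intro k hk Y hY hw
    rw [pointOver_eq (A.good hk hY) hw]
    exact ⟨rfl, Y, hY, rfl⟩
  d_e := by
    intro k hk Y hY hw
    rw [pointOver_eq (A.good hk hY) hw]
    simp only
    rw [crMap_back hk (A.good hk hY), toFin_coe]
  e_d := by
    rintro k hk ⟨c, P, hP⟩ ⟨rfl, Y, hY, e⟩
    have hg := A.good hk hY
    simp only at e ⊢
    subst e
    rw [crMap_back hk hg, toFin_coe, pointOver_eq hg (hg.body.mp hP.1)]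
  e_cont := by
    intro k hk
    rw [continuousOn_iff_continuous_domRestrict]
    have hgood := fun Y (hY : Y ∈ A.dom) => A.good hk hY
    have heq : Set.domRestrict {Y | Y ∈ A.dom ∧
        InWedge (A.β k Y) (A.β (k + 1) Y) Y.1} (A.pointOver p₀ k) =
        fun Y => Sigma.mk (A.cell k) ⟨(A.back k Y.1 : Hbar),
          (hgood Y.1 Y.2.1).body.mpr Y.2.2, (hgood Y.1 Y.2.1).not_vertex⟩ := by
      funext Y
      exact pointOver_eq (hgood Y.1 Y.2.1) Y.2.2
    rw [heq]
    refine continuous_sigmaMk.comp (Continuous.subtype_mk ?_ _)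
    refine OnePoint.continuous_coe.comp ?_
    refine continuous_iff_continuousAt.mpr fun Y => ?_
    exact ContinuousAt.comp (g := A.back k) (continuousAt_cm (hgood Y.1 Y.2.1).den)
      continuous_subtype_val.continuousAt
  β_cont k hk Y hY := (A.β_continuousAt hk
    (A.exists_domain.choose_spec.2.2.2.1 k hk Y hY)).continuousWithinAt
  β_lt k hk Y hY := (A.good hk hY).lt
  β_width k hk Y hY := by
    have := (A.good hk hY).width
    linarith [Real.pi_pos]
  β_last Y _ := A.β_last Y
  β_bdd := by
    intro k hk Y _
    have h1 : |A.b k| ≤ ∑ k ∈ Finset.range (K + 1), |A.b k| :=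
      Finset.single_le_sum (f := fun k => |A.b k|) (fun _ _ => abs_nonneg _)
        (Finset.mem_range.mpr (by omega))
    have h2 := abs_le.mp (Complex.abs_arg_le_pi (A.γ k Y / A.γ k (0, t₀)))
    have h3 := abs_le.mp h1
    rw [β]
    constructor <;> linarith [h2.1, h2.2, h3.1, h3.2]
  glue := by
    intro k hk l hl hkl Y hY hr
    have hgk := A.good hk hY
    have hgl := A.good hl hY
    have hwl : InWedge (A.β l Y) (A.β (l + 1) Y) Y.1 := ⟨_, ⟨le_rfl, hgl.lt.le⟩, hr⟩
    have hwk : InWedge (A.β k Y) (A.β (k + 1) Y) Y.1 := by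
      rcases Nat.lt_or_ge (k + 1) K with h | h
      · rw [Nat.mod_eq_of_lt h] at hkl
        subst hkl
        exact ⟨_, ⟨hgk.lt.le, le_rfl⟩, hr⟩
      · have hK : k + 1 = K := by omega
        have hl0 : l = 0 := by rw [← hkl, hK, Nat.mod_self]
        subst hl0
        refine ⟨_, ⟨hgk.lt.le, le_rfl⟩, ?_⟩
        have : A.β (k + 1) Y = A.β 0 Y + 2 * Real.pi * N := by
          rw [← A.β_last Y]; exact congrArg (A.β · Y) hK
        rw [this]
        exact hr.add_two_pi_mul N
    rw [pointOver_eq hgk hwk, pointOver_eq hgl hwl]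
    rcases hgk.link l hl hkl hr with ⟨F, G, h1, h2, h3⟩ | ⟨F, G, h1, h2, h3⟩
    · refine Quot.sound ⟨F, G, h1, h3, ?_⟩
      apply (A.unit l hl).crMap_injective
      have := congrFun h2 (A.back k Y : Hbar)
      rw [crMap_back hk hgk] at this
      rw [crMap_back hl hgl, this]; rfl
    · refine (Quot.sound ⟨F, G, h1, h3, ?_⟩).symm
      apply (A.unit k hk).crMap_injective
      have := congrFun h2 (A.back l Y : Hbar)
      rw [crMap_back hl hgl] at this
      rw [crMap_back hk hgk, this]; rfl
  sat := by
    rintro k hk ⟨c, P, hP⟩ ⟨rfl, Y, hY, e⟩ ⟨c', Q, hQ⟩ hpq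
    have hg := A.good hk hY
    have hdY := crMap_back hk hg
    simp only at e ⊢
    subst e
    rw [hdY, toFin_coe]
    have fin : ∀ l < K, c' = A.cell l → crMap (A.D l) Q = (Y : Hbar) →
        (((k + 1) % K = l ∧ OnRay (A.β l Y) Y.1) ∨ ((l + 1) % K = k ∧ OnRay (A.β k Y) Y.1)) →
        ∃ l < K, (⟨c', ⟨Q, hQ⟩⟩ : Pts w) ∈ A.part A.dom l ∧ toFin (crMap (A.D l) Q) = Y ∧
          (((k + 1) % K = l ∧ OnRay (A.β l Y) Y.1) ∨
            ((l + 1) % K = k ∧ OnRay (A.β k Y) Y.1)) := by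
      intro l hl h1 h2 h3
      refine ⟨l, hl, ⟨h1, Y, hY, ?_⟩, by rw [h2, toFin_coe], h3⟩
      apply (A.unit l hl).crMap_injective
      rw [crMap_back hl (A.good hl hY), h2]
    rcases hpq with ⟨F, G, h1, h2, h3⟩ | ⟨F, G, h1, h2, h3⟩
    · obtain ⟨l, hl, e1, e2, e3⟩ := hg.out c' F G h1 h2
      refine fin l hl e1 ?_ e3
      simp only at h3
      rw [h3, ← hdY, e2]; rfl
    · simp only at h1 h2 h3
      obtain ⟨l, hl, e1, e2, e3⟩ := hg.inn c' F G h1 ⟨Q, h2, h3.symm⟩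
      refine fin l hl e1 ?_ e3
      rw [e2, Function.comp_apply, ← h3, hdY]

lemma base_mem_part {k : ℕ} {p : Pts w} (hk : k < K) (h1 : p.1 = A.cell k)
    (h2 : p.2.1 = (A.q k : Hbar)) (p₀ : Pts w) : p ∈ (A.wedgeCycle p₀).O k := by
  refine ⟨h1, (0, t₀), A.base_mem_dom, ?_⟩
  rw [A.back_base hk, h2]

/-- This supplies the face-pairing clause of `IsDeveloping`: the transformations on two matched
pieces differ by the pairing map. -/
lemma pairing_dev {k : ℕ} (hk : k < K) {p₀ p q : Pts w} (hp : p ∈ (A.wedgeCycle p₀).O k)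
    {F : Set Hbar} {G : Hbar → Hbar} (h1 : FacePairing w p.1 q.1 F G) (h2 : p.2.1 ∈ F)
    (h3 : q.2.1 = G p.2.1) :
    ∃ l < K, q ∈ (A.wedgeCycle p₀).O l ∧ crMap (A.D k) = crMap (A.D l) ∘ G := by
  obtain ⟨c, P, hP⟩ := p
  obtain ⟨rfl, Y, hY, e⟩ := hp
  have hY : Y ∈ A.dom := hY
  have hg := A.good hk hY
  have hdY := crMap_back hk hg
  simp only at e h1 h2 h3
  subst e
  obtain ⟨l, hl, e1, e2, e3⟩ := hg.out _ F G h1 h2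
  refine ⟨l, hl, ⟨e1, Y, hY, ?_⟩, e2⟩
  apply (A.unit l hl).crMap_injective
  rw [crMap_back hl (A.good hl hY), h3, ← hdY, e2]; rfl

open Classical in
/-- The cells arranged around an edge point form a branched chart. -/
theorem hasBranchedChart {k : ℕ} (hk : k < K) {p : Pts w} (h1 : p.1 = A.cell k)
    (h2 : p.2.1 = (A.q k : Hbar)) : HasBranchedChart w (proj w p) N := by
  have hp : p ∈ (A.wedgeCycle p).O k := A.base_mem_part hk h1 h2 p
  have hpd : ∀ q : Pts w, ∀ k < K, q ∈ (A.wedgeCycle p).O k → ∀ q' : Pts w,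
      ∀ F G, FacePairing w q.1 q'.1 F G → q.2.1 ∈ F → q'.2.1 = G q.2.1 →
      ∃ l < K, q' ∈ (A.wedgeCycle p).O l ∧ crMap (A.D k) = crMap (A.D l) ∘ G :=
    fun q k hk hq q' F G e1 e2 e3 => A.pairing_dev hk hq e1 e2 e3
  have hval : ∀ q : Pts w, ∀ k < K, q ∈ (A.wedgeCycle p).O k →
      (((A.wedgeCycle p).d k q : ℂ × ℝ) : Hbar) = crMap (A.D k) q.2.1 := by
    rintro q k hk ⟨hc, Y, hY, e⟩
    have hY : Y ∈ A.dom := hY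
    change ((toFin (crMap (A.D k) q.2.1) : ℂ × ℝ) : Hbar) = _
    rw [e, crMap_back hk (A.good hk hY), toFin_coe]
  have hbase : (A.wedgeCycle p).d k p = (0, t₀) := by
    change toFin (crMap (A.D k) p.2.1) = _
    rw [h2, A.dev k hk]; rfl
  generalize A.wedgeCycle p = B at hp hpd hval hbase
  refine ⟨A.N_pos, B.nbhd, fun y => pt ((B.glued y).1 ^ N) (B.glued y).2, B.glued, B.isOpen_nbhd,
    ⟨k, hk, p, hp, rfl⟩, ?_, B.isOpenEmbedding_glued, ?_, fun y _ => rfl⟩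
  · let g : Pts w → Hbar → Hbar := fun p =>
      if h : ∃ k < K, p ∈ B.O k then crMap (A.D h.choose) else id
    have hg : ∀ k < K, ∀ p ∈ B.O k, g p = crMap (A.D k) := by
      intro k hk p hp
      have h : ∃ k < K, p ∈ B.O k := ⟨k, hk, hp⟩
      have he : h.choose = k := B.disj _ h.choose_spec.1 k hk p h.choose_spec.2 hp
      change (if h : ∃ k < K, p ∈ B.O k then crMap (A.D h.choose) else id) = _
      rw [dif_pos h, he]
    refine ⟨g, ?_, ?_, ?_, ?_⟩
    · intro p hp
      obtain ⟨k, hk, hp⟩ := B.mem_nbhd_iff.mp hp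
      exact ⟨A.D k, A.unit k hk, hg k hk p hp⟩
    · intro p hp
      obtain ⟨k, hk, hp⟩ := B.mem_nbhd_iff.mp hp
      filter_upwards [(B.isOpen_O k hk).mem_nhds hp] with p' hp'
      rw [hg k hk p hp, hg k hk p' hp']
    · intro p q hp F G h1 h2 h3
      obtain ⟨k, hk, hp⟩ := B.mem_nbhd_iff.mp hp
      obtain ⟨l, hl, hq, he⟩ := hpd p k hk hp q F G h1 h2 h3
      rw [hg k hk p hp, hg l hl q hq, he]
    · intro p hp
      obtain ⟨k, hk, hp⟩ := B.mem_nbhd_iff.mp hp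
      rw [hg k hk p hp, ← hval p k hk hp, ← B.glued_pow hk hp]
      rfl
  · have h3 := B.glued_pow hk hp
    rw [hbase] at h3
    exact (pow_eq_zero_iff A.N_pos.ne').mp (Prod.ext_iff.mp h3).1

end EdgeCycle

end

section

/-! ### The edges and faces of the model cells in coordinates -/

lemma sqrt3_sq : Real.sqrt 3 * Real.sqrt 3 = 3 := Real.mul_self_sqrt (by norm_num)

lemma sqrt3_pos : 0 < Real.sqrt 3 := Real.sqrt_pos.mpr (by norm_num)

/-- The arc of the unit circle from `1` to `-ω = e^{iπ/3}`. -/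
def Arc (e : ℂ) : Prop := e.re * e.re + e.im * e.im = 1 ∧ 0 ≤ e.im ∧ e.im ≤ Real.sqrt 3 * e.re

lemma Arc.re_ge {e : ℂ} (h : Arc e) : 1 / 2 ≤ e.re := by
  obtain ⟨h1, h2, h3⟩ := h
  have hs := sqrt3_sq
  have hp := sqrt3_pos
  have : 0 ≤ e.re := by
    by_contra h; push Not at h
    nlinarith
  nlinarith [mul_nonneg h2 (sub_nonneg.mpr h3), mul_nonneg (sub_nonneg.mpr h3) (sub_nonneg.mpr h3)]

lemma arc_one : Arc 1 := by simp [Arc]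

lemma arc_neg_om : Arc (-om) := by
  have hs := sqrt3_sq
  have hp := sqrt3_pos
  simp only [Arc, Complex.neg_re, Complex.neg_im, om_re, om_im]
  refine ⟨by nlinarith, by linarith, by nlinarith⟩

lemma cs_re (σ : ℝ) : (1 + Complex.I * σ * om).re = 1 + Real.sqrt 3 / 2 * σ := by
  simp [om_re, om_im]; ring

lemma cs_im (σ : ℝ) : (1 + Complex.I * σ * om).im = -σ / 2 := by
  simp [om_re, om_im]; ring

lemma cs_ne {σ : ℝ} (hσ : 0 ≤ σ) : 1 + Complex.I * σ * om ≠ 0 := fun h => by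
  have := cs_re σ
  rw [h] at this
  have hp := sqrt3_pos
  simp at this
  nlinarith [mul_nonneg hp.le hσ]

/-- The arc is parametrised by `σ ↦ c̄ / c`, where `c = 1 + iσω`, with `-ω` as limit. -/
lemma arc_iff {e : ℂ} : Arc e ↔ e = -om ∨ ∃ σ : ℝ, 0 ≤ σ ∧
    e * (1 + Complex.I * σ * om) = star (1 + Complex.I * σ * om) := by
  have hs := sqrt3_sq
  have hp := sqrt3_pos
  constructor
  · intro h
    have hre := h.re_ge
    obtain ⟨h1, h2, h3⟩ := h
    by_cases he : e = -om
    · exact Or.inl he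
    right
    -- For `e` on the unit circle this number is `|e + ω|²`, which vanishes only at `-ω`. The value
    -- of `σ` below is the solution of `e c = c̄`.
    have hd : 0 < 2 - e.re - Real.sqrt 3 * e.im := by
      by_contra hneg; push Not at hneg
      apply he
      have h4 : (Real.sqrt 3 * e.re - e.im) ^ 2 ≤ 0 := by nlinarith
      have h5 : e.im = Real.sqrt 3 * e.re := by nlinarith [sq_nonneg (Real.sqrt 3 * e.re - e.im)]
      have h6 : e.re = 1 / 2 := by
        rw [h5] at h1; nlinarith
      apply Complex.ext
      · rw [Complex.neg_re, om_re, h6]; norm_num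
      · rw [Complex.neg_im, om_im, h5, h6]; ring
    have hn : 0 ≤ e.im + Real.sqrt 3 * e.re - Real.sqrt 3 := by
      have h4 : Real.sqrt 3 ^ 2 ≤ (e.im + Real.sqrt 3 * e.re) ^ 2 := by
        nlinarith [mul_nonneg h2 (sub_nonneg.mpr h3)]
      have h5 : 0 ≤ e.im + Real.sqrt 3 * e.re := by positivity
      have h6 := (pow_le_pow_iff_left₀ hp.le h5 two_ne_zero).mp h4
      linarith
    refine ⟨(e.im + Real.sqrt 3 * e.re - Real.sqrt 3) / (2 - e.re - Real.sqrt 3 * e.im),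
      div_nonneg hn hd.le, ?_⟩
    set σ := (e.im + Real.sqrt 3 * e.re - Real.sqrt 3) / (2 - e.re - Real.sqrt 3 * e.im) with hσ
    have hσ' : σ * (2 - e.re - Real.sqrt 3 * e.im) =
        e.im + Real.sqrt 3 * e.re - Real.sqrt 3 := div_mul_cancel₀ _ hd.ne'
    apply Complex.ext
    · rw [Complex.mul_re, Complex.star_def, Complex.conj_re, cs_re, cs_im]
      apply mul_left_cancel₀ hd.ne'
      linear_combination (e.re * Real.sqrt 3 / 2 + e.im / 2 - Real.sqrt 3 / 2) * hσ' +
        h1 / 2 + (e.re-1)^2/2 * hs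
    · rw [Complex.mul_im, Complex.star_def, Complex.conj_im, cs_re, cs_im]
      apply mul_left_cancel₀ hd.ne'
      linear_combination (e.im * Real.sqrt 3 / 2 - e.re / 2 - 1 / 2) * hσ' -
        Real.sqrt 3 / 2 * h1 + (e.re * e.im / 2 - e.im / 2) * hs
  · rintro (rfl | ⟨σ, hσ, h⟩)
    · exact arc_neg_om
    · have h1 := congrArg Complex.re h
      have h2 := congrArg Complex.im h
      rw [Complex.mul_re, Complex.star_def, Complex.conj_re, cs_re, cs_im] at h1
      rw [Complex.mul_im, Complex.star_def, Complex.conj_im, cs_re, cs_im] at h2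
      set n := 1 + Real.sqrt 3 * σ + σ ^ 2 with hn
      have hnpos : 0 < n := by positivity
      have hre : e.re * n = 1 + Real.sqrt 3 * σ + σ ^ 2 / 2 := by
        linear_combination (1 + Real.sqrt 3 / 2 * σ) * h1 - σ / 2 * h2 + (1-e.re)*σ^2/4 * hs
      have him : e.im * n = σ + Real.sqrt 3 / 2 * σ ^ 2 := by
        linear_combination σ / 2 * h1 + (1 + Real.sqrt 3 / 2 * σ) * h2 - (e.im)*σ^2/4 * hs
      have hre' : e.re = (1 + Real.sqrt 3 * σ + σ ^ 2 / 2) / n := by field_simp; linarith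
      have him' : e.im = (σ + Real.sqrt 3 / 2 * σ ^ 2) / n := by field_simp; linarith
      refine ⟨?_, ?_, ?_⟩
      · rw [hre', him']; field_simp; rw [hn]; nlinarith
      · rw [him']; positivity
      · rw [hre', him', mul_div_assoc', div_le_div_iff_of_pos_right hnpos]
        nlinarith [mul_nonneg hp.le hσ]

end

section

/-- When `h = ⟨p, q⟩` is nonzero, the condition `l̄ h = -i s` determines `l = i σ h` with `σ = s /
|h|²`, so the arc has one real parameter. -/
lemma mem_edge_iff {P Q : Hbar} {h : ℂ} (hh : herm (lift P) (lift Q) = h) (h0 : h ≠ 0) (X : Hbar) :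
    X ∈ edge P Q ↔ X = Q ∨ ∃ σ : ℝ, 0 ≤ σ ∧
      X = stereo (lift P + (Complex.I * σ * h) • lift Q) := by
  subst hh
  set h := herm (lift P) (lift Q)
  have hpos : (0 : ℝ) < Complex.normSq h := Complex.normSq_pos.mpr h0
  have hn : ((Complex.normSq h : ℝ) : ℂ) = h * star h := (Complex.mul_conj h).symm
  have hs : star h ≠ 0 := star_ne_zero.mpr h0
  refine or_congr Iff.rfl ⟨?_, ?_⟩
  · rintro ⟨l, s, hs0, h1, rfl⟩
    refine ⟨s / Complex.normSq h, by positivity, ?_⟩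
    congr 3
    have h2 := congrArg star h1
    simp only [star_mul, star_neg, Complex.star_def, Complex.conj_I,
      Complex.conj_ofReal, neg_neg, Complex.conj_conj] at h2
    push_cast
    rw [hn]
    field_simp
    rw [Complex.star_def]
    linear_combination h2
  · rintro ⟨σ, hσ, rfl⟩
    refine ⟨_, σ * Complex.normSq h, by positivity, ?_, rfl⟩
    push_cast
    rw [hn]
    simp only [star_mul, Complex.star_def, Complex.conj_I, Complex.conj_ofReal]
    ring

lemma stereo_eq_pt {v : Fin 3 → ℂ} {x z : ℂ} (h : v 2 ≠ 0) (h1 : v 1 = z * v 2)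
    (h0 : v 0 = x * v 2) : stereo v = pt z (2 * x.im) := by
  rw [stereo_of_ne h, chart, h1, h0, mul_div_cancel_right₀ _ h, mul_div_cancel_right₀ _ h, pt]

lemma pt_inj {z z' : ℂ} {t t' : ℝ} : pt z t = pt z' t' ↔ z = z' ∧ t = t' := by
  simp [pt]

lemma pt_ne_infty (z : ℂ) (t : ℝ) : pt z t ≠ OnePoint.infty := OnePoint.coe_ne_infty _

lemma P4_def : P4 = OnePoint.infty := rfl

lemma coe_eq_pt (q : ℂ × ℝ) : (q : Hbar) = pt q.1 q.2 := rfl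

lemma mem_edge_pt_P4 {z z' : ℂ} {t t' : ℝ} :
    pt z' t' ∈ edge (pt z t) P4 ↔ z' = z ∧ t ≤ t' := by
  have hh : herm (lift (pt z t)) (lift P4) = 1 := by
    simp [herm_eq, lift_pt, P4_def, lift_infty]
  have key (σ : ℝ) : stereo (lift (pt z t) + (Complex.I * σ * 1) • lift P4) = pt z (t + 2 * σ) := by
    rw [stereo_eq_pt (x := xc (z, t) + Complex.I * σ) (z := z)] <;>
      simp [lift_pt, P4_def, lift_infty, xc_im]
    ring_nf
  rw [mem_edge_iff hh one_ne_zero]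
  constructor
  · rintro (h | ⟨σ, hσ, h⟩)
    · exact absurd h (pt_ne_infty _ _)
    · rw [key, pt_inj] at h
      exact ⟨h.1, by linarith⟩
  · rintro ⟨rfl, h⟩
    exact Or.inr ⟨(t' - t) / 2, by linarith, by rw [key, pt_inj]; exact ⟨rfl, by ring⟩⟩

lemma mem_edge_P4_pt {z z' : ℂ} {t t' : ℝ} :
    pt z' t' ∈ edge P4 (pt z t) ↔ z' = z ∧ t' ≤ t := by
  have hh : herm (lift P4) (lift (pt z t)) = 1 := by
    simp [herm_eq, lift_pt, P4_def, lift_infty]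
  have key (σ : ℝ) (hσ : σ ≠ 0) :
      stereo (lift P4 + (Complex.I * σ * 1) • lift (pt z t)) = pt z (t - 2 / σ) := by
    have hc : (σ : ℂ) ≠ 0 := Complex.ofReal_ne_zero.mpr hσ
    rw [stereo_eq_pt (x := xc (z, t) - Complex.I * (1 / σ : ℝ)) (z := z)]
    · simp only [Complex.sub_im, Complex.I_mul_im, Complex.ofReal_re, xc_im]; ring_nf
    · simp [lift_pt, P4_def, lift_infty, hσ]
    · simp [lift_pt, P4_def, lift_infty]; ring
    · simp [lift_pt, P4_def, lift_infty]; field_simp; ring_nf; rw [Complex.I_sq]; ring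
  rw [mem_edge_iff hh one_ne_zero]
  constructor
  · rintro (h | ⟨σ, hσ, h⟩)
    · rw [pt_inj] at h; exact ⟨h.1, h.2.le⟩
    · rcases eq_or_lt_of_le hσ with rfl | hpos
      · simp [P4_def, stereo_lift, pt_ne_infty] at h
      · rw [key σ hpos.ne', pt_inj] at h
        have : 0 < 2 / σ := by positivity
        exact ⟨h.1, by linarith⟩
  · rintro ⟨rfl, h⟩
    rcases eq_or_lt_of_le h with rfl | hlt
    · exact Or.inl rfl
    · have hd : 0 < t - t' := by linarith
      refine Or.inr ⟨2 / (t - t'), by positivity, ?_⟩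
      rw [key _ (by positivity), pt_inj]
      refine ⟨rfl, ?_⟩
      field_simp; ring

lemma infty_mem_edge_P4 (P : Hbar) : OnePoint.infty ∈ edge P P4 := Or.inl rfl

lemma star_om_eq : star om = ((-1 / 2 : ℝ) : ℂ) + ((Real.sqrt 3 / 2 : ℝ) : ℂ) * Complex.I := by
  apply Complex.ext <;> simp [om_re, om_im] <;> ring

lemma Arc.norm {e : ℂ} (h : Arc e) : ‖e‖ = 1 := by
  have h1 := h.1
  rw [← Complex.normSq_apply, Complex.normSq_eq_norm_sq] at h1
  nlinarith [norm_nonneg e]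

lemma xc_of_norm {e : ℂ} (h : ‖e‖ = 1) : xc (e, Real.sqrt 3) = star om := by
  rw [xc_eq_ofReal, star_om_eq, h]; norm_num

/-- Both lifts have the form `(ω̄, ·, 1)`, so along the arc the zeroth and last coordinates stay in
the ratio `ω̄`: the height remains `√3`, and the middle quotient is `c̄ / c` with `c = 1 + iσω`. -/
lemma mem_edge_P1_P2 {X : Hbar} :
    X ∈ edge P1 P2 ↔ ∃ e, Arc e ∧ X = pt e (Real.sqrt 3) := by
  have h1 : lift P1 = ![star om, 1, 1] := by
    rw [P1, lift_pt, xc_of_norm (by simp)]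
  have h2 : lift P2 = ![star om, -om, 1] := by
    rw [P2, lift_pt, xc_of_norm arc_neg_om.norm]
  have hh : herm (lift P1) (lift P2) = om := by
    rw [h1, h2]; simp [herm_eq]
  have key (σ : ℝ) (hσ : 0 ≤ σ) (e : ℂ)
      (he : e * (1 + Complex.I * σ * om) = star (1 + Complex.I * σ * om)) :
      stereo (lift P1 + (Complex.I * σ * om) • lift P2) = pt e (Real.sqrt 3) := by
    rw [h1, h2, stereo_eq_pt (x := star om) (z := e)]
    · simp only [Complex.star_def, Complex.conj_im, om_im]; ring_nf
    · simpa using cs_ne hσ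
    · have h3 : star (1 + Complex.I * σ * om) = 1 - Complex.I * σ * (-1 - om) := by
        rw [← star_om]; simp; ring
      rw [h3] at he
      simp
      linear_combination -he - Complex.I * σ * om_sq
    · simp; ring
  rw [mem_edge_iff hh om_ne_zero]
  constructor
  · rintro (rfl | ⟨σ, hσ, rfl⟩)
    · exact ⟨-om, arc_neg_om, rfl⟩
    · have : star (1 + Complex.I * σ * om) / (1 + Complex.I * σ * om) * (1 + Complex.I * σ * om) =
        star (1 + Complex.I * σ * om) := div_mul_cancel₀ _ (cs_ne hσ)
      exact ⟨_, arc_iff.mpr (Or.inr ⟨σ, hσ, this⟩), key σ hσ _ this⟩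
  · rintro ⟨e, he, rfl⟩
    rcases arc_iff.mp he with rfl | ⟨σ, hσ, h⟩
    · exact Or.inl rfl
    · exact Or.inr ⟨σ, hσ, (key σ hσ e h).symm⟩

/-- With `c = 1 + iσω` one has `c̄ - c = iσ`, because `ω + ω̄ = -1`. Hence the zeroth quotient is
`e' - 1` for `e' = c̄ / c`, and the end point `e` enters only as a rotation about the vertical axis.
-/
lemma mem_edge_P3 {e : ℂ} (hn : ‖e‖ = 1) {X : Hbar} :
    X ∈ edge P3 (pt e (Real.sqrt 3)) ↔
      ∃ e', Arc e' ∧ X = pt (e * om * (e' - 1)) (2 * e'.im) := by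
  have h1 : lift P3 = ![0, 0, 1] := by
    rw [P3, lift_pt]; simp [xc]
  have h2 : lift (pt e (Real.sqrt 3)) = ![star om, e, 1] := by
    rw [lift_pt, xc_of_norm hn]
  have hh : herm (lift P3) (lift (pt e (Real.sqrt 3))) = om := by
    rw [h1, h2]; simp [herm_eq]
  have key (σ : ℝ) (hσ : 0 ≤ σ) (e' : ℂ)
      (he : e' * (1 + Complex.I * σ * om) = star (1 + Complex.I * σ * om)) :
      stereo (lift P3 + (Complex.I * σ * om) • lift (pt e (Real.sqrt 3))) =
        pt (e * om * (e' - 1)) (2 * e'.im) := by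
    have hx : (e' - 1) * (1 + Complex.I * σ * om) = Complex.I * σ := by
      rw [sub_mul, he, star_add, star_mul, star_mul]
      simp only [star_one, Complex.star_def, Complex.conj_I, Complex.conj_ofReal]
      rw [← Complex.star_def, star_om]; ring
    rw [h1, h2, stereo_eq_pt (x := e' - 1) (z := e * om * (e' - 1))]
    · simp
    · simpa using cs_ne hσ
    · simp; linear_combination -e * om * hx
    · have h4 : (starRingEnd ℂ) om = -1 - om := star_om
      simp
      rw [h4]; linear_combination -hx - Complex.I * σ * om_sq
  have hs2 : star om = om ^ 2 := by rw [star_om, om_sq]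
  rw [mem_edge_iff hh om_ne_zero]
  constructor
  · rintro (rfl | ⟨σ, hσ, rfl⟩)
    · refine ⟨-om, arc_neg_om, ?_⟩
      rw [pt_inj]
      refine ⟨by linear_combination e * om_sq, by rw [Complex.neg_im, om_im]; ring⟩
    · have : star (1 + Complex.I * σ * om) / (1 + Complex.I * σ * om) * (1 + Complex.I * σ * om) =
        star (1 + Complex.I * σ * om) := div_mul_cancel₀ _ (cs_ne hσ)
      exact ⟨_, arc_iff.mpr (Or.inr ⟨σ, hσ, this⟩), key σ hσ _ this⟩
  · rintro ⟨e', he, rfl⟩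
    rcases arc_iff.mp he with rfl | ⟨σ, hσ, h⟩
    · left
      rw [pt_inj]
      refine ⟨by linear_combination -e * om_sq, by rw [Complex.neg_im, om_im]; ring⟩
    · exact Or.inr ⟨σ, hσ, (key σ hσ e' h).symm⟩

lemma mem_edge_P3_P1 {X : Hbar} :
    X ∈ edge P3 P1 ↔ ∃ e, Arc e ∧ X = pt (om * (e - 1)) (2 * e.im) := by
  rw [P1, mem_edge_P3 (by simp)]; simp only [one_mul]

/-! ### The vertical faces -/

lemma mem_F134 {z : ℂ} {t : ℝ} : pt z t ∈ triMinus P4 P3 P1 ↔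
    ∃ e, Arc e ∧ z = om * (e - 1) ∧ 2 * e.im ≤ t := by
  simp only [triMinus, Set.mem_ofPred_eq, mem_edge_P3_P1]
  constructor
  · rintro ⟨_, ⟨e, he, rfl⟩, h⟩
    exact ⟨e, he, mem_edge_pt_P4.mp h⟩
  · rintro ⟨e, he, h⟩
    exact ⟨_, ⟨e, he, rfl⟩, mem_edge_pt_P4.mpr h⟩

lemma mem_F124 {z : ℂ} {t : ℝ} : pt z t ∈ triMinus P4 P1 P2 ↔
    Arc z ∧ Real.sqrt 3 ≤ t := by
  simp only [triMinus, Set.mem_ofPred_eq, mem_edge_P1_P2]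
  constructor
  · rintro ⟨_, ⟨e, he, rfl⟩, h⟩
    obtain ⟨rfl, h'⟩ := mem_edge_pt_P4.mp h
    exact ⟨he, h'⟩
  · rintro ⟨he, h⟩
    exact ⟨_, ⟨z, he, rfl⟩, mem_edge_pt_P4.mpr ⟨rfl, h⟩⟩

lemma mem_low {z : ℂ} {t : ℝ} : pt z t ∈ triPlus P4 P1 P2 ↔
    Arc z ∧ t ≤ Real.sqrt 3 := by
  simp only [triPlus, Set.mem_ofPred_eq, mem_edge_P1_P2]
  constructor
  · rintro ⟨_, ⟨e, he, rfl⟩, h⟩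
    obtain ⟨rfl, h'⟩ := mem_edge_P4_pt.mp h
    exact ⟨he, h'⟩
  · rintro ⟨he, h⟩
    exact ⟨_, ⟨z, he, rfl⟩, mem_edge_P4_pt.mpr ⟨rfl, h⟩⟩

lemma mem_tetB {z : ℂ} {t : ℝ} : pt z t ∈ tetB ↔
    ∃ e e', Arc e ∧ Arc e' ∧ z = e * om * (e' - 1) ∧ 2 * e'.im ≤ t := by
  simp only [tetB, ballOver, triPlus, Set.mem_ofPred_eq, mem_edge_P1_P2]
  constructor
  · rintro ⟨_, ⟨_, ⟨e, he, rfl⟩, h1⟩, h2⟩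
    obtain ⟨e', he', rfl⟩ := (mem_edge_P3 he.norm).mp h1
    exact ⟨e, e', he, he', mem_edge_pt_P4.mp h2⟩
  · rintro ⟨e, e', he, he', h⟩
    exact ⟨_, ⟨_, ⟨e, he, rfl⟩, (mem_edge_P3 he.norm).mpr ⟨e', he', rfl⟩⟩, mem_edge_pt_P4.mpr h⟩

end

section

/-! ### The base triangle of the standard tetrahedra -/

lemma normSq_add_om (z : ℂ) : Complex.normSq (z + om) =
    Complex.normSq z + 1 - z.re - Real.sqrt 3 * z.im := by
  simp only [Complex.normSq_apply, Complex.add_re, Complex.add_im, om_re, om_im]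
  linear_combination (1 / 4) * sqrt3_sq

lemma normSq_sub_star_om (z : ℂ) : Complex.normSq (z - star om) =
    Complex.normSq z + 1 + z.re - Real.sqrt 3 * z.im := by
  simp only [Complex.normSq_apply, Complex.sub_re, Complex.sub_im, Complex.star_def,
    Complex.conj_re, Complex.conj_im, om_re, om_im]
  linear_combination (1 / 4) * sqrt3_sq

/-- The common vertical projection of the standard tetrahedra. -/
def InT (z : ℂ) : Prop :=
  Complex.normSq z ≤ 1 ∧ Complex.normSq (z + om) ≤ 1 ∧ 1 ≤ Complex.normSq (z - star om)

/-! ### The tetrahedron of type `B` -/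

/-- With `e = p + iq`, `e' = p' + iq'`, `s = √3` and `z = eω(e' - 1)`, the hypotheses `h1` and `h2`
are `|z + ω| ≤ 1` and `|z - ω̄| ≥ 1`. They force `e` onto the arc, so that every point of the base
triangle lies below the tetrahedron. -/
lemma arc_of_tetB {p q p' q' s : ℝ} (hs : s * s = 3) (hs0 : 0 < s) (h : p * p + q * q = 1)
    (h' : p' * p' + q' * q' = 1) (hq' : 0 < q') (hp' : 1 / 2 ≤ p')
    (h1 : (1 - p') * (1 - p) ≤ q * q')
    (h2 : 0 ≤ (1 - p') * (1 + (-p / 2 - s * q / 2)) + (s / 2 * p - q / 2) * q') :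
    0 ≤ q ∧ q ≤ s * p := by
  have hp1 : p' < 1 := by nlinarith
  have hpp : p ≤ 1 := by nlinarith
  have hq : 0 ≤ q := by
    by_contra hc; push Not at hc
    nlinarith [mul_nonneg (sub_nonneg.mpr hp1.le) (sub_nonneg.mpr hpp),
        mul_pos (neg_pos.mpr hc) hq']
  refine ⟨hq, ?_⟩
  by_contra hc; push Not at hc
  have h3 : s * (1 - p') ≤ q' := by
    by_contra h4; push Not at h4
    have : q' * q' < s * (1 - p') * (s * (1 - p')) := by nlinarith
    nlinarith
  -- `P + iQ` is the point `ω ē` of the unit circle.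
  set P := -p / 2 - s * q / 2 with hP
  have hPQ : P * P + (q / 2 - s / 2 * p) * (q / 2 - s / 2 * p) = 1 := by
    rw [hP]; linear_combination h + (p * p + q * q) / 4 * hs
  have hQ : 0 < q / 2 - s / 2 * p := by linarith
  set Q := q / 2 - s / 2 * p with hQd
  clear_value P Q
  have hP1 : -1 ≤ P := by nlinarith
  have h5 : Q * s ≤ 1 + P := by
    have : Q * (s * (1 - p')) ≤ (1 - p') * (1 + P) := by nlinarith
    have h1p : 0 < 1 - p' := by linarith
    nlinarith
  have h6 : 1 / 2 ≤ P := by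
    have : -1 < P := by nlinarith
    have h7 : Q * s * (Q * s) ≤ (1 + P) * (1 + P) := by
      apply mul_le_mul h5 h5 (by positivity) (by linarith)
    nlinarith
  have hqs : 0 ≤ Q / 2 - s / 2 * P := by
    have : q = Q / 2 - s / 2 * P := by rw [hP, hQd]; linear_combination -(q / 4) * hs
    linarith
  have hp2 : p = -P / 2 - s / 2 * Q := by rw [hP, hQd]; linear_combination -(p / 4) * hs
  have h7 : 3 * P ≤ s * Q := by
    have := mul_nonneg hs0.le hqs
    linear_combination 2 * this - P * hs
  have h8 : p ≤ -1 := by linarith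
  have h9 : 0 ≤ (-1 - p) * (1 - p) := mul_nonneg (by linarith) (by linarith)
  have h10 : q = 0 := mul_self_eq_zero.mp (le_antisymm (by linarith) (mul_self_nonneg q))
  rw [h10] at h1
  nlinarith

/-- On the bottom face `|z|² = |e' - 1|² = 2 - 2 Re e'`, so the height `2 Im e'` depends on `|z|`
alone and the face is a graph. Conversely `|z|` determines `e'`, and then `z` determines `e`, except
at `z = 0`, where `e' = 1`. -/
lemma mem_tetB_iff {z : ℂ} {t : ℝ} : pt z t ∈ tetB ↔
    InT z ∧ Real.sqrt (4 * Complex.normSq z - Complex.normSq z ^ 2) ≤ t := by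
  have hs := sqrt3_sq
  have hs0 := sqrt3_pos
  set s := Real.sqrt 3 with hsd
  have hO : om * star om = 1 := by rw [star_om]; linear_combination -om_sq
  have hexp (e e' : ℂ) : (e * om * (e' - 1)).re = (e.re * om.re - e.im * om.im) * (e'.re - 1) -
      (e.re * om.im + e.im * om.re) * e'.im ∧ (e * om * (e' - 1)).im =
      (e.re * om.re - e.im * om.im) * e'.im + (e.re * om.im + e.im * om.re) * (e'.re - 1) := by
    constructor <;> simp
  rw [mem_tetB, InT, normSq_add_om, normSq_sub_star_om]
  rw [← hsd]
  constructor
  · rintro ⟨e, e', he, he', rfl, ht⟩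
    have hr := he.re_ge
    have hr' := he'.re_ge
    obtain ⟨a1, a2, a3⟩ := he
    obtain ⟨b1, b2, b3⟩ := he'
    rw [← hsd] at a3 b3
    have hN : Complex.normSq (e * om * (e' - 1)) = 2 - 2 * e'.re := by
      rw [Complex.normSq_mul, Complex.normSq_mul, Complex.normSq_apply e, a1,
        show Complex.normSq om = 1 by
          rw [Complex.normSq_apply, om_re, om_im]; linear_combination (1 / 4) * hs,
        Complex.normSq_apply, Complex.sub_re, Complex.sub_im, Complex.one_re, Complex.one_im]
      linear_combination b1
    rw [hN, (hexp e e').1, (hexp e e').2, om_re, om_im, ← hsd]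
    have c1 : 1 - e.re ≤ e.im := by nlinarith
    have c2 : 1 - e'.re ≤ e'.im := by nlinarith
    have c3 : (1 - e'.re) * (1 - e.re) ≤ e.im * e'.im := by
      rw [mul_comm e.im]
      apply mul_le_mul c2 c1 _ b2
      nlinarith
    have c4 : 0 ≤ (1 - e'.re) * (1 + (-e.re / 2 - s * e.im / 2)) +
        (s / 2 * e.re - e.im / 2) * e'.im := by
      have : 0 ≤ 1 - e'.re := by nlinarith
      have : -1 ≤ -e.re / 2 - s * e.im / 2 := by
        nlinarith [sq_nonneg (s * e.re - e.im)]
      have : 0 ≤ s / 2 * e.re - e.im / 2 := by linarith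
      apply add_nonneg <;> apply mul_nonneg <;> linarith
    refine ⟨⟨by linarith, ?_, ?_⟩, ?_⟩
    · linear_combination 2 * c3 - (e.im * e'.im / 2 + e.re * (1 - e'.re) / 2) * hs
    · linear_combination 2 * c4 + (e.im * e'.im / 2 + e.re * (1 - e'.re) / 2) * hs
    · refine le_trans (le_of_eq ?_) ht
      rw [show 4 * (2 - 2 * e'.re) - (2 - 2 * e'.re) ^ 2 = (2 * e'.im) ^ 2 by
        linear_combination -4 * b1]
      exact Real.sqrt_sq (by linarith)
  · rintro ⟨⟨h1, h2, h3⟩, ht⟩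
    set ρ := Complex.normSq z with hρ
    have hρ0 : 0 ≤ ρ := Complex.normSq_nonneg z
    set q' := Real.sqrt (4 * ρ - ρ ^ 2) / 2 with hq'
    have hq0 : 0 ≤ q' := by positivity
    have hqq : q' * q' = ρ - ρ ^ 2 / 4 := by
      have := Real.mul_self_sqrt (show 0 ≤ 4 * ρ - ρ ^ 2 by nlinarith)
      rw [hq']; linear_combination this / 4
    set e' : ℂ := ⟨1 - ρ / 2, q'⟩ with he'
    have harc' : Arc e' := by
      refine ⟨?_, hq0, ?_⟩
      · simp only [he']; linear_combination hqq
      · simp only [he']; rw [← hsd]; by_contra hc; push Not at hc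
        have : s * (1 - ρ / 2) * (s * (1 - ρ / 2)) < q' * q' := by
          have : 0 ≤ s * (1 - ρ / 2) := by apply mul_nonneg hs0.le; linarith
          nlinarith
        nlinarith
    rcases eq_or_ne z 0 with hz | hz
    · have hρz : ρ = 0 := by rw [hρ, hz]; simp
      refine ⟨1, 1, arc_one, arc_one, by simp [hz], ?_⟩
      rw [hρz] at ht; simpa using ht
    have hρp : 0 < ρ := Complex.normSq_pos.mpr hz
    have hqp : 0 < q' := by
      rcases hq0.lt_or_eq with h | h
      · exact h
      · rw [← h] at hqq; nlinarith
    have he1 : e' - 1 ≠ 0 := fun h => by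
      have := congrArg Complex.im h
      simp [he'] at this; linarith
    set e := z * star om / (e' - 1) with hed
    have hez : z = e * om * (e' - 1) := by
      have h4 : e * (e' - 1) = z * star om := div_mul_cancel₀ _ he1
      linear_combination -z * hO - om * h4
    have hn : Complex.normSq (e' - 1) = ρ := by
      rw [Complex.normSq_apply]; simp [he']; linear_combination hqq
    have hne : e.re * e.re + e.im * e.im = 1 := by
      have : ρ = Complex.normSq e * Complex.normSq om * Complex.normSq (e' - 1) := by
        rw [hρ]; conv_lhs => rw [hez]
        rw [Complex.normSq_mul, Complex.normSq_mul]
      rw [hn, show Complex.normSq om = 1 by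
          rw [Complex.normSq_apply, om_re, om_im]; linear_combination (1 / 4) * hs] at this
      rw [← Complex.normSq_apply]
      apply mul_right_cancel₀ hρp.ne'; linarith
    have hre := congrArg Complex.re hez
    have him := congrArg Complex.im hez
    rw [(hexp e e').1, om_re, om_im] at hre
    rw [(hexp e e').2, om_re, om_im] at him
    have hr1 : e'.re = 1 - ρ / 2 := rfl
    have hr2 : e'.im = q' := rfl
    rw [hr1, hr2, ← hsd] at hre him
    refine ⟨e, e', ⟨hne, ?_⟩, harc', hez, by simp only [he']; rw [hq']; linarith⟩
    apply arc_of_tetB hs hs0 hne harc'.1 hqp harc'.re_ge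
    · rw [hr1, hr2]; rw [hre, him] at h2
      linear_combination h2 / 2 + (e.im * q' / 4 + e.re * ρ / 8) * hs
    · rw [hr1, hr2]; rw [hre, him] at h3
      linear_combination h3 / 2 - (e.im * q' / 4 + e.re * ρ / 8) * hs

end

section

/-! ### The tetrahedron of type `A` -/

lemma normSq_om : Complex.normSq om = 1 := by
  rw [Complex.normSq_apply, om_re, om_im]; linear_combination (1 / 4) * sqrt3_sq

lemma om_mul_star : om * star om = 1 := by rw [star_om]; linear_combination -om_sq

lemma Arc.xc_eq {e : ℂ} (h : Arc e) (τ : ℝ) :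
    xc (om * (e - 1), 2 * e.im + 2 * τ) = e - 1 + Complex.I * τ := by
  have h1 := h.1
  apply Complex.ext
  · rw [xc_re]
    simp only [Complex.normSq_mul, normSq_om]
    rw [Complex.normSq_apply]
    simp
    linear_combination -h1 / 2
  · rw [xc_im]; simp; ring

lemma cs_re' (τ : ℝ) : (1 + Complex.I * om * τ).re = 1 + Real.sqrt 3 / 2 * τ := by
  simp [om_re, om_im]; ring

lemma cs_im' (τ : ℝ) : (1 + Complex.I * om * τ).im = -τ / 2 := by
  simp [om_re, om_im]; ring

lemma cs_ne' {τ : ℝ} (hτ : -(Real.sqrt 3) / 2 ≤ τ) : 1 + Complex.I * om * τ ≠ 0 := fun h => by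
  have := cs_re' τ
  rw [h] at this
  have hp := sqrt3_pos
  have hs := sqrt3_sq
  simp at this
  nlinarith

lemma cs_normSq (τ : ℝ) : Complex.normSq (1 + Complex.I * om * τ) =
    1 + Real.sqrt 3 * τ + τ ^ 2 := by
  rw [Complex.normSq_apply, cs_re', cs_im']; linear_combination τ ^ 2 / 4 * sqrt3_sq

lemma mulVec_lift_pt (A : Matrix (Fin 3) (Fin 3) ℂ) (z : ℂ) (t : ℝ) (i : Fin 3) :
    (A *ᵥ lift (pt z t)) i = A i 0 * xc (z, t) + A i 1 * z + A i 2 :=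
  mulVec_lift_apply A (z, t) i

lemma conj_om : (starRingEnd ℂ) om = -1 - om := star_om

lemma xc_cm {A : Matrix (Fin 3) (Fin 3) ℂ} (hA : IsUnit21 A) {q : ℂ × ℝ} (h : den A q ≠ 0) :
    xc (cm A q) = (A *ᵥ lift (q : Hbar)) 0 / (A *ᵥ lift (q : Hbar)) 2 := by
  obtain ⟨c, hc, h1⟩ := hA.exists_lift q
  rw [crMap_coe h] at h1
  rw [h1, lift_coe]
  simp [hc]

lemma G1_face_two {e : ℂ} (he : Arc e) (τ : ℝ) :
    (G1 *ᵥ lift (pt (om * (e - 1)) (2 * e.im + 2 * τ))) 2 = -om * (1 + Complex.I * om * τ) := by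
  rw [mulVec_lift_pt, he.xc_eq]
  simp [G1, conj_om]
  linear_combination (e - 1 + Complex.I * τ) * om_sq

lemma G1_face_zero {e : ℂ} (he : Arc e) (τ : ℝ) :
    (G1 *ᵥ lift (pt (om * (e - 1)) (2 * e.im + 2 * τ))) 0 = -om * (e - 1 + Complex.I * τ) := by
  rw [mulVec_lift_pt, he.xc_eq]
  simp [G1]

/-- The values of `G1` on the face `(134)`. -/
lemma crMap_G1_face {e : ℂ} (he : Arc e) {τ : ℝ} (hτ : 0 ≤ τ) :
    crMap G1 (pt (om * (e - 1)) (2 * e.im + 2 * τ)) =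
      pt (om * e / (1 + Complex.I * om * τ) - om)
        (2 * ((e - 1 + Complex.I * τ) / (1 + Complex.I * om * τ)).im) := by
  have hc : 1 + Complex.I * om * τ ≠ 0 := cs_ne' (by have := sqrt3_pos; linarith)
  have h2 := G1_face_two he τ
  have h0 := G1_face_zero he τ
  have h1 : (G1 *ᵥ lift (pt (om * (e - 1)) (2 * e.im + 2 * τ))) 1 =
      e - 1 + Complex.I * τ + om * (e - 1) := by
    rw [mulVec_lift_pt, he.xc_eq]
    simp [G1]
  have hk := inv_mul_cancel₀ hc
  simp only [div_eq_mul_inv]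
  set k := (1 + Complex.I * om * (τ : ℂ))⁻¹
  apply stereo_eq_pt
  · rw [h2]; exact mul_ne_zero (neg_ne_zero.mpr om_ne_zero) hc
  · rw [h1, h2]
    linear_combination om ^ 2 * e * hk + (e - 1 - Complex.I * τ * om + Complex.I * τ) * om_sq
  · rw [h2, h0]
    linear_combination om * (e - 1 + Complex.I * τ) * hk

lemma G1_P4 : crMap G1 P4 = P2 := by
  have : P2 = pt (-om) (2 * (star om).im) := by
    rw [P2, Complex.star_def, Complex.conj_im, om_im]; ring_nf
  rw [this]
  apply stereo_eq_pt <;> simp [P4_def, lift_infty, G1, conj_om, Matrix.mulVec, dotProduct,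
    Fin.sum_univ_three]
  · intro h; apply om_ne_zero; linear_combination (om + 1) * h - om_sq
  · linear_combination om_sq
  · linear_combination om_sq

lemma om_mul_neg_om_sub_one : om * (-om - 1) = 1 := by linear_combination -om_sq

lemma two_mul_neg_om_im : 2 * (-om).im = Real.sqrt 3 := by rw [Complex.neg_im, om_im]; ring

lemma G1_P1 : crMap G1 P1 = P1 := by
  have := crMap_G1_face arc_neg_om le_rfl (τ := 0)
  rw [om_mul_neg_om_sub_one, two_mul_neg_om_im] at this
  simp only [mul_zero, add_zero, Complex.ofReal_zero, div_one] at this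
  rw [P1, this, pt_inj]
  refine ⟨by linear_combination -om_sq, ?_⟩
  rw [Complex.sub_im, Complex.one_im, sub_zero, two_mul_neg_om_im]

lemma G1_P3 : crMap G1 P3 = P3 := by
  have := crMap_G1_face arc_one le_rfl (τ := 0)
  simpa [P3] using this

lemma P3_ne_P1 : P3 ≠ P1 := by simp [P3, P1, pt_inj]

lemma P4_notMem_edge_P3_P1 : P4 ∉ edge P3 P1 := by
  rw [mem_edge_P3_P1]
  rintro ⟨e, -, h⟩
  exact pt_ne_infty _ _ h.symm

/-- `G1` fixes `P1` and `P3` and sends `P4` to `P2`. The bottom face of type `A` thus inherits from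
the vertical face (134) its parameters: `e` on the arc and the height `τ` above it. -/
lemma faceA_eq : triMinus P2 P3 P1 = crMap G1 '' triMinus P4 P3 P1 := by
  rw [isUnit21_G1.triMinus_image P3_ne_P1 P4_notMem_edge_P3_P1, G1_P4, G1_P3, G1_P1]

lemma mem_faceA {X : Hbar} : X ∈ triMinus P2 P3 P1 ↔ X = P2 ∨ ∃ (e : ℂ) (τ : ℝ), Arc e ∧ 0 ≤ τ ∧
    X = pt (om * e / (1 + Complex.I * om * τ) - om)
        (2 * ((e - 1 + Complex.I * τ) / (1 + Complex.I * om * τ)).im) := by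
  rw [faceA_eq]
  constructor
  · rintro ⟨Y, hY, rfl⟩
    induction Y using OnePoint.rec with
    | infty => exact Or.inl G1_P4
    | coe q =>
      rw [coe_eq_pt, mem_F134] at hY
      obtain ⟨e, he, h1, h2⟩ := hY
      refine Or.inr ⟨e, q.2 / 2 - e.im, he, by linarith, ?_⟩
      rw [← crMap_G1_face he (by linarith), coe_eq_pt, h1]
      congr 2; ring
  · rintro (rfl | ⟨e, τ, he, hτ, rfl⟩)
    · exact ⟨P4, ⟨P1, Or.inl rfl, infty_mem_edge_P4 _⟩, G1_P4⟩
    · exact ⟨_, mem_F134.mpr ⟨e, he, rfl, by linarith⟩, crMap_G1_face he hτ⟩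

lemma mem_tetA {z : ℂ} (hz : z ≠ -om) {t : ℝ} : pt z t ∈ tetA ↔
    ∃ (e : ℂ) (τ : ℝ), Arc e ∧ 0 ≤ τ ∧ z = om * e / (1 + Complex.I * om * τ) - om ∧
      2 * ((e - 1 + Complex.I * τ) / (1 + Complex.I * om * τ)).im ≤ t := by
  simp only [tetA, ballOver, Set.mem_ofPred_eq, mem_faceA]
  constructor
  · rintro ⟨_, rfl | ⟨e, τ, he, hτ, rfl⟩, h⟩
    · exact absurd (mem_edge_pt_P4.mp h).1 hz
    · exact ⟨e, τ, he, hτ, mem_edge_pt_P4.mp h⟩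
  · rintro ⟨e, τ, he, hτ, h⟩
    exact ⟨_, Or.inr ⟨e, τ, he, hτ, rfl⟩, mem_edge_pt_P4.mpr h⟩

/-- The parameter `τ` of the point of the bottom face of `tetA` over `z`. -/
def tauA (z : ℂ) : ℝ := -(Real.sqrt 3) / 2 + Real.sqrt (1 / Complex.normSq (z + om) - 1 / 4)

/-- The height of the bottom face of `tetA` over `z`. -/
def heightA (z : ℂ) : ℝ :=
  2 * ((star om * (z + om) * (1 + Complex.I * om * tauA z) - 1 + Complex.I * tauA z) /
    (1 + Complex.I * om * tauA z)).im

lemma tauA_ge (z : ℂ) : -(Real.sqrt 3) / 2 ≤ tauA z := by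
  rw [tauA]; linarith [Real.sqrt_nonneg (1 / Complex.normSq (z + om) - 1 / 4)]

lemma continuousAt_heightA {z : ℂ} (hz : z ≠ -om) : ContinuousAt heightA z := by
  have h0 : Complex.normSq (z + om) ≠ 0 := by
    rw [Ne, Complex.normSq_eq_zero]; intro h; exact hz (eq_neg_of_add_eq_zero_left h)
  have h1 : ContinuousAt tauA z := by
    unfold tauA
    have : ContinuousAt (fun z => 1 / Complex.normSq (z + om)) z :=
      continuousAt_const.div (by fun_prop) h0
    fun_prop
  have h2 := cs_ne' (tauA_ge z)
  unfold heightA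
  refine continuousAt_const.mul (Complex.continuous_im.continuousAt.comp ?_)
  refine ContinuousAt.div ?_ ?_ h2 <;> fun_prop

/-- On the face `|z + ω| = 1 / |1 + iωτ|`, and `|1 + iωτ|² = (τ + √3/2)² + 1/4`; `tauA` solves this
for `τ`. -/
lemma tauA_eq {e : ℂ} (he : Arc e) {τ : ℝ} (hτ : 0 ≤ τ) :
    tauA (om * e / (1 + Complex.I * om * τ) - om) = τ := by
  have hs := sqrt3_sq
  have hp := sqrt3_pos
  rw [tauA, sub_add_cancel, Complex.normSq_div, Complex.normSq_mul, normSq_om, cs_normSq,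
    Complex.normSq_apply e, he.1]
  rw [show 1 / (1 * 1 / (1 + Real.sqrt 3 * τ + τ ^ 2)) - 1 / 4 = (Real.sqrt 3 / 2 + τ) ^ 2 by
    rw [one_mul, one_div_one_div]; linear_combination -(1 / 4) * hs]
  rw [Real.sqrt_sq (by positivity)]; ring

lemma heightA_eq {e : ℂ} (he : Arc e) {τ : ℝ} (hτ : 0 ≤ τ) :
    heightA (om * e / (1 + Complex.I * om * τ) - om) =
      2 * ((e - 1 + Complex.I * τ) / (1 + Complex.I * om * τ)).im := by
  have hc : 1 + Complex.I * om * τ ≠ 0 := cs_ne' (by have := sqrt3_pos; linarith)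
  rw [heightA, tauA_eq he hτ, sub_add_cancel, mul_assoc, div_mul_cancel₀ _ hc, ← mul_assoc,
    mul_comm (star om), om_mul_star, one_mul]

/-- Two of the three inequalities of `InT` in the parameters of the face. The third, `|z + ω| ≤ 1`,
amounts to `|1 + iωτ| ≥ 1`. -/
lemma normSq_faceA (e : ℂ) (τ : ℝ) (he : e.re * e.re + e.im * e.im = 1) (hτ : 0 ≤ τ) :
    (Complex.normSq (om * e / (1 + Complex.I * om * τ) - om) ≤ 1 ↔
      1 ≤ 2 * e.re + τ * (Real.sqrt 3 * e.re - e.im)) ∧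
    (1 ≤ Complex.normSq (om * e / (1 + Complex.I * om * τ) - om - star om) ↔
      0 ≤ 1 - e.re + e.im * (Real.sqrt 3 + 2 * τ)) := by
  have hs := sqrt3_sq
  have hp := sqrt3_pos
  have hc : 1 + Complex.I * om * τ ≠ 0 := cs_ne' (by linarith)
  have hn := cs_normSq τ
  set n := 1 + Real.sqrt 3 * τ + τ ^ 2 with hnd
  have hn0 : 0 < n := by positivity
  constructor
  · have h2 (c : ℂ) (hc : c ≠ 0) : om * e / c - om = om * (e - c) / c := by field_simp
    rw [h2 _ hc, Complex.normSq_div, hn, Complex.normSq_mul, normSq_om, one_mul, div_le_one hn0,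
      Complex.normSq_apply, Complex.sub_re, Complex.sub_im, cs_re', cs_im']
    constructor <;> intro h
    · linear_combination h - he - τ ^ 2 / 4 * hs
    · linear_combination h + he + τ ^ 2 / 4 * hs
  · have h2 (c : ℂ) (hc : c ≠ 0) : om * e / c - om - star om = (om * e + c) / c := by
      rw [star_om]; field_simp; ring
    rw [h2 _ hc, Complex.normSq_div, hn, one_le_div hn0, Complex.normSq_apply, Complex.add_re,
      Complex.add_im, cs_re', cs_im', Complex.mul_re, Complex.mul_im, om_re, om_im]
    constructor <;> intro h
    · linear_combination h + he + (τ ^ 2 / 4 + (e.re * e.re + e.im * e.im) / 4 + e.im * τ / 2) * hs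
    · linear_combination h - he - (τ ^ 2 / 4 + (e.re * e.re + e.im * e.im) / 4 + e.im * τ / 2) * hs

lemma arc_of_tetA {p q τ s : ℝ} (hs : s * s = 3) (hs0 : 0 < s) (hτ : 0 ≤ τ)
    (h : p * p + q * q = 1) (h1 : 1 ≤ 2 * p + τ * (s * p - q))
    (h2 : 0 ≤ 1 - p + q * (s + 2 * τ)) : 0 ≤ q ∧ q ≤ s * p := by
  have hq : 0 ≤ q := by
    by_contra hc; push Not at hc
    have h3 : s * (-q) ≤ 1 - p := by nlinarith [mul_nonneg hτ (neg_pos.mpr hc).le]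
    have h4 : p ≤ -1 / 2 := by
      have h5 : s * (-q) * (s * (-q)) ≤ (1 - p) * (1 - p) := by
        apply mul_le_mul h3 h3 (by nlinarith) (by nlinarith)
      have h6 : 0 < 1 - p := by nlinarith
      nlinarith
    have h7 : -q ≤ s / 2 := by
      by_contra h8; push Not at h8
      nlinarith
    have h9 : s * p - q ≤ 0 := by nlinarith
    linarith [mul_nonneg hτ (neg_nonneg.mpr h9)]
  refine ⟨hq, ?_⟩
  by_contra hc; push Not at hc
  have h3 : 1 / 2 ≤ p := by nlinarith
  have h4 : q ≤ s / 2 := by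
    by_contra h8; push Not at h8
    nlinarith
  nlinarith

lemma InT.exists_faceA {z : ℂ} (h : InT z) (hz : z ≠ -om) : ∃ (e : ℂ) (τ : ℝ), Arc e ∧ 0 ≤ τ ∧
    z = om * e / (1 + Complex.I * om * τ) - om := by
  obtain ⟨h1, h2, h3⟩ := h
  have hs := sqrt3_sq
  have hp := sqrt3_pos
  have h0 : 0 < Complex.normSq (z + om) := by
    rw [Complex.normSq_pos]; intro h; exact hz (eq_neg_of_add_eq_zero_left h)
  have hinv : 1 ≤ 1 / Complex.normSq (z + om) := by rwa [one_le_div h0]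
  have hτ : 0 ≤ tauA z := by
    have : Real.sqrt 3 / 2 ≤ Real.sqrt (1 / Complex.normSq (z + om) - 1 / 4) := by
      apply Real.le_sqrt_of_sq_le
      nlinarith
    rw [tauA]; linarith
  set τ := tauA z with hτd
  have hc := cs_ne' (tauA_ge z)
  rw [← hτd] at hc
  have hnn : Complex.normSq (1 + Complex.I * om * τ) = 1 / Complex.normSq (z + om) := by
    have := Real.mul_self_sqrt (show 0 ≤ 1 / Complex.normSq (z + om) - 1 / 4 by linarith)
    rw [show Real.sqrt (1 / Complex.normSq (z + om) - 1 / 4) = τ + Real.sqrt 3 / 2 by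
      rw [hτd, tauA]; ring] at this
    rw [cs_normSq]; linear_combination this - hs / 4
  set e := star om * (z + om) * (1 + Complex.I * om * τ) with he
  have hze : z = om * e / (1 + Complex.I * om * τ) - om := by
    rw [he, ← mul_assoc, mul_div_cancel_right₀ _ hc]
    linear_combination -(z + om) * om_mul_star
  have hne : e.re * e.re + e.im * e.im = 1 := by
    rw [← Complex.normSq_apply, he, Complex.normSq_mul, Complex.normSq_mul, hnn,
      Complex.star_def, Complex.normSq_conj, normSq_om]
    field_simp
  have h4 := normSq_faceA e τ hne hτ
  rw [← hze] at h4
  exact ⟨e, τ, ⟨hne, arc_of_tetA hs hp hτ hne (h4.1.mp h1) (h4.2.mp h3)⟩, hτ, hze⟩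

lemma inT_faceA {e : ℂ} (he : Arc e) {τ : ℝ} (hτ : 0 ≤ τ) :
    InT (om * e / (1 + Complex.I * om * τ) - om) := by
  have hp := sqrt3_pos
  have hr := he.re_ge
  have h4 := normSq_faceA e τ he.1 hτ
  obtain ⟨a1, a2, a3⟩ := he
  refine ⟨h4.1.mpr ?_, ?_, h4.2.mpr ?_⟩
  · have := mul_nonneg hτ (sub_nonneg.mpr a3)
    linarith
  · rw [sub_add_cancel, Complex.normSq_div, Complex.normSq_mul, normSq_om, cs_normSq,
      Complex.normSq_apply e, a1, div_le_one (by positivity)]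
    nlinarith [mul_nonneg hp.le hτ, sq_nonneg τ]
  · have : e.re ≤ 1 := by nlinarith
    have := mul_nonneg a2 (show 0 ≤ Real.sqrt 3 + 2 * τ by positivity)
    linarith

lemma mem_faceA_iff {z : ℂ} (hz : z ≠ -om) {t : ℝ} : pt z t ∈ triMinus P2 P3 P1 ↔
    InT z ∧ t = heightA z := by
  rw [mem_faceA]
  constructor
  · rintro (h | ⟨e, τ, he, hτ, h⟩)
    · exact absurd (pt_inj.mp h).1 hz
    · obtain ⟨rfl, rfl⟩ := pt_inj.mp h
      exact ⟨inT_faceA he hτ, (heightA_eq he hτ).symm⟩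
  · rintro ⟨h, rfl⟩
    obtain ⟨e, τ, he, hτ, rfl⟩ := h.exists_faceA hz
    exact Or.inr ⟨e, τ, he, hτ, by rw [heightA_eq he hτ]⟩

lemma mem_tetA_iff {z : ℂ} (hz : z ≠ -om) {t : ℝ} : pt z t ∈ tetA ↔ InT z ∧ heightA z ≤ t := by
  rw [mem_tetA hz]
  constructor
  · rintro ⟨e, τ, he, hτ, rfl, h⟩
    exact ⟨inT_faceA he hτ, by rwa [heightA_eq he hτ]⟩
  · rintro ⟨h, h'⟩
    obtain ⟨e, τ, he, hτ, rfl⟩ := h.exists_faceA hz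
    exact ⟨e, τ, he, hτ, rfl, by rwa [heightA_eq he hτ] at h'⟩

/-- The last coordinate of the image of `(z, t)` under the developing map near the edges `(12)`
and `(23)`, up to a constant. -/
def denD (q : ℂ × ℝ) : ℂ := q.1 - om * xc q - star om

/-- Over a fixed `z`, `|D|²` is a quadratic polynomial in the height with vertex `√3 + √3 Re z - Im
z`. Below the vertex it decreases, so comparing heights there is the same as comparing values of
`|D|²`, in the opposite order. -/
lemma normSq_denD_sub (z : ℂ) (t t' : ℝ) :
    Complex.normSq (denD (z, t)) - Complex.normSq (denD (z, t')) =
      (t - t') * ((t + t') / 4 - (Real.sqrt 3 + Real.sqrt 3 * z.re - z.im) / 2) := by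
  simp only [denD, Complex.normSq_apply, Complex.sub_re, Complex.sub_im, Complex.mul_re,
    Complex.mul_im, om_re, om_im, xc_re, xc_im, Complex.star_def, Complex.conj_re, Complex.conj_im]
  linear_combination (t^2 - t'^2) / 16 * sqrt3_sq

/-- On the face `D` and `z + ω` are quotients of complex numbers of modulus one by the same `1 +
iωτ`. Near the edges (12) and (23) this replaces the explicit height function by a polynomial
equation. -/
lemma normSq_denD_faceA {z : ℂ} {t : ℝ} (hz : z ≠ -om) (h : pt z t ∈ triMinus P2 P3 P1) :
    Complex.normSq (denD (z, t)) = Complex.normSq (z + om) := by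
  rcases mem_faceA.mp h with h | ⟨e, τ, he, hτ, h⟩
  · exact absurd (pt_inj.mp h).1 hz
  have hc : 1 + Complex.I * om * τ ≠ 0 := cs_ne' (by have := sqrt3_pos; linarith)
  have h5 : xc (z, t) = (e - 1 + Complex.I * τ) / (1 + Complex.I * om * τ) := by
    have h1 := crMap_G1_face he hτ
    rw [← h] at h1
    rw [← cm_eq h1, xc_cm isUnit21_G1 (den_ne_zero h1)]
    change (G1 *ᵥ lift (pt _ _)) 0 / (G1 *ᵥ lift (pt _ _)) 2 = _
    rw [G1_face_zero he, G1_face_two he, mul_div_mul_left _ _ (neg_ne_zero.mpr om_ne_zero)]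
  obtain ⟨rfl, rfl⟩ := pt_inj.mp h
  have h6 : denD (om * e / (1 + Complex.I * om * τ) - om,
      2 * ((e - 1 + Complex.I * τ) / (1 + Complex.I * om * τ)).im) =
      -star om / (1 + Complex.I * om * τ) := by
    rw [denD, h5, star_om]
    have hk := inv_mul_cancel₀ hc
    simp only [div_eq_mul_inv]
    linear_combination -hk
  rw [h6, sub_add_cancel, Complex.normSq_div, Complex.normSq_div, Complex.normSq_neg,
    Complex.normSq_mul, normSq_om, Complex.star_def, Complex.normSq_conj, normSq_om,
    Complex.normSq_apply e, he.1, one_mul]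

end

section

/-! ### The standard tetrahedra and slabs near interior points of their edges -/

/-- The points of the edge `(14)`. -/
def q14 (t : ℝ) : ℂ × ℝ := (1, t)

/-- The points of the edge `(34)`. -/
def q34 (t : ℝ) : ℂ × ℝ := (0, t - Real.sqrt 3)

/-- The points of the edge `(12)`. -/
def q12 (t : ℝ) : ℂ × ℝ :=
  (⟨(2 * Real.sqrt 3 * t - (1 - t ^ 2)) / (2 * (1 + t ^ 2)),
    -(Real.sqrt 3 * (1 - t ^ 2) + 2 * t) / (2 * (1 + t ^ 2))⟩, Real.sqrt 3)

/-- The points of the edge `(23)` of the tetrahedron of type `A`. -/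
def q23 (t : ℝ) : ℂ × ℝ :=
  (⟨1 / 2 - 2 / (1 + t ^ 2), Real.sqrt 3 / 2 - 2 * t / (1 + t ^ 2)⟩,
    (Real.sqrt 3 * t ^ 2 - 2 * t - Real.sqrt 3) / (1 + t ^ 2))

lemma cs_edge (t : ℝ) : 1 + Complex.I * om * ((t - Real.sqrt 3) / 2 : ℝ) =
    ⟨(1 + Real.sqrt 3 * t) / 4, (Real.sqrt 3 - t) / 4⟩ := by
  apply Complex.ext
  · rw [cs_re']; linear_combination -(1 / 4) * sqrt3_sq
  · rw [cs_im']; ring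

lemma q14_mem_F134 {t : ℝ} (ht : Real.sqrt 3 ≤ t) : (q14 t : Hbar) ∈ triMinus P4 P3 P1 := by
  rw [coe_eq_pt, mem_F134]
  exact ⟨-om, arc_neg_om, om_mul_neg_om_sub_one.symm, by rw [two_mul_neg_om_im]; exact ht⟩

lemma q34_mem_F134 {t : ℝ} (ht : Real.sqrt 3 ≤ t) : (q34 t : Hbar) ∈ triMinus P4 P3 P1 := by
  rw [coe_eq_pt, mem_F134]
  exact ⟨1, arc_one, by simp [q34], by simpa [q34] using ht⟩

/-- This is the origin of the formula for `q12`, as `G1_q34` is for `q23`: the parameter is carried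
along by the face pairings, so that the points of all corners with the same `t` represent one point
of the edge. -/
lemma G1_q14 {t : ℝ} (ht : Real.sqrt 3 ≤ t) : crMap G1 (q14 t) = q12 t := by
  have hs := sqrt3_sq
  have hp := sqrt3_pos
  have h := crMap_G1_face arc_neg_om (show 0 ≤ (t - Real.sqrt 3) / 2 by linarith)
  have hc : 1 + Complex.I * om * ((t - Real.sqrt 3) / 2 : ℝ) ≠ 0 := cs_ne' (by linarith)
  rw [om_mul_neg_om_sub_one, two_mul_neg_om_im] at h
  rw [show Real.sqrt 3 + 2 * ((t - Real.sqrt 3) / 2) = t by ring] at h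
  change crMap G1 (pt 1 t) = pt _ _
  rw [h, pt_inj]
  have h1 : (-om - 1 + Complex.I * ((t - Real.sqrt 3) / 2 : ℝ)) /
      (1 + Complex.I * om * ((t - Real.sqrt 3) / 2 : ℝ)) = star om := by
    rw [div_eq_iff hc, star_om]
    linear_combination Complex.I * ((t - Real.sqrt 3) / 2 : ℝ) * om_sq
  refine ⟨?_, ?_⟩
  · rw [sub_eq_iff_eq_add, div_eq_iff hc, cs_edge]
    have : 1 + t ^ 2 ≠ 0 := by positivity
    apply Complex.ext
    · simp only [Complex.mul_re, Complex.neg_re, Complex.neg_im, Complex.add_re, Complex.add_im,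
        om_re, om_im]
      field_simp
      ring_nf
    · simp only [Complex.mul_im, Complex.neg_re, Complex.neg_im, Complex.add_re, Complex.add_im,
        om_re, om_im]
      field_simp
      ring_nf
  · rw [h1, Complex.star_def, Complex.conj_im, om_im]; ring

lemma G1_q34 {t : ℝ} (ht : Real.sqrt 3 ≤ t) : crMap G1 (q34 t) = q23 t := by
  have hs := sqrt3_sq
  have hp := sqrt3_pos
  have h := crMap_G1_face arc_one (show 0 ≤ (t - Real.sqrt 3) / 2 by linarith)
  have hc : 1 + Complex.I * om * ((t - Real.sqrt 3) / 2 : ℝ) ≠ 0 := cs_ne' (by linarith)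
  rw [sub_self, mul_zero, Complex.one_im, mul_zero, zero_add] at h
  rw [show 2 * ((t - Real.sqrt 3) / 2) = t - Real.sqrt 3 by ring] at h
  change crMap G1 (pt 0 (t - Real.sqrt 3)) = pt _ _
  rw [h, pt_inj]
  have hne : 1 + t ^ 2 ≠ 0 := by positivity
  refine ⟨?_, ?_⟩
  · rw [sub_eq_iff_eq_add, div_eq_iff hc, cs_edge]
    apply Complex.ext
    · simp only [Complex.mul_re, Complex.one_re, Complex.one_im, Complex.add_re, Complex.add_im,
        om_re, om_im]
      field_simp
      ring_nf
    · simp only [Complex.mul_im, Complex.one_re, Complex.one_im, Complex.add_re, Complex.add_im,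
        om_re, om_im]
      field_simp
      ring_nf
  · rw [Complex.div_im, cs_normSq, cs_edge]
    simp
    have : (1 + √3 * ((t - √3) / 2) + ((t - √3) / 2) ^ 2) = (1 + t ^ 2) / 4 := by
      linear_combination -(1 / 4) * hs
    rw [this]
    field_simp
    ring_nf
    grind

/-- The point lies on one wall of the base triangle and strictly inside the other two, so near it
only that wall and the bottom face are seen. -/
lemma q12_arc {t : ℝ} (ht : Real.sqrt 3 < t) : Complex.normSq (q12 t).1 = 1 ∧
    Complex.normSq ((q12 t).1 + om) < 1 ∧ 1 < Complex.normSq ((q12 t).1 - star om) := by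
  have hs := sqrt3_sq
  have hp := sqrt3_pos
  have h1 : Complex.normSq (q12 t).1 = 1 := by
    rw [Complex.normSq_apply, q12]; field_simp; ring_nf; grind
  rw [normSq_add_om, normSq_sub_star_om, h1]
  have h2 : (q12 t).1.re + Real.sqrt 3 * (q12 t).1.im = 1 + (t ^ 2 - 3) / (1 + t ^ 2) := by
    simp only [q12]; field_simp; ring_nf; grind
  have h3 : (q12 t).1.re - Real.sqrt 3 * (q12 t).1.im =
      -1 + (2 + 2 * Real.sqrt 3 * t) / (1 + t ^ 2) := by
    simp only [q12]; field_simp; ring_nf; grind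
  have h4 : 0 < (t ^ 2 - 3) / (1 + t ^ 2) := div_pos (by nlinarith) (by positivity)
  have h5 : 0 < (2 + 2 * Real.sqrt 3 * t) / (1 + t ^ 2) :=
    div_pos (by nlinarith) (by positivity)
  exact ⟨rfl, by linarith, by linarith⟩

lemma q23_arc {t : ℝ} (ht : Real.sqrt 3 < t) : Complex.normSq (q23 t).1 < 1 ∧
    Complex.normSq ((q23 t).1 + om) < 1 ∧ Complex.normSq ((q23 t).1 - star om) = 1 := by
  have hs := sqrt3_sq
  have hp := sqrt3_pos
  have h1 : Complex.normSq (q23 t).1 = 1 + (2 - 2 * t * Real.sqrt 3) / (1 + t ^ 2) := by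
    rw [Complex.normSq_apply, q23]; field_simp; ring_nf; grind
  have h2 : Complex.normSq ((q23 t).1 + om) = 1 - (t ^ 2 - 3) / (1 + t ^ 2) := by
    rw [normSq_add_om, h1]; simp only [q23]; field_simp; ring_nf; grind
  have h3 : Complex.normSq ((q23 t).1 - star om) = 1 := by
    rw [normSq_sub_star_om, h1]; simp only [q23]; field_simp; ring_nf; grind
  have h4 : 0 < (t ^ 2 - 3) / (1 + t ^ 2) := div_pos (by nlinarith) (by positivity)
  have h5 : (2 - 2 * t * Real.sqrt 3) / (1 + t ^ 2) < 0 :=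
    div_neg_of_neg_of_pos (by nlinarith) (by positivity)
  exact ⟨by linarith, by linarith, h3⟩

lemma q12_ne {t : ℝ} (ht : Real.sqrt 3 < t) : (q12 t).1 ≠ -om := by
  intro h
  have := congrArg Complex.im h
  rw [Complex.neg_im, om_im] at this
  have hs := sqrt3_sq
  have hp := sqrt3_pos
  simp only [q12] at this
  field_simp at this
  nlinarith

lemma q23_ne (t : ℝ) : (q23 t).1 ≠ -om := by
  intro h
  have := congrArg Complex.re h
  rw [Complex.neg_re, om_re] at this
  simp only [q23] at this
  have h2 : 0 < 2 / (1 + t ^ 2) := by positivity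
  linarith

lemma q12_mem_faceA {t : ℝ} (ht : Real.sqrt 3 ≤ t) : (q12 t : Hbar) ∈ triMinus P2 P3 P1 := by
  rw [faceA_eq]; exact ⟨_, q14_mem_F134 ht, G1_q14 ht⟩

lemma q23_mem_faceA {t : ℝ} (ht : Real.sqrt 3 ≤ t) : (q23 t : Hbar) ∈ triMinus P2 P3 P1 := by
  rw [faceA_eq]; exact ⟨_, q34_mem_F134 ht, G1_q34 ht⟩

lemma one_ne_neg_om : (1 : ℂ) ≠ -om := fun h => by
  have := congrArg Complex.re h
  rw [Complex.neg_re, om_re] at this; norm_num at this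

lemma heightA_one : heightA 1 = Real.sqrt 3 := by
  have h : pt 1 (Real.sqrt 3) ∈ triMinus P2 P3 P1 := by
    rw [faceA_eq]
    refine ⟨P1, ?_, G1_P1⟩
    exact mem_F134.mpr ⟨-om, arc_neg_om, om_mul_neg_om_sub_one.symm, by rw [two_mul_neg_om_im]⟩
  exact ((mem_faceA_iff one_ne_neg_om).mp h).2.symm

lemma zero_ne_neg_om : (0 : ℂ) ≠ -om := fun h => om_ne_zero (neg_eq_zero.mp h.symm)

lemma heightA_zero : heightA 0 = 0 := by
  have h : pt 0 0 ∈ triMinus P2 P3 P1 := by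
    rw [faceA_eq]
    refine ⟨P3, ?_, G1_P3⟩
    exact mem_F134.mpr ⟨1, arc_one, by simp, by simp⟩
  exact ((mem_faceA_iff zero_ne_neg_om).mp h).2.symm

lemma eventually_ne_neg_om {q : ℂ × ℝ} (h : q.1 ≠ -om) : ∀ᶠ x : ℂ × ℝ in 𝓝 q, x.1 ≠ -om :=
  continuous_fst.continuousAt.eventually_ne h

lemma eventually_heightA_lt {q : ℂ × ℝ} (h : q.1 ≠ -om) (h2 : heightA q.1 < q.2) :
    ∀ᶠ x : ℂ × ℝ in 𝓝 q, heightA x.1 < x.2 :=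
  Tendsto.eventually_lt ((continuousAt_heightA h).comp continuous_fst.continuousAt)
    continuous_snd.continuousAt h2

lemma continuous_normSq_add (c : ℂ) : Continuous fun q : ℂ × ℝ => Complex.normSq (q.1 + c) :=
  Complex.continuous_normSq.comp (by fun_prop)

/-- Near the edge `(14)`. -/
lemma eventually_mem_tetA_14 {t : ℝ} (ht : Real.sqrt 3 < t) : ∀ᶠ x : ℂ × ℝ in 𝓝 (q14 t),
    ((x : Hbar) ∈ tetA ↔ Complex.normSq x.1 ≤ 1 ∧ Complex.normSq (x.1 + om) ≤ 1) := by
  have h3 : ∀ᶠ x : ℂ × ℝ in 𝓝 (q14 t), 1 < Complex.normSq (x.1 - star om) := by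
    refine (continuous_normSq_add (-star om)).continuousAt.eventually_const_lt ?_
    beta_reduce
    rw [← sub_eq_add_neg, normSq_sub_star_om]; simp [q14]
  filter_upwards [h3, eventually_ne_neg_om (q := q14 t) one_ne_neg_om,
    eventually_heightA_lt (q := q14 t) one_ne_neg_om (by simpa [q14, heightA_one] using ht)]
    with x h3 hne h4
  rw [coe_eq_pt, mem_tetA_iff hne, InT]
  exact ⟨fun h => ⟨h.1.1, h.1.2.1⟩, fun h => ⟨⟨h.1, h.2, h3.le⟩, h4.le⟩⟩

lemma eventually_heightB_lt {q : ℂ × ℝ}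
    (h2 : Real.sqrt (4 * Complex.normSq q.1 - Complex.normSq q.1 ^ 2) < q.2) :
    ∀ᶠ x : ℂ × ℝ in 𝓝 q, Real.sqrt (4 * Complex.normSq x.1 - Complex.normSq x.1 ^ 2) < x.2 :=
  Tendsto.eventually_lt (Continuous.continuousAt (by
    have := Complex.continuous_normSq; fun_prop)) continuous_snd.continuousAt h2

lemma eventually_mem_tetB_14 {t : ℝ} (ht : Real.sqrt 3 < t) : ∀ᶠ x : ℂ × ℝ in 𝓝 (q14 t),
    ((x : Hbar) ∈ tetB ↔ Complex.normSq x.1 ≤ 1 ∧ Complex.normSq (x.1 + om) ≤ 1) := by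
  have h3 : ∀ᶠ x : ℂ × ℝ in 𝓝 (q14 t), 1 < Complex.normSq (x.1 - star om) := by
    refine (continuous_normSq_add (-star om)).continuousAt.eventually_const_lt ?_
    beta_reduce
    rw [← sub_eq_add_neg, normSq_sub_star_om]; simp [q14]
  filter_upwards [h3, eventually_heightB_lt (q := q14 t) (by norm_num [q14]; exact ht)]
    with x h3 h4
  rw [coe_eq_pt, mem_tetB_iff, InT]
  exact ⟨fun h => ⟨h.1.1, h.1.2.1⟩, fun h => ⟨⟨h.1, h.2, h3.le⟩, h4.le⟩⟩

lemma eventually_mem_tetA_34 {t : ℝ} (ht : Real.sqrt 3 < t) : ∀ᶠ x : ℂ × ℝ in 𝓝 (q34 t),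
    ((x : Hbar) ∈ tetA ↔ Complex.normSq (x.1 + om) ≤ 1 ∧
      1 ≤ Complex.normSq (x.1 - star om)) := by
  have h3 : ∀ᶠ x : ℂ × ℝ in 𝓝 (q34 t), Complex.normSq x.1 < 1 := by
    refine (Complex.continuous_normSq.comp continuous_fst).continuousAt.eventually_lt_const ?_
    simp [q34]
  filter_upwards [h3, eventually_ne_neg_om (q := q34 t) zero_ne_neg_om,
    eventually_heightA_lt (q := q34 t) zero_ne_neg_om (by simpa [q34, heightA_zero] using ht)]
    with x h3 hne h4
  rw [coe_eq_pt, mem_tetA_iff hne, InT]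
  exact ⟨fun h => h.1.2, fun h => ⟨⟨h3.le, h⟩, h4.le⟩⟩

lemma eventually_mem_tetB_34 {t : ℝ} (ht : Real.sqrt 3 < t) : ∀ᶠ x : ℂ × ℝ in 𝓝 (q34 t),
    ((x : Hbar) ∈ tetB ↔ Complex.normSq (x.1 + om) ≤ 1 ∧
      1 ≤ Complex.normSq (x.1 - star om)) := by
  have h3 : ∀ᶠ x : ℂ × ℝ in 𝓝 (q34 t), Complex.normSq x.1 < 1 := by
    refine (Complex.continuous_normSq.comp continuous_fst).continuousAt.eventually_lt_const ?_
    simp [q34]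
  filter_upwards [h3, eventually_heightB_lt (q := q34 t) (by simpa [q34] using ht)]
    with x h3 h4
  rw [coe_eq_pt, mem_tetB_iff, InT]
  exact ⟨fun h => h.1.2, fun h => ⟨⟨h3.le, h⟩, h4.le⟩⟩

/-- Near a point of the bottom face that lies below the axis of `|D|²` as a function of the height,
the upper side is given by `|D|² ≤ |z + ω|²`. -/
lemma eventually_heightA_le_iff {q : ℂ × ℝ} (h : q.1 ≠ -om) (hq : (q : Hbar) ∈ triMinus P2 P3 P1)
    (h2 : q.2 < Real.sqrt 3 + Real.sqrt 3 * q.1.re - q.1.im) :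
    ∀ᶠ x : ℂ × ℝ in 𝓝 q, InT x.1 → (heightA x.1 ≤ x.2 ↔
      Complex.normSq (denD x) ≤ Complex.normSq (x.1 + om)) := by
  have hq2 := ((mem_faceA_iff h).mp hq).2
  have hc : ContinuousAt (fun x : ℂ × ℝ => (x.2 + heightA x.1) / 4) q :=
    (continuous_snd.continuousAt.add
      ((continuousAt_heightA h).comp continuous_fst.continuousAt)).div_const _
  have h3 : ∀ᶠ x : ℂ × ℝ in 𝓝 q, (x.2 + heightA x.1) / 4 <
      (Real.sqrt 3 + Real.sqrt 3 * x.1.re - x.1.im) / 2 := by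
    refine Tendsto.eventually_lt hc (g := fun x : ℂ × ℝ =>
      (Real.sqrt 3 + Real.sqrt 3 * x.1.re - x.1.im) / 2) (Continuous.continuousAt ?_) ?_
    · have := Complex.continuous_re; have := Complex.continuous_im; fun_prop
    · beta_reduce; rw [← hq2]; linarith
  filter_upwards [h3, eventually_ne_neg_om h] with x h3 hne hT
  have h5 := normSq_denD_faceA hne ((mem_faceA_iff hne).mpr ⟨hT, rfl⟩)
  have h6 := normSq_denD_sub x.1 x.2 (heightA x.1)
  rw [h5] at h6
  constructor
  · intro h7
    have := mul_nonpos_of_nonneg_of_nonpos (sub_nonneg.mpr h7) (sub_nonpos.mpr h3.le)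
    linarith
  · intro h7
    by_contra hc; push Not at hc
    have := mul_pos_of_neg_of_neg (sub_neg.mpr hc) (sub_neg.mpr h3)
    linarith

lemma q12_below {t : ℝ} (ht : Real.sqrt 3 < t) :
    (q12 t).2 < Real.sqrt 3 + Real.sqrt 3 * (q12 t).1.re - (q12 t).1.im := by
  have hs := sqrt3_sq
  have hp := sqrt3_pos
  have h2 : Real.sqrt 3 * (q12 t).1.re - (q12 t).1.im = 4 * t / (1 + t ^ 2) := by
    simp only [q12]; field_simp; ring_nf; grind
  have h3 : 0 < 4 * t / (1 + t ^ 2) := div_pos (by linarith) (by positivity)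
  change Real.sqrt 3 < _
  linarith

lemma q23_below {t : ℝ} (ht : Real.sqrt 3 < t) :
    (q23 t).2 < Real.sqrt 3 + Real.sqrt 3 * (q23 t).1.re - (q23 t).1.im := by
  have hs := sqrt3_sq
  have hp := sqrt3_pos
  have h2 : Real.sqrt 3 + Real.sqrt 3 * (q23 t).1.re - (q23 t).1.im - (q23 t).2 =
      4 * t / (1 + t ^ 2) := by
    simp only [q23]; field_simp; ring_nf
  have h3 : 0 < 4 * t / (1 + t ^ 2) := div_pos (by linarith) (by positivity)
  linarith

lemma eventually_mem_tetA_12 {t : ℝ} (ht : Real.sqrt 3 < t) : ∀ᶠ x : ℂ × ℝ in 𝓝 (q12 t),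
    ((x : Hbar) ∈ tetA ↔ Complex.normSq (denD x) ≤ Complex.normSq (x.1 + om) ∧
      Complex.normSq x.1 ≤ 1) := by
  obtain ⟨h1, h2, h3⟩ := q12_arc ht
  have h2' := (continuous_normSq_add om).continuousAt.eventually_lt_const h2
  have h3' := (continuous_normSq_add (-star om)).continuousAt.eventually_const_lt h3
  filter_upwards [h2', h3', eventually_ne_neg_om (q12_ne ht),
    eventually_heightA_le_iff (q12_ne ht) (q12_mem_faceA ht.le) (q12_below ht)] with x h2 h3 hne h4
  rw [coe_eq_pt, mem_tetA_iff hne]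
  constructor
  · rintro ⟨h, h'⟩; exact ⟨(h4 h).mp h', h.1⟩
  · rintro ⟨h, h'⟩
    have hT : InT x.1 := ⟨h', h2.le, h3.le⟩
    exact ⟨hT, (h4 hT).mpr h⟩

lemma eventually_mem_tetA_23 {t : ℝ} (ht : Real.sqrt 3 < t) : ∀ᶠ x : ℂ × ℝ in 𝓝 (q23 t),
    ((x : Hbar) ∈ tetA ↔ 1 ≤ Complex.normSq (x.1 - star om) ∧
      Complex.normSq (denD x) ≤ Complex.normSq (x.1 + om)) := by
  obtain ⟨h1, h2, h3⟩ := q23_arc ht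
  have h1' := (Complex.continuous_normSq.comp continuous_fst).continuousAt.eventually_lt_const h1
  have h2' := (continuous_normSq_add om).continuousAt.eventually_lt_const h2
  filter_upwards [h1', h2', eventually_ne_neg_om (q23_ne t),
    eventually_heightA_le_iff (q23_ne t) (q23_mem_faceA ht.le) (q23_below ht)] with x h1 h2 hne h4
  rw [coe_eq_pt, mem_tetA_iff hne]
  constructor
  · rintro ⟨h, h'⟩; exact ⟨h.2.2, (h4 h).mp h'⟩
  · rintro ⟨h, h'⟩
    have hT : InT x.1 := ⟨h1.le, h2.le, h⟩
    exact ⟨hT, (h4 hT).mpr h'⟩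

lemma normSq_xc (q : ℂ × ℝ) : Complex.normSq (xc q) = (Complex.normSq q.1 ^ 2 + q.2 ^ 2) / 4 := by
  rw [Complex.normSq_apply, xc_re, xc_im]; ring

/-- For positive heights `√(4ρ - ρ²) ≤ t` may be squared, and `|x|² = (ρ² + t²)/4` for the zeroth
coordinate `x`, where `ρ = |z|²`; the bottom face becomes `|z| = |x|`. -/
lemma eventually_mem_tetB_12 {t : ℝ} (ht : Real.sqrt 3 < t) : ∀ᶠ x : ℂ × ℝ in 𝓝 (q12 t),
    ((x : Hbar) ∈ tetB ↔ Complex.normSq x.1 ≤ Complex.normSq (xc x) ∧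
      Complex.normSq x.1 ≤ 1) := by
  obtain ⟨h1, h2, h3⟩ := q12_arc ht
  have h2' := (continuous_normSq_add om).continuousAt.eventually_lt_const h2
  have h3' := (continuous_normSq_add (-star om)).continuousAt.eventually_const_lt h3
  have h4' : ∀ᶠ x : ℂ × ℝ in 𝓝 (q12 t), 0 < x.2 :=
    continuous_snd.continuousAt.eventually_const_lt (show 0 < (q12 t).2 from sqrt3_pos)
  filter_upwards [h2', h3', h4'] with x h2 h3 h4
  have : Real.sqrt (4 * Complex.normSq x.1 - Complex.normSq x.1 ^ 2) ≤ x.2 ↔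
      Complex.normSq x.1 ≤ Complex.normSq (xc x) := by
    rw [Real.sqrt_le_left h4.le, normSq_xc]
    constructor <;> intro h <;> linarith
  rw [coe_eq_pt, mem_tetB_iff, this, InT]
  exact ⟨fun h => ⟨h.2, h.1.1⟩, fun h => ⟨⟨h.2, h2.le, h3.le⟩, h.1⟩⟩

end

section

/-! ### The slabs near the edge `(12)` -/

/-- The closed plane sector from `-30°` to `270°`. -/
def InCone (y : ℂ) : Prop := y.re - Real.sqrt 3 * y.im ≤ Real.sqrt 3 * ‖y‖

lemma q12_re_add {t : ℝ} (ht : Real.sqrt 3 < t) :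
    1 < (q12 t).1.re + Real.sqrt 3 * (q12 t).1.im := by
  obtain ⟨h1, h2, -⟩ := q12_arc ht
  rw [normSq_add_om, h1] at h2
  linarith

lemma q12_re_sub {t : ℝ} (ht : Real.sqrt 3 < t) :
    0 < Real.sqrt 3 * (q12 t).1.re - (q12 t).1.im := by
  have := q12_below ht
  change Real.sqrt 3 < _ at this
  linarith

lemma q12_im_pos {t : ℝ} (ht : Real.sqrt 3 < t) : 0 < (q12 t).1.im := by
  have hs := sqrt3_sq
  have hp := sqrt3_pos
  simp only [q12]
  refine div_pos ?_ (by positivity)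
  have := mul_pos (sub_pos.mpr ht) (show 0 < Real.sqrt 3 * t + 1 by nlinarith)
  linear_combination this - t * hs

/-- Seen from `-ω`, the open arc lies strictly between the directions `-60°` of the chord to `1` and
`-30°` of the tangent, outside the cone. The auxiliary `u`, `v` are twice the coordinates along
`e^{iπ/3}` and `e^{-iπ/6}`. -/
lemma q12_not_inCone {t : ℝ} (ht : Real.sqrt 3 < t) : ¬ InCone ((q12 t).1 + om) := by
  have hs := sqrt3_sq
  have hp := sqrt3_pos
  obtain ⟨h1, -, -⟩ := q12_arc ht
  have hr := q12_re_add ht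
  have hr2 := q12_re_sub ht
  rw [Complex.normSq_apply] at h1
  have hre : ((q12 t).1 + om).re = (q12 t).1.re - 1 / 2 := by rw [Complex.add_re, om_re]; ring
  have him : ((q12 t).1 + om).im = (q12 t).1.im - Real.sqrt 3 / 2 := by
    rw [Complex.add_im, om_im]; ring
  have hn : ‖(q12 t).1 + om‖ ^ 2 =
      2 - ((q12 t).1.re + Real.sqrt 3 * (q12 t).1.im) := by
    rw [← Complex.normSq_eq_norm_sq, normSq_add_om, Complex.normSq_apply]; linarith
  rw [InCone, hre, him]
  generalize (q12 t).1.re = a at *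
  generalize (q12 t).1.im = b at *
  generalize ‖(q12 t).1 + om‖ = N at *
  intro h
  set u := a + Real.sqrt 3 * b with hu
  set v := Real.sqrt 3 * a - b with hv
  have huv : u * u + v * v = 4 := by rw [hu, hv]; linear_combination 4 * h1 + (a * a + b * b) * hs
  have e1 : a - 1 / 2 - Real.sqrt 3 * (b - Real.sqrt 3 / 2) =
      1 + (Real.sqrt 3 * v - u) / 2 := by rw [hu, hv]; linear_combination (1 / 2 - a / 2) * hs
  rw [e1] at h
  clear_value u v
  have hu2 : u < 2 := by nlinarith
  have h3 : Real.sqrt 3 * (2 - u) < v := by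
    by_contra hc; push Not at hc
    have : v * v ≤ Real.sqrt 3 * (2 - u) * (Real.sqrt 3 * (2 - u)) :=
      mul_le_mul hc hc hr2.le (by nlinarith)
    nlinarith
  have h4 : 2 * (2 - u) < 1 + (Real.sqrt 3 * v - u) / 2 := by nlinarith
  have h5 : (1 + (Real.sqrt 3 * v - u) / 2) ^ 2 ≤ (Real.sqrt 3 * N) ^ 2 := by
    apply pow_le_pow_left₀ _ h
    linarith
  have h6 : (1 + (Real.sqrt 3 * v - u) / 2) ^ 2 ≤ 3 * (2 - u) := by
    rw [mul_pow, hn] at h5; nlinarith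
  have h7 : Real.sqrt 3 * v * 2 ≥ 3 * (2 - u) * 2 := by nlinarith
  have h8 : (2 + u) * (2 - u) = v * v := by linarith
  nlinarith

lemma continuous_cone : Continuous fun x : ℂ × ℝ =>
    ((x.1 + om).re - Real.sqrt 3 * (x.1 + om).im) - Real.sqrt 3 * ‖x.1 + om‖ := by
  have := Complex.continuous_re; have := Complex.continuous_im; fun_prop

lemma eventually_not_inCone {t : ℝ} (ht : Real.sqrt 3 < t) :
    ∀ᶠ x : ℂ × ℝ in 𝓝 (q12 t), ¬ InCone (x.1 + om) := by
  have h := q12_not_inCone ht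
  rw [InCone, not_le] at h
  have := continuous_cone.continuousAt.eventually_const_lt
    (show 0 < ((q12 t).1 + om).re - Real.sqrt 3 * ((q12 t).1 + om).im -
      Real.sqrt 3 * ‖(q12 t).1 + om‖ by linarith)
  filter_upwards [this] with x hx
  rw [InCone, not_le]; linarith

lemma exp_pi_div_six : Complex.exp (-(Real.pi / 6 : ℝ) * Complex.I) =
    ((Real.sqrt 3 / 2 : ℝ) : ℂ) - ((1 / 2 : ℝ) : ℂ) * Complex.I := by
  rw [← Complex.ofReal_neg, Complex.exp_mul_I, ← Complex.ofReal_cos, ← Complex.ofReal_sin,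
    Real.cos_neg, Real.sin_neg, Real.cos_pi_div_six, Real.sin_pi_div_six]
  push_cast; ring

lemma cos_le_of_mem {x : ℝ} (h1 : Real.pi / 6 ≤ x) (h2 : x ≤ 2 * Real.pi - Real.pi / 6) :
    Real.cos x ≤ Real.sqrt 3 / 2 := by
  rw [← Real.cos_pi_div_six]
  have hpi := Real.pi_pos
  rcases le_total x Real.pi with h | h
  · exact Real.cos_le_cos_of_nonneg_of_le_pi (by linarith) h h1
  · rw [← Real.cos_two_pi_sub x]
    exact Real.cos_le_cos_of_nonneg_of_le_pi (by linarith) (by linarith) (by linarith)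

lemma inCone_exp {r th : ℝ} (hr : 0 ≤ r) (h1 : -(Real.pi / 6) ≤ th)
    (h2 : th ≤ 3 * Real.pi / 2) : InCone (r * Complex.exp (th * Complex.I)) := by
  have hc := cos_le_of_mem (x := th + Real.pi / 3) (by linarith) (by linarith)
  rw [Real.cos_add, Real.cos_pi_div_three, Real.sin_pi_div_three] at hc
  rw [InCone, norm_mul, Complex.norm_exp_ofReal_mul_I, Complex.norm_real, Real.norm_of_nonneg hr,
    Complex.re_ofReal_mul, Complex.im_ofReal_mul, Complex.exp_ofReal_mul_I_re,
    Complex.exp_ofReal_mul_I_im]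
  nlinarith

/-- For every `k` the sector part of the base opens at most from `-30°` to `270°`, so it stays
inside the cone and away from the edge. Only the half-strip remains, and the index `k` does not
matter here. -/
lemma eventually_mem_slab (k : ℤ) {t : ℝ} (ht : Real.sqrt 3 < t) :
    ∀ᶠ x : ℂ × ℝ in 𝓝 (q12 t), ((x : Hbar) ∈ slab k ↔ 1 ≤ Complex.normSq x.1) := by
  have hs := sqrt3_sq
  have hp := sqrt3_pos
  have hpi := Real.pi_pos
  obtain ⟨h1, -, -⟩ := q12_arc ht
  have hre := Complex.continuous_re
  have him := Complex.continuous_im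
  have c1 : Continuous fun x : ℂ × ℝ => x.1.re + Real.sqrt 3 * x.1.im := by fun_prop
  have c2 : Continuous fun x : ℂ × ℝ => Real.sqrt 3 * x.1.re - x.1.im := by fun_prop
  have hlt : (q12 t).1.re + Real.sqrt 3 * (q12 t).1.im < 2 := by
    have := q12_re_sub ht
    rw [Complex.normSq_apply] at h1
    nlinarith
  filter_upwards [eventually_not_inCone ht, c1.continuousAt.eventually_const_lt (q12_re_add ht),
    c2.continuousAt.eventually_const_lt (q12_re_sub ht),
    c1.continuousAt.eventually_lt_const hlt] with x hx h2 h3 h4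
  have hmem : (x : Hbar) ∈ slab k ↔ x.1 ∈ slabBase k := by
    constructor
    · rintro (h | ⟨z, hz, t, h⟩)
      · exact absurd h (OnePoint.coe_ne_infty _)
      · rw [coe_eq_pt, pt_inj] at h; rw [h.1]; exact hz
    · exact fun h => Or.inr ⟨x.1, h, x.2, rfl⟩
  rw [hmem, slabBase, Complex.normSq_apply]
  constructor
  · rintro (⟨th, r, ht0, ht1, hr, h⟩ | ⟨th, r, ht0, ht1, hr, h⟩)
    · rw [exp_pi_div_six] at h
      have hre := congrArg Complex.re h
      have him := congrArg Complex.im h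
      simp [Complex.exp_ofReal_mul_I_re, Complex.exp_ofReal_mul_I_im] at hre him
      have hcos : 0 ≤ Real.cos (th + Real.pi / 6) :=
        Real.cos_nonneg_of_mem_Icc ⟨by linarith, by linarith⟩
      rw [Real.cos_add, Real.cos_pi_div_six, Real.sin_pi_div_six] at hcos
      rw [hre, him]
      linear_combination 2 * mul_nonneg hr hcos + sq_nonneg r - Real.sin_sq_add_cos_sq th -
        r ^ 2 / 4 * hs
    · exfalso
      apply hx
      rw [h, show -om + r * Complex.exp (th * Complex.I) + om = r * Complex.exp (th * Complex.I) by
        ring]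
      refine inCone_exp hr ht0 (ht1.trans ?_)
      have : (((1 - k) % 6 : ℤ) : ℝ) ≤ 5 := by exact_mod_cast (by omega : (1 - k) % 6 ≤ 5)
      nlinarith
  · intro h
    left
    -- These are the coordinates of `z` in the orthonormal basis `e^{iπ/3}`, `e^{-iπ/6}`. The strip
    -- line through `z` leaves the arc at the point with the same `u = sin θ`, after which it has
    -- length `r = v - cos θ`.
    set u := (x.1.re + Real.sqrt 3 * x.1.im) / 2 with hu
    set v := (Real.sqrt 3 * x.1.re - x.1.im) / 2 with hv
    have hu1 : 1 / 2 ≤ u := by rw [hu]; linarith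
    have hu2 : u ≤ 1 := by rw [hu]; linarith
    have hv0 : 0 ≤ v := by rw [hv]; linarith
    have huv : 1 ≤ u * u + v * v := by
      rw [hu, hv]; linear_combination h - (x.1.re * x.1.re + x.1.im * x.1.im) / 4 * hs
    have hsin : Real.sin (Real.arcsin u) = u := Real.sin_arcsin (by linarith) hu2
    have hcos : Real.cos (Real.arcsin u) = Real.sqrt (1 - u ^ 2) := Real.cos_arcsin u
    have hcv : Real.cos (Real.arcsin u) ≤ v := by
      rw [hcos]; exact Real.sqrt_le_left hv0 |>.mpr (by nlinarith)
    have hθ1 : Real.pi / 6 ≤ Real.arcsin u := by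
      rw [Real.le_arcsin_iff_sin_le ⟨by linarith, by linarith⟩ ⟨by linarith, hu2⟩,
        Real.sin_pi_div_six]; exact hu1
    have hθ2 := Real.arcsin_le_pi_div_two u
    clear hcos
    generalize Real.arcsin u = θ at *
    refine ⟨θ - Real.pi / 6, v - Real.cos θ, by linarith, by linarith, by linarith, ?_⟩
    rw [exp_pi_div_six]
    apply Complex.ext
    · rw [Complex.add_re, Complex.exp_ofReal_mul_I_re, Real.cos_sub, Real.cos_pi_div_six,
        Real.sin_pi_div_six, hsin]
      simp only [Complex.mul_re, Complex.mul_im, Complex.sub_re, Complex.sub_im, Complex.ofReal_re,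
        Complex.ofReal_im, Complex.I_re, Complex.I_im]
      rw [hu, hv]; linear_combination -(x.1.re / 4) * hs
    · rw [Complex.add_im, Complex.exp_ofReal_mul_I_im, Real.sin_sub, Real.cos_pi_div_six,
        Real.sin_pi_div_six, hsin]
      simp only [Complex.mul_re, Complex.mul_im, Complex.sub_re, Complex.sub_im, Complex.ofReal_re,
        Complex.ofReal_im, Complex.I_re, Complex.I_im]
      rw [hu, hv]; linear_combination -(x.1.im / 4) * hs

/-! ### Faces near the edges -/

lemma eventually_pos {f : ℂ × ℝ → ℝ} (hf : Continuous f) {q : ℂ × ℝ} (h : 0 < f q) :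
    ∀ᶠ x in 𝓝 q, 0 < f x :=
  hf.continuousAt.eventually_const_lt h

lemma mem_F134_iff {z : ℂ} {t : ℝ} : pt z t ∈ triMinus P4 P3 P1 ↔
    Complex.normSq (z + om) = 1 ∧ 0 ≤ Real.sqrt 3 * z.re - z.im ∧
      0 ≤ Real.sqrt 3 * (1 - z.re) - z.im ∧ Real.sqrt 3 * z.re - z.im ≤ t := by
  have hs := sqrt3_sq
  have h (e : ℂ) : z = om * (e - 1) ↔ e = star om * z + 1 := by
    constructor <;> rintro rfl
    · linear_combination -(e - 1) * om_mul_star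
    · linear_combination -z * om_mul_star
  simp only [mem_F134, h]
  have hre : (star om * z + 1).re = -(z.re + Real.sqrt 3 * z.im) / 2 + 1 := by
    simp [om_re, om_im]; ring
  have him : (star om * z + 1).im = (Real.sqrt 3 * z.re - z.im) / 2 := by
    simp [om_re, om_im]; ring
  have : (∃ e, Arc e ∧ e = star om * z + 1 ∧ 2 * e.im ≤ t) ↔
      Arc (star om * z + 1) ∧ 2 * (star om * z + 1).im ≤ t :=
    ⟨by rintro ⟨_, h1, rfl, h2⟩; exact ⟨h1, h2⟩, fun h => ⟨_, h.1, rfl, h.2⟩⟩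
  rw [this, Arc, hre, him, normSq_add_om, Complex.normSq_apply]
  constructor
  · rintro ⟨⟨h1, h2, h3⟩, h4⟩
    refine ⟨by linear_combination h1 - (z.re ^ 2 + z.im ^ 2) / 4 * hs, by linarith, ?_, by linarith⟩
    linear_combination h3 - z.im / 2 * hs
  · rintro ⟨h1, h2, h3, h4⟩
    refine ⟨⟨by linear_combination h1 + (z.re ^ 2 + z.im ^ 2) / 4 * hs, by linarith, ?_⟩,
        by linarith⟩
    linear_combination h3 + z.im / 2 * hs

lemma mem_F124_iff {z : ℂ} {t : ℝ} : pt z t ∈ triMinus P4 P1 P2 ↔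
    Complex.normSq z = 1 ∧ 0 ≤ z.im ∧ z.im ≤ Real.sqrt 3 * z.re ∧ Real.sqrt 3 ≤ t := by
  rw [mem_F124, Arc, Complex.normSq_apply]; tauto

lemma mem_low_iff {z : ℂ} {t : ℝ} : pt z t ∈ triPlus P4 P1 P2 ↔
    Complex.normSq z = 1 ∧ 0 ≤ z.im ∧ z.im ≤ Real.sqrt 3 * z.re ∧ t ≤ Real.sqrt 3 := by
  rw [mem_low, Arc, Complex.normSq_apply]; tauto

lemma crMap_G2_pt (z : ℂ) (t : ℝ) :
    crMap G2 (pt z t) = pt (star om * (1 - z)) (t + 2 * z.im - Real.sqrt 3) := by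
  have : t + 2 * z.im - Real.sqrt 3 = 2 * (xc (z, t) + z + om).im := by
    simp [xc_im, om_im]; ring
  rw [this]
  apply stereo_eq_pt <;> simp [mulVec_lift_pt, G2, conj_om] <;> ring

lemma crMap_G3_pt (z : ℂ) (t : ℝ) : crMap G3 (pt z t) = pt (-om * z) t := by
  have : t = 2 * (xc (z, t)).im := by rw [xc_im]; ring
  conv_rhs => rw [this]
  apply stereo_eq_pt <;> simp [mulVec_lift_pt, G3]

lemma crMap_infty {A : Matrix (Fin 3) (Fin 3) ℂ} (h : A 2 0 = 0) :
    crMap A OnePoint.infty = OnePoint.infty :=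
  stereo_of_eq (by simp [lift_infty, Matrix.mulVec, dotProduct, Fin.sum_univ_three, h])

/-- Here and in the next lemmas an image face is placed on a surface with a simple equation, which
suffices to show that it misses a neighbourhood of certain edge points. -/
lemma G2_face_normSq {x : ℂ × ℝ} (hx : (x : Hbar) ∈ crMap G2 '' triMinus P4 P1 P2) :
    Complex.normSq (x.1 - star om) = 1 := by
  obtain ⟨Y, hY, h⟩ := hx
  induction Y using OnePoint.rec with
  | infty => rw [crMap_infty (by simp [G2])] at h; exact absurd h.symm (OnePoint.coe_ne_infty _)
  | coe q =>
    rw [coe_eq_pt, mem_F124_iff] at hY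
    rw [coe_eq_pt, crMap_G2_pt, coe_eq_pt, pt_inj] at h
    rw [← h.1, show star om * (1 - q.1) - star om = star om * -q.1 by ring, Complex.normSq_mul,
      Complex.star_def, Complex.normSq_conj, normSq_om, Complex.normSq_neg, hY.1, one_mul]

lemma G3_face_normSq {x : ℂ × ℝ} (hx : (x : Hbar) ∈ crMap G3 '' triMinus P4 P3 P1) :
    Complex.normSq (x.1 - star om) = 1 := by
  obtain ⟨Y, hY, h⟩ := hx
  induction Y using OnePoint.rec with
  | infty => rw [crMap_infty (by simp [G3])] at h; exact absurd h.symm (OnePoint.coe_ne_infty _)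
  | coe q =>
    rw [coe_eq_pt, mem_F134_iff] at hY
    rw [coe_eq_pt, crMap_G3_pt, coe_eq_pt, pt_inj] at h
    rw [← h.1, show -om * q.1 - star om = -om * (q.1 + om) by
      rw [star_om]; linear_combination om_sq, Complex.normSq_mul, Complex.normSq_neg, normSq_om,
      hY.1, one_mul]

lemma G4_face_normSq {x : ℂ × ℝ} (hx : (x : Hbar) ∈ crMap G4 '' triPlus P4 P1 P2) :
    Complex.normSq (xc x) = Complex.normSq x.1 := by
  obtain ⟨Y, hY, h⟩ := hx
  induction Y using OnePoint.rec with
  | infty =>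
    have h2 := h
    change crMap G4 P4 = _ at h2
    have : crMap G4 P4 = pt 0 0 := by
      have : (0 : ℝ) = 2 * (0 : ℂ).im := by simp
      rw [this]
      apply stereo_eq_pt <;> simp [P4_def, lift_infty, G4, Matrix.mulVec, dotProduct,
        Fin.sum_univ_three, om_ne_zero]
    rw [this, coe_eq_pt, pt_inj] at h2
    rw [normSq_xc, ← h2.1, ← h2.2]; simp
  | coe q =>
    rw [coe_eq_pt, mem_low_iff] at hY
    have hd := den_ne_zero h
    rw [← cm_eq h, xc_cm isUnit21_G4 hd, cm, chart]
    simp only [Complex.normSq_div]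
    congr 1
    rw [mulVec_lift_apply, mulVec_lift_apply]
    simp [G4, Complex.normSq_mul, Complex.normSq_conj, hY.1]

lemma G1_face_height {x : ℂ × ℝ} (hx : (x : Hbar) ∈ crMap G1 '' triMinus P4 P3 P1)
    (h : x.1 ≠ -om) : x.2 = heightA x.1 := by
  rw [← faceA_eq, coe_eq_pt, mem_faceA_iff h] at hx
  exact hx.2

/-- In the `z`-plane, `G3` carries the ray of `B'` to the ray at `-ω` of direction `30°`, and each
`G2` rotates by `-60°` about `-ω`. None of the six resulting directions lies strictly between `270°`
and `330°`. -/
lemma inCone_bigon (n : ℕ) {x : ℂ × ℝ} (hx : (x : Hbar) ∈ crMap (G2 ^ n * G3) '' bigonB) :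
    InCone (x.1 + om) := by
  have key (n : ℕ) (z : ℂ) (t : ℝ) : ∃ t', crMap (G2 ^ n * G3) (pt z t) =
      pt (-om + (-star om) ^ n * (-om) * (z - 1)) t' := by
    induction n with
    | zero => exact ⟨t, by rw [pow_zero, one_mul, crMap_G3_pt]; congr 1; ring⟩
    | succ n ih =>
      obtain ⟨t', h⟩ := ih
      rw [pow_succ', mul_assoc, crMap_mul _ ((isUnit21_G2.pow n).mul isUnit21_G3),
        Function.comp_apply, h, crMap_G2_pt]
      refine ⟨_, pt_inj.mpr ⟨?_, rfl⟩⟩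
      rw [pow_succ', star_om]
      linear_combination -om_sq
  have h2 : (-star om) ^ 2 = om := by rw [star_om]; linear_combination om_sq
  have h3 : (-star om) ^ 3 = -1 := by rw [pow_succ, h2]; linear_combination -om_mul_star
  have hpow : (-star om) ^ 6 = 1 := by linear_combination ((-star om) ^ 3 - 1) * h3
  have hp := sqrt3_pos
  have hs := sqrt3_sq
  -- For a direction `ρ e^{iπ/6}` with `|ρ| = 1` the cone condition reads `Im ρ ≥ -√3/2`; `-ω̄` is a
  -- sixth root of unity, so six cases suffice.
  have him : -(Real.sqrt 3) / 2 ≤ ((-star om) ^ n).im := by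
    rw [← Nat.div_add_mod n 6, pow_add, pow_mul, hpow, one_pow, one_mul]
    have h6 := Nat.mod_lt n (show 6 > 0 by norm_num)
    interval_cases n % 6
    · simp; linarith
    · simp [om_im]
    · rw [h2, om_im]
    · rw [h3]; simp; linarith
    · rw [show 4 = 2 * 2 by rfl, pow_mul, h2, om_sq]; simp [om_im]; linarith
    · rw [show 5 = 3 + 2 by rfl, pow_add, h2, h3]; simp [om_im]; linarith
  have hn : ‖(-star om) ^ n‖ = 1 := by
    have h1 : ‖om‖ = 1 := by simpa using arc_neg_om.norm
    rw [norm_pow, norm_neg, norm_star, h1, one_pow]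
  obtain ⟨Y, hY, h⟩ := hx
  rcases hY with rfl | ⟨r, s, hr, rfl⟩
  · rw [P4_def, crMap_mul _ isUnit21_G3, Function.comp_apply, crMap_infty (by simp [G3])] at h
    have hG (n : ℕ) : crMap (G2 ^ n) OnePoint.infty = OnePoint.infty := by
      induction n with
      | zero => rw [pow_zero, crMap_one, id]
      | succ n ih =>
        rw [pow_succ', crMap_mul _ (isUnit21_G2.pow n), Function.comp_apply, ih,
          crMap_infty (by simp [G2])]
    rw [hG] at h
    exact absurd h.symm (OnePoint.coe_ne_infty _)
  · obtain ⟨t', ht'⟩ := key n (1 + r * Complex.exp (-(Real.pi / 6 : ℝ) * Complex.I)) s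
    rw [ht', coe_eq_pt, pt_inj] at h
    have e1 : x.1 + om = (-star om) ^ n *
        (-om * (r * Complex.exp (-(Real.pi / 6 : ℝ) * Complex.I))) := by
      rw [← h.1]; ring
    have e2 : -om * (r * Complex.exp (-(Real.pi / 6 : ℝ) * Complex.I)) =
        (r : ℂ) * ⟨Real.sqrt 3 / 2, 1 / 2⟩ := by
      rw [exp_pi_div_six]
      apply Complex.ext
      · simp [om_re, om_im]; ring
      · simp [om_re, om_im]; linear_combination r / 4 * hs
    have e3 : ‖(⟨Real.sqrt 3 / 2, 1 / 2⟩ : ℂ)‖ = 1 := by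
      have := Complex.normSq_eq_norm_sq ⟨Real.sqrt 3 / 2, 1 / 2⟩
      rw [Complex.normSq_apply] at this
      nlinarith [norm_nonneg (⟨Real.sqrt 3 / 2, 1 / 2⟩ : ℂ)]
    rw [e1, e2, InCone, norm_mul, norm_mul, hn, e3, Complex.norm_real, Real.norm_of_nonneg hr]
    simp only [Complex.mul_re, Complex.mul_im, Complex.ofReal_re, Complex.ofReal_im]
    have := mul_nonneg hr (sub_nonneg.mpr him)
    linear_combination 2 * this - r * ((-star om) ^ n).im / 2 * hs

lemma eventually_F134_14 {t : ℝ} (ht : Real.sqrt 3 < t) : ∀ᶠ x : ℂ × ℝ in 𝓝 (q14 t),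
    ((x : Hbar) ∈ triMinus P4 P3 P1 ↔ Complex.normSq (x.1 + om) = 1 ∧
      0 ≤ Real.sqrt 3 * (1 - x.1.re) - x.1.im) := by
  have hre := Complex.continuous_re
  have him := Complex.continuous_im
  have c1 : Continuous fun x : ℂ × ℝ => Real.sqrt 3 * x.1.re - x.1.im := by fun_prop
  have c2 : Continuous fun x : ℂ × ℝ => x.2 - (Real.sqrt 3 * x.1.re - x.1.im) := by fun_prop
  filter_upwards [eventually_pos c1 (q := q14 t) (by
    simp [q14]), eventually_pos c2 (q := q14 t) (by
    simpa [q14] using ht)] with x h1 h2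
  rw [coe_eq_pt, mem_F134_iff]
  exact ⟨fun h => ⟨h.1, h.2.2.1⟩, fun h => ⟨h.1, h1.le, h.2, by linarith⟩⟩

lemma eventually_F134_34 {t : ℝ} (ht : Real.sqrt 3 < t) : ∀ᶠ x : ℂ × ℝ in 𝓝 (q34 t),
    ((x : Hbar) ∈ triMinus P4 P3 P1 ↔ Complex.normSq (x.1 + om) = 1 ∧
      0 ≤ Real.sqrt 3 * x.1.re - x.1.im) := by
  have hre := Complex.continuous_re
  have him := Complex.continuous_im
  have c1 : Continuous fun x : ℂ × ℝ => Real.sqrt 3 * (1 - x.1.re) - x.1.im := by fun_prop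
  have c2 : Continuous fun x : ℂ × ℝ => x.2 - (Real.sqrt 3 * x.1.re - x.1.im) := by fun_prop
  filter_upwards [eventually_pos c1 (q := q34 t) (by
    simp [q34]), eventually_pos c2 (q := q34 t) (by
    simpa [q34] using ht)] with x h1 h2
  rw [coe_eq_pt, mem_F134_iff]
  exact ⟨fun h => ⟨h.1, h.2.1⟩, fun h => ⟨h.1, h.2, h1.le, by linarith⟩⟩

lemma eventually_F124_14 {t : ℝ} (ht : Real.sqrt 3 < t) : ∀ᶠ x : ℂ × ℝ in 𝓝 (q14 t),
    ((x : Hbar) ∈ triMinus P4 P1 P2 ↔ Complex.normSq x.1 = 1 ∧ 0 ≤ x.1.im) := by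
  have hre := Complex.continuous_re
  have him := Complex.continuous_im
  have c1 : Continuous fun x : ℂ × ℝ => Real.sqrt 3 * x.1.re - x.1.im := by fun_prop
  filter_upwards [eventually_pos c1 (q := q14 t) (by
    simp [q14]), eventually_pos (f := fun x => x.2 - Real.sqrt 3) (by fun_prop)
    (q := q14 t) (sub_pos.mpr ht)] with x h1 h2
  rw [coe_eq_pt, mem_F124_iff]
  exact ⟨fun h => ⟨h.1, h.2.1⟩, fun h => ⟨h.1, h.2, by linarith, by linarith⟩⟩

lemma eventually_F124_12 {t : ℝ} (ht : Real.sqrt 3 < t) : ∀ᶠ x : ℂ × ℝ in 𝓝 (q12 t),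
    ((x : Hbar) ∈ triMinus P4 P1 P2 ↔ Complex.normSq x.1 = 1 ∧ Real.sqrt 3 ≤ x.2) ∧
    ((x : Hbar) ∈ triPlus P4 P1 P2 ↔ Complex.normSq x.1 = 1 ∧ x.2 ≤ Real.sqrt 3) := by
  have hre := Complex.continuous_re
  have him := Complex.continuous_im
  have c1 : Continuous fun x : ℂ × ℝ => Real.sqrt 3 * x.1.re - x.1.im := by fun_prop
  have c2 : Continuous fun x : ℂ × ℝ => x.1.im := by fun_prop
  filter_upwards [c1.continuousAt.eventually_const_lt (q12_re_sub ht),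
    c2.continuousAt.eventually_const_lt (q12_im_pos ht)] with x h1 h2
  rw [coe_eq_pt, mem_F124_iff, mem_low_iff]
  exact ⟨⟨fun h => ⟨h.1, h.2.2.2⟩, fun h => ⟨h.1, h2.le, by linarith, h.2⟩⟩,
    ⟨fun h => ⟨h.1, h.2.2.2⟩, fun h => ⟨h.1, h2.le, by linarith, h.2⟩⟩⟩

/-! ### Faces that do not meet the edges -/

lemma eventually_notMem_14 {t : ℝ} (ht : Real.sqrt 3 < t) : ∀ᶠ x : ℂ × ℝ in 𝓝 (q14 t),
    (x : Hbar) ∉ crMap G1 '' triMinus P4 P3 P1 ∧ (x : Hbar) ∉ crMap G2 '' triMinus P4 P1 P2 ∧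
    (x : Hbar) ∉ crMap G3 '' triMinus P4 P3 P1 ∧ (x : Hbar) ∉ crMap G4 '' triPlus P4 P1 P2 := by
  have hs := sqrt3_sq
  have hp := sqrt3_pos
  have h3 : ∀ᶠ x : ℂ × ℝ in 𝓝 (q14 t), 1 < Complex.normSq (x.1 - star om) := by
    refine (continuous_normSq_add (-star om)).continuousAt.eventually_const_lt ?_
    beta_reduce
    rw [← sub_eq_add_neg, normSq_sub_star_om]; simp [q14]
  have c1 : Continuous fun x : ℂ × ℝ => Complex.normSq (xc x) - Complex.normSq x.1 := by
    have := Complex.continuous_normSq; fun_prop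
  filter_upwards [h3, eventually_ne_neg_om (q := q14 t) one_ne_neg_om,
    eventually_heightA_lt (q := q14 t) one_ne_neg_om (by simpa [q14, heightA_one] using ht),
    eventually_pos c1 (q := q14 t) (by
      rw [normSq_xc]; simp [q14]; nlinarith)] with x h3 hne h4 h5
  refine ⟨fun h => ?_, fun h => ?_, fun h => ?_, fun h => ?_⟩
  · linarith [G1_face_height h hne]
  · linarith [G2_face_normSq h]
  · linarith [G3_face_normSq h]
  · linarith [G4_face_normSq h]

lemma eventually_notMem_34 {t : ℝ} (ht : Real.sqrt 3 < t) : ∀ᶠ x : ℂ × ℝ in 𝓝 (q34 t),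
    (x : Hbar) ∉ crMap G1 '' triMinus P4 P3 P1 ∧ (x : Hbar) ∉ triMinus P4 P1 P2 ∧
    (x : Hbar) ∉ crMap G4 '' triPlus P4 P1 P2 := by
  have hp := sqrt3_pos
  have h3 : ∀ᶠ x : ℂ × ℝ in 𝓝 (q34 t), Complex.normSq x.1 < 1 := by
    refine (Complex.continuous_normSq.comp continuous_fst).continuousAt.eventually_lt_const ?_
    simp [q34]
  have c1 : Continuous fun x : ℂ × ℝ => Complex.normSq (xc x) - Complex.normSq x.1 := by
    have := Complex.continuous_normSq; fun_prop
  filter_upwards [h3, eventually_ne_neg_om (q := q34 t) zero_ne_neg_om,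
    eventually_heightA_lt (q := q34 t) zero_ne_neg_om (by simpa [q34, heightA_zero] using ht),
    eventually_pos c1 (q := q34 t) (by
      rw [normSq_xc]; simp [q34]; have := sub_pos.mpr ht; positivity)] with x h3 hne h4 h5
  refine ⟨fun h => ?_, fun h => ?_, fun h => ?_⟩
  · linarith [G1_face_height h hne]
  · rw [coe_eq_pt, mem_F124_iff] at h; linarith [h.1]
  · linarith [G4_face_normSq h]

lemma eventually_notMem_12 {t : ℝ} (ht : Real.sqrt 3 < t) : ∀ᶠ x : ℂ × ℝ in 𝓝 (q12 t),
    (x : Hbar) ∉ triMinus P4 P3 P1 ∧ (x : Hbar) ∉ crMap G2 '' triMinus P4 P1 P2 ∧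
    (x : Hbar) ∉ crMap G3 '' triMinus P4 P3 P1 ∧ (x : Hbar) ∉ bigonB ∧
    ∀ n : ℕ, (x : Hbar) ∉ crMap (G2 ^ n * G3) '' bigonB := by
  obtain ⟨h1, h2, h3⟩ := q12_arc ht
  have h2' := (continuous_normSq_add om).continuousAt.eventually_lt_const h2
  have h3' := (continuous_normSq_add (-star om)).continuousAt.eventually_const_lt h3
  have hre := Complex.continuous_re
  have him := Complex.continuous_im
  have c1 : Continuous fun x : ℂ × ℝ => x.1.re + Real.sqrt 3 * x.1.im := by fun_prop
  filter_upwards [h2', h3', eventually_not_inCone ht,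
    c1.continuousAt.eventually_const_lt (q12_re_add ht)] with x h2 h3 hx h4
  rw [← sub_eq_add_neg] at h3
  refine ⟨fun h => ?_, fun h => ?_, fun h => ?_, fun h => ?_, fun n h => hx (inCone_bigon n h)⟩
  · rw [coe_eq_pt, mem_F134_iff] at h; linarith [h.1]
  · linarith [G2_face_normSq h]
  · linarith [G3_face_normSq h]
  · rcases h with h | ⟨r, s, hr, h⟩
    · exact absurd h (OnePoint.coe_ne_infty _)
    · rw [coe_eq_pt, pt_inj, exp_pi_div_six] at h
      rw [h.1] at h4
      simp at h4
      nlinarith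

lemma eventually_notMem_23 {t : ℝ} (ht : Real.sqrt 3 < t) : ∀ᶠ x : ℂ × ℝ in 𝓝 (q23 t),
    (x : Hbar) ∉ triMinus P4 P3 P1 ∧ (x : Hbar) ∉ triMinus P4 P1 P2 := by
  obtain ⟨h1, h2, h3⟩ := q23_arc ht
  have h1' := (Complex.continuous_normSq.comp continuous_fst).continuousAt.eventually_lt_const h1
  have h2' := (continuous_normSq_add om).continuousAt.eventually_lt_const h2
  filter_upwards [h1', h2'] with x h1 h2
  refine ⟨fun h => ?_, fun h => ?_⟩
  · rw [coe_eq_pt, mem_F134_iff] at h; linarith [h.1]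
  · rw [coe_eq_pt, mem_F124_iff] at h
    have := h.1
    simp only [Function.comp] at h1; linarith

end

section

/-! ### The developing maps of the cells around an edge -/

/-- The developing map at the edge `(14)`. -/
def devT : Matrix (Fin 3) (Fin 3) ℂ := !![1, 1, -1 / 2; 0, 1, -1; 0, 0, 1]

/-- The developing map at the edge `(12)`. -/
def dev12 : Matrix (Fin 3) (Fin 3) ℂ := !![om / 2, 1 / 2, star om / 2; -1, 0, star om; -om, 1,
    -star om]

/-- The developing map at the edge `(23)`. -/
def dev23 : Matrix (Fin 3) (Fin 3) ℂ :=
  !![om / 2, (star om - om) / 2, 1 + star om / 2; -1, -om, 0; -om, 1, -star om]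

/-- The developing map at the edge `(34)`. -/
def dev34 : Matrix (Fin 3) (Fin 3) ℂ := !![1, 0, star om + 1 / 2; 0, -om, 0; 0, 0, 1]

/-- The rotations around the vertical axis through the angles `iπ/3`, clockwise. -/
def rotM (i : ℕ) : Matrix (Fin 3) (Fin 3) ℂ := !![1, 0, 0; 0, (-star om) ^ i, 0; 0, 0, 1]

lemma neg_star_om_mul : star (-star om) * (-star om) = 1 := by
  simp; exact om_mul_star

lemma isUnit21_rotM (i : ℕ) : IsUnit21 (rotM i) := by
  have h : star ((-star om) ^ i) * (-star om) ^ i = 1 := by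
    rw [star_pow, ← mul_pow, neg_star_om_mul, one_pow]
  ext a b; fin_cases a <;> fin_cases b <;> simp [J, rotM, Matrix.mul_apply, Fin.sum_univ_three,
    Matrix.conjTranspose_apply]
  simpa using h

lemma isUnit21_devT : IsUnit21 devT := by
  have h2 := om_sq
  have hc : (starRingEnd ℂ) 2 = 2 := Complex.conj_ofNat 2
  ext i j; fin_cases i <;> fin_cases j <;> simp [J, devT, Matrix.mul_apply, Fin.sum_univ_three,
      Matrix.conjTranspose_apply, hc] <;> norm_num

lemma isUnit21_dev12 : IsUnit21 dev12 := by
  have h2 := om_sq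
  have hc : (starRingEnd ℂ) 2 = 2 := Complex.conj_ofNat 2
  ext i j; fin_cases i <;> fin_cases j <;> simp [J, dev12, Matrix.mul_apply, Fin.sum_univ_three,
      Matrix.conjTranspose_apply] <;> (try simp only [conj_om, hc]) <;> grind

lemma isUnit21_dev23 : IsUnit21 dev23 := by
  have h2 := om_sq
  have hc : (starRingEnd ℂ) 2 = 2 := Complex.conj_ofNat 2
  ext i j; fin_cases i <;> fin_cases j <;> simp [J, dev23, Matrix.mul_apply, Fin.sum_univ_three,
      Matrix.conjTranspose_apply] <;> (try simp only [conj_om, hc]) <;> grind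

lemma isUnit21_dev34 : IsUnit21 dev34 := by
  have h2 := om_sq
  have hc : (starRingEnd ℂ) 2 = 2 := Complex.conj_ofNat 2
  ext i j; fin_cases i <;> fin_cases j <;> simp [J, dev34, Matrix.mul_apply, Fin.sum_univ_three,
      Matrix.conjTranspose_apply] <;> (try simp only [conj_om, hc]) <;> grind

lemma crMap_eq_comp {A B G : Matrix (Fin 3) (Fin 3) ℂ} (c : ℂ) (hc : c ≠ 0) (hG : IsUnit21 G)
    (h : B * G = c • A) : crMap A = crMap B ∘ crMap G := by
  rw [← crMap_mul B hG, h, crMap_smul hc]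

/-- The developing matrices of neighbouring corners are normalised to differ exactly by the face
pairing between them; this and the following lemmas are the corresponding matrix identities. -/
lemma devT_eq_12 : crMap devT = crMap dev12 ∘ crMap G1 := by
  refine crMap_eq_comp 1 one_ne_zero isUnit21_G1 ?_
  have h2 := om_sq
  ext i j; fin_cases i <;> fin_cases j <;> simp [dev12, devT, G1, Matrix.mul_apply,
      Fin.sum_univ_three] <;> (try simp only [conj_om]) <;> grind

lemma dev12_eq_23 : crMap dev12 = crMap dev23 ∘ crMap G2 := by
  refine crMap_eq_comp 1 one_ne_zero isUnit21_G2 ?_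
  have h2 := om_sq
  ext i j; fin_cases i <;> fin_cases j <;> simp [dev12, dev23, G2, Matrix.mul_apply,
      Fin.sum_univ_three] <;> (try simp only [conj_om]) <;> grind

lemma devT_eq_34 : crMap devT = crMap dev34 ∘ crMap G2 := by
  refine crMap_eq_comp 1 one_ne_zero isUnit21_G2 ?_
  have h2 := om_sq
  ext i j; fin_cases i <;> fin_cases j <;> simp [devT, dev34, G2, Matrix.mul_apply,
      Fin.sum_univ_three] <;> (try simp only [conj_om]) <;> grind

lemma dev34_eq_23 : crMap dev34 = crMap dev23 ∘ crMap G1 := by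
  refine crMap_eq_comp 1 one_ne_zero isUnit21_G1 ?_
  have h2 := om_sq
  ext i j; fin_cases i <;> fin_cases j <;> simp [dev23, dev34, G1, Matrix.mul_apply,
      Fin.sum_univ_three] <;> (try simp only [conj_om]) <;> grind

lemma rotM_add (i j : ℕ) : rotM (i + j) = rotM i * rotM j := by
  ext a b; fin_cases a <;> fin_cases b <;> simp [rotM, Matrix.mul_apply, Fin.sum_univ_three,
      pow_add]

lemma rotM_zero : rotM 0 = 1 := by
  ext a b; fin_cases a <;> fin_cases b <;> simp [rotM]

lemma crMap_rot_comp {A B G : Matrix (Fin 3) (Fin 3) ℂ} (hB : IsUnit21 B)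
    (hA : IsUnit21 A) (h : crMap A = crMap B ∘ crMap G) (i : ℕ) :
    crMap (rotM i * A) = crMap (rotM i * B) ∘ crMap G := by
  rw [crMap_mul _ hA, crMap_mul _ hB, h, Function.comp_assoc]

/-- In developed coordinates `G4` is, up to a scalar, the inverse of the rotation `rotM 1` about the
axis. Each slab crossed therefore adds one factor `rotM 1`. By `rot_dev34_succ` the pairing `G3`
does the same on the (34) side, so both chains reach the corner (23) with the same power `rotM n`.
-/
lemma rot_dev12_succ (i : ℕ) :
    crMap (rotM i * dev12) = crMap (rotM (i + 1) * dev12) ∘ crMap G4 := by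
  have h : rotM 1 * dev12 * G4 = (-star om) • dev12 := by
    have h2 := om_sq
    ext i j; fin_cases i <;> fin_cases j <;> simp [dev12, rotM, G4, Matrix.mul_apply,
        Fin.sum_univ_three] <;> (try simp only [conj_om]) <;> grind
  refine crMap_eq_comp (-star om) (neg_ne_zero.mpr (star_ne_zero.mpr om_ne_zero)) isUnit21_G4 ?_
  rw [rotM_add, Matrix.mul_assoc, Matrix.mul_assoc, ← Matrix.mul_assoc (rotM 1), h,
    Matrix.mul_smul]

lemma rot_dev34_succ (i : ℕ) :
    crMap (rotM i * dev34) = crMap (rotM (i + 1) * dev34) ∘ crMap G3 := by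
  have h : rotM 1 * dev34 * G3 = dev34 := by
    have h2 := om_sq
    ext i j; fin_cases i <;> fin_cases j <;> simp [dev34, rotM, G3, Matrix.mul_apply,
        Fin.sum_univ_three] <;> (try simp only [conj_om]) <;> grind
  refine crMap_eq_comp 1 one_ne_zero isUnit21_G3 ?_
  rw [rotM_add, Matrix.mul_assoc, Matrix.mul_assoc, ← Matrix.mul_assoc (rotM 1), h, one_smul]

lemma crMap_rotM_axis (i : ℕ) (t : ℝ) : crMap (rotM i) (pt 0 t) = pt 0 t := by
  have : t = 2 * (xc (0, t)).im := by rw [xc_im]; exact (mul_div_cancel₀ _ two_ne_zero).symm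
  conv_rhs => rw [this]
  apply stereo_eq_pt <;> simp [mulVec_lift_pt, rotM]

lemma crMap_rot_axis {A : Matrix (Fin 3) (Fin 3) ℂ} (hA : IsUnit21 A) {P : Hbar} {t : ℝ}
    (h : crMap A P = pt 0 t) (i : ℕ) : crMap (rotM i * A) P = pt 0 t := by
  rw [crMap_mul _ hA, Function.comp_apply, h, crMap_rotM_axis]

lemma crMap_devT_q14 (t : ℝ) : crMap devT (q14 t) = pt 0 t := by
  change crMap devT (pt 1 t) = pt 0 t
  have : t = 2 * (xc (1, t) + 1 / 2).im := by
    rw [Complex.add_im, xc_im]; norm_num; ring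
  conv_rhs => rw [this]
  apply stereo_eq_pt <;> simp [mulVec_lift_pt, devT]
  ring

lemma crMap_dev12_q12 {t : ℝ} (ht : Real.sqrt 3 ≤ t) : crMap dev12 (q12 t) = pt 0 t := by
  rw [← G1_q14 ht, ← crMap_devT_q14 t, devT_eq_12, Function.comp_apply]

lemma G2_q14 (t : ℝ) : crMap G2 (q14 t) = q34 t := by
  change crMap G2 (pt 1 t) = pt 0 (t - Real.sqrt 3)
  rw [crMap_G2_pt]; simp

lemma crMap_dev34_q34 (t : ℝ) : crMap dev34 (q34 t) = pt 0 t := by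
  rw [← G2_q14 t, ← crMap_devT_q14 t, devT_eq_34, Function.comp_apply]

lemma crMap_dev23_q23 {t : ℝ} (ht : Real.sqrt 3 ≤ t) : crMap dev23 (q23 t) = pt 0 t := by
  rw [← G1_q34 ht, ← crMap_dev34_q34 t, dev34_eq_23, Function.comp_apply]

/-! ### The half-sheets -/

/-- The multiplier of the sheet developed from the face `(124)` at the edge `(14)`. -/
def g0 (Y : ℂ × ℝ) : ℂ := -Complex.I * (star Y.1 + 2)

/-- The multiplier of the sheet developed from the face `(134)` at the edge `(14)`. -/
def g1 (Y : ℂ × ℝ) : ℂ := Complex.I * (star Y.1 - 2 * om)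

/-- The multiplier of the sheet developed from the face `(124)` at the edge `(12)`. -/
def gm (Y : ℂ × ℝ) : ℂ := Complex.I * star (-star om * xc Y - Y.1 + star om / 2)

/-- Rotation of a multiplier. -/
def rot (i : ℕ) (γ : ℂ × ℝ → ℂ) (Y : ℂ × ℝ) : ℂ := (-om) ^ i * γ ((-om) ^ i * Y.1, Y.2)

@[fun_prop]
lemma continuous_g0 : Continuous g0 := by unfold g0; fun_prop

@[fun_prop]
lemma continuous_g1 : Continuous g1 := by unfold g1; fun_prop

@[fun_prop]
lemma continuous_gm : Continuous gm := by unfold gm; fun_prop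

lemma continuous_rot {γ : ℂ × ℝ → ℂ} (h : Continuous γ) (i : ℕ) : Continuous (rot i γ) := by
  unfold rot; fun_prop

lemma neg_om_pow_mul (i : ℕ) : (-star om) ^ i * (-om) ^ i = 1 := by
  rw [← mul_pow, neg_mul_neg, mul_comm, om_mul_star, one_pow]

/-- The value `Z γ(Z, t)` at the image `(Z, t)` of a point. -/
def zval (A : Matrix (Fin 3) (Fin 3) ℂ) (γ : ℂ × ℝ → ℂ) (x : ℂ × ℝ) : ℂ := (cm A x).1 * γ (cm A x)

lemma zval_neg (A : Matrix (Fin 3) (Fin 3) ℂ) (γ : ℂ × ℝ → ℂ) (x : ℂ × ℝ) :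
    zval A (-γ) x = -zval A γ x := by simp [zval]

lemma rotM_mulVec (i : ℕ) (v : Fin 3 → ℂ) :
    rotM i *ᵥ v = ![v 0, (-star om) ^ i * v 1, v 2] := by
  ext a; fin_cases a <;> simp [rotM, Matrix.mulVec, dotProduct, Fin.sum_univ_three]

lemma cm_rot (i : ℕ) (A : Matrix (Fin 3) (Fin 3) ℂ) (x : ℂ × ℝ) :
    cm (rotM i * A) x = ((-star om) ^ i * (cm A x).1, (cm A x).2) := by
  simp only [cm, chart, ← Matrix.mulVec_mulVec, rotM_mulVec]
  simp [mul_div_assoc]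

/-- Rotating the developing map and the multiplier together changes nothing, which reduces
conditions at the `i`-th corner of a chain to unrotated ones. -/
lemma zval_rot (i : ℕ) (A : Matrix (Fin 3) (Fin 3) ℂ) (γ : ℂ × ℝ → ℂ) (x : ℂ × ℝ) :
    zval (rotM i * A) (rot i γ) x = zval A γ x := by
  rw [zval, zval, cm_rot, rot]
  have h : (-om) ^ i * ((-star om) ^ i * (cm A x).1) = (cm A x).1 := by
    rw [← mul_assoc, mul_comm ((-om) ^ i), neg_om_pow_mul, one_mul]
  simp only [h]
  linear_combination (cm A x).1 * γ (cm A x) * neg_om_pow_mul i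

lemma onSheet_iff (A : Matrix (Fin 3) (Fin 3) ℂ) (γ : ℂ × ℝ → ℂ) (x : ℂ × ℝ) :
    OnSheet γ (cm A x) ↔ (zval A γ x).im = 0 ∧ 0 ≤ (zval A γ x).re := Iff.rfl

lemma cm_fst (A : Matrix (Fin 3) (Fin 3) ℂ) (x : ℂ × ℝ) :
    (cm A x).1 = (A 1 0 * xc x + A 1 1 * x.1 + A 1 2) / (A 2 0 * xc x + A 2 1 * x.1 + A 2 2) := by
  rw [cm, chart, mulVec_lift_apply, mulVec_lift_apply]

lemma cm_devT (x : ℂ × ℝ) : (cm devT x).1 = x.1 - 1 := by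
  rw [cm_fst]; simp [devT]; ring

lemma cm_dev34 (x : ℂ × ℝ) : (cm dev34 x).1 = -om * x.1 := by
  rw [cm_fst]; simp [dev34]

lemma cm_dev12 (x : ℂ × ℝ) : (cm dev12 x).1 = (star om - xc x) / denD x := by
  rw [cm_fst]; simp [dev12, denD]; ring_nf

lemma cm_dev23 (x : ℂ × ℝ) : (cm dev23 x).1 = -(xc x + om * x.1) / denD x := by
  rw [cm_fst]; simp [dev23, denD]; ring_nf

lemma den_dev12 (x : ℂ × ℝ) : den dev12 x = denD x := by
  rw [den, mulVec_lift_apply]; simp [dev12, denD]; ring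

lemma den_dev23 (x : ℂ × ℝ) : den dev23 x = denD x := by
  rw [den, mulVec_lift_apply]; simp [dev23, denD]; ring

/-- The multiplier is chosen so that the imaginary part is the equation of the vertical cylinder
containing the developed face, while the real part selects the half of it on one side of the axis.
-/
lemma im_mul_g0 (Y : ℂ × ℝ) : (Y.1 * g0 Y).im = 1 - Complex.normSq (Y.1 + 1) ∧
    (Y.1 * g0 Y).re = 2 * Y.1.im := by
  constructor
  · simp [g0, Complex.normSq_apply]; ring
  · simp [g0]; ring

lemma im_mul_g1 (Y : ℂ × ℝ) : (Y.1 * g1 Y).im = Complex.normSq (Y.1 - star om) - 1 ∧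
    (Y.1 * g1 Y).re = -Y.1.im - Real.sqrt 3 * Y.1.re := by
  constructor
  · rw [normSq_sub_star_om]; simp [g1, Complex.normSq_apply, om_re, om_im]; ring
  · simp [g1, om_re, om_im]; ring

lemma zval_devT_g0 (x : ℂ × ℝ) : (zval devT g0 x).im = 1 - Complex.normSq x.1 ∧
    (zval devT g0 x).re = 2 * x.1.im := by
  rw [zval, (im_mul_g0 _).1, (im_mul_g0 _).2, cm_devT]; simp

lemma zval_devT_g1 (x : ℂ × ℝ) : (zval devT g1 x).im = Complex.normSq (x.1 + om) - 1 ∧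
    (zval devT g1 x).re = Real.sqrt 3 * (1 - x.1.re) - x.1.im := by
  rw [zval, (im_mul_g1 _).1, (im_mul_g1 _).2, cm_devT]
  refine ⟨?_, by simp; ring⟩
  rw [star_om]; ring_nf

lemma zval_dev34_g1 (x : ℂ × ℝ) : (zval dev34 g1 x).im = Complex.normSq (x.1 + om) - 1 ∧
    (zval dev34 g1 x).re = -(Real.sqrt 3 * x.1.re - x.1.im) := by
  rw [zval, (im_mul_g1 _).1, (im_mul_g1 _).2, cm_dev34]
  constructor
  · rw [show -om * x.1 - star om = -om * (x.1 + om) by rw [star_om]; linear_combination om_sq,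
      Complex.normSq_mul, Complex.normSq_neg, normSq_om, one_mul]
  · simp [om_re, om_im]; linear_combination (x.1.im / 2) * sqrt3_sq

lemma zval_dev34_g0 (x : ℂ × ℝ) :
    (zval dev34 g0 x).im = 1 - Complex.normSq (x.1 - star om) := by
  rw [zval, (im_mul_g0 _).1, cm_dev34]
  rw [show -om * x.1 + 1 = -om * (x.1 - star om) by linear_combination -om_mul_star,
      Complex.normSq_mul, Complex.normSq_neg, normSq_om, one_mul]

/-- The developed first coordinate is a quotient `a / D`. With this form of the multiplier the
product is `i a / |D|²`, so its signs are those of the real and imaginary parts of the numerator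
(`mul_I_star_inv`). -/
lemma gm_dev12 {x : ℂ × ℝ} (h : denD x ≠ 0) : gm (cm dev12 x) = Complex.I * star (1 / denD x) := by
  have hd : den dev12 x ≠ 0 := by rwa [den_dev12]
  have hd2 : (dev12 *ᵥ lift (x : Hbar)) 2 = denD x := den_dev12 x
  rw [gm, xc_cm isUnit21_dev12 hd, cm_dev12, hd2, mulVec_lift_apply]
  congr 2
  rw [eq_div_iff h]
  have h1 (v : ℂ) : v / denD x * denD x = v := div_mul_cancel₀ _ h
  rw [add_mul, sub_mul, mul_assoc, h1, h1]
  simp [dev12, denD, conj_om]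
  linear_combination (xc x - 1) * om_sq

lemma gm_dev23 {x : ℂ × ℝ} (h : denD x ≠ 0) : gm (cm dev23 x) = Complex.I * star (1 / denD x) := by
  have hd : den dev23 x ≠ 0 := by rwa [den_dev23]
  have hd2 : (dev23 *ᵥ lift (x : Hbar)) 2 = denD x := den_dev23 x
  rw [gm, xc_cm isUnit21_dev23 hd, cm_dev23, hd2, mulVec_lift_apply]
  congr 2
  rw [eq_div_iff h]
  have h1 (v : ℂ) : v / denD x * denD x = v := div_mul_cancel₀ _ h
  rw [add_mul, sub_mul, mul_assoc, h1, h1]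
  simp [dev23, denD, conj_om]
  linear_combination (xc x - 1 - x.1) * om_sq

lemma mul_I_star_inv (a d : ℂ) : (a / d * (Complex.I * star (1 / d))).im = a.re / Complex.normSq d ∧
    (a / d * (Complex.I * star (1 / d))).re = -a.im / Complex.normSq d := by
  have : a / d * (Complex.I * star (1 / d)) = a * Complex.I * ((Complex.normSq d)⁻¹ : ℝ) := by
    push_cast
    rw [Complex.normSq_eq_conj_mul_self, star_div₀, star_one, Complex.star_def, mul_inv]
    ring
  rw [this]
  constructor
  · rw [Complex.im_mul_ofReal, Complex.mul_I_im]; rfl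
  · rw [Complex.re_mul_ofReal, Complex.mul_I_re]; rfl

lemma zval_dev12_gm {x : ℂ × ℝ} (h : denD x ≠ 0) :
    (zval dev12 gm x).im = (Complex.normSq x.1 - 1) / 2 / Complex.normSq (denD x) ∧
    (zval dev12 gm x).re = (x.2 - Real.sqrt 3) / 2 / Complex.normSq (denD x) := by
  rw [zval, gm_dev12 h, cm_dev12, (mul_I_star_inv _ _).1, (mul_I_star_inv _ _).2]
  constructor
  · congr 1; rw [Complex.sub_re, xc_re]; simp [om_re]; ring
  · congr 1; rw [Complex.sub_im, xc_im]; simp [om_im]; ring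

lemma zval_dev23_gm {x : ℂ × ℝ} (h : denD x ≠ 0) :
    (zval dev23 gm x).im = (Complex.normSq (x.1 - star om) - 1) / 2 / Complex.normSq (denD x) := by
  rw [zval, gm_dev23 h, cm_dev23, (mul_I_star_inv _ _).1, normSq_sub_star_om]
  congr 1; rw [Complex.neg_re, Complex.add_re, xc_re]; simp [om_re, om_im]; ring

lemma zval_dev12_g1 {x : ℂ × ℝ} (h : denD x ≠ 0) : (zval dev12 g1 x).im =
    (Complex.normSq (x.1 + om) - Complex.normSq (denD x)) / Complex.normSq (denD x) := by
  have h2 : Complex.normSq (denD x) ≠ 0 := by rwa [Ne, Complex.normSq_eq_zero]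
  have h3 : (star om - xc x) / denD x - star om = -star om * (x.1 + om) / denD x := by
    rw [div_sub' h]; congr 1
    rw [denD, star_om]; linear_combination -xc x * om_sq
  rw [zval, (im_mul_g1 _).1, cm_dev12, h3, Complex.normSq_div, Complex.normSq_mul,
    Complex.normSq_neg, Complex.star_def, Complex.normSq_conj, normSq_om, one_mul, sub_div,
    div_self h2]

lemma zval_dev23_g1 {x : ℂ × ℝ} (h : denD x ≠ 0) : (zval dev23 g1 x).im =
    (Complex.normSq (x.1 + om) - Complex.normSq (denD x)) / Complex.normSq (denD x) := by
  have h2 : Complex.normSq (denD x) ≠ 0 := by rwa [Ne, Complex.normSq_eq_zero]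
  have h3 : -(xc x + om * x.1) / denD x - star om = (x.1 + om) / denD x := by
    rw [div_sub' h]; congr 1
    rw [denD, star_om]; linear_combination (1 - xc x) * om_sq
  rw [zval, (im_mul_g1 _).1, cm_dev23, h3, Complex.normSq_div, sub_div,
    div_self h2]

/-- One rotation step later the same sheet is the surface `|x| = |z|` that carries the bottom face
of type `B`: `G4` carries the lower triangle of the slab onto that face. -/
lemma zval_rot_dev12_gm {x : ℂ × ℝ} (h : denD x ≠ 0) : (zval (rotM 1 * dev12) gm x).im =
    -((Complex.normSq (xc x) - Complex.normSq x.1) / 2 / Complex.normSq (denD x)) := by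
  have hd : den dev12 x ≠ 0 := by rwa [den_dev12]
  have hd2 : (dev12 *ᵥ lift (x : Hbar)) 2 = denD x := den_dev12 x
  have hx : xc (cm (rotM 1 * dev12) x) = xc (cm dev12 x) := by
    rw [cm_rot, xc, xc]
    have : ‖om‖ = 1 := by simpa using arc_neg_om.norm
    simp [this]
  have h1 (v : ℂ) : v / denD x * denD x = v := div_mul_cancel₀ _ h
  have hg : gm (cm (rotM 1 * dev12) x) = Complex.I * star (om * xc x / denD x) := by
    rw [gm, hx, xc_cm isUnit21_dev12 hd, cm_rot, cm_dev12, hd2, mulVec_lift_apply]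
    congr 2
    rw [eq_div_iff h, add_mul, sub_mul, mul_assoc, h1, mul_assoc, h1]
    simp [dev12, denD, conj_om]
    linear_combination xc x * om_sq
  have e : zval (rotM 1 * dev12) gm x = (-star om * (star om - xc x) * (star om * star (xc x))) /
      denD x * (Complex.I * star (1 / denD x)) := by
    rw [zval, hg, cm_rot, cm_dev12]
    simp only [star_div₀, star_mul, star_one, pow_one]
    ring
  rw [e, (mul_I_star_inv _ _).1, ← neg_div]
  congr 1
  have : -star om * (star om - xc x) * (star om * star (xc x)) =
      -star (xc x) + om * (xc x * star (xc x)) := by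
    rw [star_om]
    linear_combination (star (xc x) * (2 + om) + xc x * star (xc x)) * om_sq
  rw [this, Complex.star_def, Complex.mul_conj, Complex.add_re, Complex.neg_re, Complex.conj_re,
    Complex.re_mul_ofReal, om_re, xc_re]
  ring

end

section

/-! ### Sheets and bodies in developed coordinates -/

lemma eventually_denD_12 {t : ℝ} (ht : Real.sqrt 3 < t) :
    ∀ᶠ x : ℂ × ℝ in 𝓝 (q12 t), denD x ≠ 0 := by
  have := eventually_den_ne (den_ne_zero (crMap_dev12_q12 ht.le))
  simpa only [den_dev12] using this

lemma eventually_denD_23 {t : ℝ} (ht : Real.sqrt 3 < t) :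
    ∀ᶠ x : ℂ × ℝ in 𝓝 (q23 t), denD x ≠ 0 := by
  have := eventually_den_ne (den_ne_zero (crMap_dev23_q23 ht.le))
  simpa only [den_dev23] using this

lemma sheet_F134_14 {t : ℝ} (ht : Real.sqrt 3 < t) : ∀ᶠ x : ℂ × ℝ in 𝓝 (q14 t),
    ((x : Hbar) ∈ triMinus P4 P3 P1 ↔ OnSheet g1 (cm devT x)) := by
  filter_upwards [eventually_F134_14 ht] with x hx
  rw [hx, onSheet_iff, (zval_devT_g1 x).1, (zval_devT_g1 x).2, sub_eq_zero]

lemma sheet_F124_14 {t : ℝ} (ht : Real.sqrt 3 < t) : ∀ᶠ x : ℂ × ℝ in 𝓝 (q14 t),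
    ((x : Hbar) ∈ triMinus P4 P1 P2 ↔ OnSheet g0 (cm devT x)) := by
  filter_upwards [eventually_F124_14 ht] with x hx
  rw [hx, onSheet_iff, (zval_devT_g0 x).1, (zval_devT_g0 x).2, sub_eq_zero, eq_comm (a := (1 : ℝ))]
  simp

lemma sheet_F134_34 {t : ℝ} (ht : Real.sqrt 3 < t) (i : ℕ) : ∀ᶠ x : ℂ × ℝ in 𝓝 (q34 t),
    ((x : Hbar) ∈ triMinus P4 P3 P1 ↔ OnSheet (rot i (-g1)) (cm (rotM i * dev34) x)) := by
  filter_upwards [eventually_F134_34 ht] with x hx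
  rw [hx, onSheet_iff, zval_rot, zval_neg, Complex.neg_im, Complex.neg_re, (zval_dev34_g1 x).1,
    (zval_dev34_g1 x).2, neg_eq_zero, sub_eq_zero, neg_neg]

lemma sheet_F124_12 {t : ℝ} (ht : Real.sqrt 3 < t) (i : ℕ) : ∀ᶠ x : ℂ × ℝ in 𝓝 (q12 t),
    ((x : Hbar) ∈ triMinus P4 P1 P2 ↔ OnSheet (rot i gm) (cm (rotM i * dev12) x)) := by
  filter_upwards [eventually_F124_12 ht, eventually_denD_12 ht] with x hx hd
  have hp : 0 < Complex.normSq (denD x) := Complex.normSq_pos.mpr hd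
  rw [hx.1, onSheet_iff, zval_rot, (zval_dev12_gm hd).1, (zval_dev12_gm hd).2,
    div_eq_zero_iff, or_iff_left hp.ne', le_div_iff₀ hp, zero_mul]
  constructor <;> rintro ⟨h1, h2⟩ <;> constructor <;> linarith

lemma sheet_low_12 {t : ℝ} (ht : Real.sqrt 3 < t) (i : ℕ) : ∀ᶠ x : ℂ × ℝ in 𝓝 (q12 t),
    ((x : Hbar) ∈ triPlus P4 P1 P2 ↔ OnSheet (-rot i gm) (cm (rotM i * dev12) x)) := by
  filter_upwards [eventually_F124_12 ht, eventually_denD_12 ht] with x hx hd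
  have hp : 0 < Complex.normSq (denD x) := Complex.normSq_pos.mpr hd
  rw [hx.2, onSheet_iff, zval_neg, zval_rot, Complex.neg_im, Complex.neg_re, (zval_dev12_gm hd).1,
    (zval_dev12_gm hd).2, neg_eq_zero, neg_nonneg,
    div_eq_zero_iff, or_iff_left hp.ne', div_le_iff₀ hp, zero_mul]
  constructor <;> rintro ⟨h1, h2⟩ <;> constructor <;> linarith

lemma body_14 {w : ZMod m → Flip} (a : ZMod m) {t : ℝ} (ht : Real.sqrt 3 < t) :
    ∀ᶠ x : ℂ × ℝ in 𝓝 (q14 t), ((x : Hbar) ∈ (Cell.tet a : Cell w).body ↔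
      0 ≤ (zval devT g0 x).im ∧ (zval devT g1 x).im ≤ 0) := by
  simp only [(zval_devT_g0 _).1, (zval_devT_g1 _).1, sub_nonneg, sub_nonpos]
  simp only [Cell.body]
  split
  · exact eventually_mem_tetB_14 ht
  · exact eventually_mem_tetA_14 ht

/-- The second condition stays a cylinder equation because the next sheet is `g0` for `i = 0` and a
rotated `-g1` otherwise; both give this equation (`zval_dev34_g0`, `zval_dev34_succ`). -/
lemma body_34 {w : ZMod m → Flip} (a : ZMod m) {t : ℝ} (ht : Real.sqrt 3 < t) (i : ℕ) :
    ∀ᶠ x : ℂ × ℝ in 𝓝 (q34 t), ((x : Hbar) ∈ (Cell.tet a : Cell w).body ↔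
      0 ≤ (zval (rotM i * dev34) (rot i (-g1)) x).im ∧
      1 - Complex.normSq (x.1 - star om) ≤ 0) := by
  simp only [zval_rot, zval_neg, Complex.neg_im, (zval_dev34_g1 _).1, neg_sub, sub_nonneg,
    sub_nonpos]
  simp only [Cell.body]
  split
  · exact eventually_mem_tetB_34 ht
  · exact eventually_mem_tetA_34 ht

lemma zval_dev34_succ (i : ℕ) (x : ℂ × ℝ) : (zval (rotM (i + 1) * dev34) (rot i (-g1)) x).im =
    1 - Complex.normSq (x.1 - star om) := by
  rw [rotM_add, Matrix.mul_assoc, zval_rot, zval_neg, zval, Complex.neg_im, (im_mul_g1 _).1, cm_rot,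
    cm_dev34, show (-star om) ^ 1 * (-om * x.1) = x.1 by linear_combination x.1 * om_mul_star]
  ring

lemma body_12A {w : ZMod m → Flip} {a : ZMod m} (ha : w (a - 1) = Flip.L) {t : ℝ}
    (ht : Real.sqrt 3 < t) : ∀ᶠ x : ℂ × ℝ in 𝓝 (q12 t), ((x : Hbar) ∈ (Cell.tet a : Cell w).body ↔
      0 ≤ (zval (rotM 0 * dev12) g1 x).im ∧ (zval (rotM 0 * dev12) (rot 0 gm) x).im ≤ 0) := by
  simp only [Cell.body, ha]
  filter_upwards [eventually_mem_tetA_12 ht, eventually_denD_12 ht] with x hx hd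
  have hp : 0 < Complex.normSq (denD x) := Complex.normSq_pos.mpr hd
  rw [hx, zval_rot, rotM_zero, one_mul, zval_dev12_g1 hd, (zval_dev12_gm hd).1, le_div_iff₀ hp,
    div_le_iff₀ hp, zero_mul]
  constructor <;> rintro ⟨h1, h2⟩ <;> constructor <;> linarith

lemma body_12B {w : ZMod m → Flip} {a : ZMod m} (ha : w (a - 1) = Flip.R) {t : ℝ}
    (ht : Real.sqrt 3 < t) (i : ℕ) :
    ∀ᶠ x : ℂ × ℝ in 𝓝 (q12 t), ((x : Hbar) ∈ (Cell.tet a : Cell w).body ↔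
      0 ≤ (zval (rotM (i + 1) * dev12) (-rot i gm) x).im ∧
      (zval (rotM (i + 1) * dev12) (rot (i + 1) gm) x).im ≤ 0) := by
  simp only [Cell.body, ha]
  filter_upwards [eventually_mem_tetB_12 ht, eventually_denD_12 ht] with x hx hd
  have hp : 0 < Complex.normSq (denD x) := Complex.normSq_pos.mpr hd
  rw [hx, zval_rot, zval_neg, rotM_add, Matrix.mul_assoc, zval_rot, Complex.neg_im,
    zval_rot_dev12_gm hd, (zval_dev12_gm hd).1, neg_neg, le_div_iff₀ hp, div_le_iff₀ hp, zero_mul]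
  constructor <;> rintro ⟨h1, h2⟩ <;> constructor <;> linarith

lemma body_slab {w : ZMod m → Flip} {a : ZMod m} (ha : w a = Flip.R) {t : ℝ}
    (ht : Real.sqrt 3 < t) (i : ℕ) :
    ∀ᶠ x : ℂ × ℝ in 𝓝 (q12 t), ((x : Hbar) ∈ (Cell.slab a ha : Cell w).body ↔
      0 ≤ (zval (rotM i * dev12) (rot i gm) x).im ∧
      (zval (rotM i * dev12) (-rot i gm) x).im ≤ 0) := by
  simp only [Cell.body]
  filter_upwards [eventually_mem_slab (lRun w a) ht, eventually_denD_12 ht] with x hx hd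
  have hp : 0 < Complex.normSq (denD x) := Complex.normSq_pos.mpr hd
  rw [hx, zval_neg, zval_rot, Complex.neg_im, (zval_dev12_gm hd).1, neg_nonpos, and_self,
    le_div_iff₀ hp, zero_mul]
  constructor <;> intro h <;> linarith

lemma body_23 {w : ZMod m → Flip} {a : ZMod m} (ha : w (a - 1) = Flip.L) {t : ℝ}
    (ht : Real.sqrt 3 < t) (i : ℕ) :
    ∀ᶠ x : ℂ × ℝ in 𝓝 (q23 t), ((x : Hbar) ∈ (Cell.tet a : Cell w).body ↔
      0 ≤ (zval (rotM i * dev23) (rot i gm) x).im ∧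
      (zval (rotM i * dev23) (rot i (-g1)) x).im ≤ 0) := by
  simp only [Cell.body, ha]
  filter_upwards [eventually_mem_tetA_23 ht, eventually_denD_23 ht] with x hx hd
  have hp : 0 < Complex.normSq (denD x) := Complex.normSq_pos.mpr hd
  rw [hx, zval_rot, zval_rot, zval_neg, Complex.neg_im, zval_dev23_gm hd, zval_dev23_g1 hd,
    neg_nonpos, le_div_iff₀ hp, le_div_iff₀ hp, zero_mul]
  constructor <;> rintro ⟨h1, h2⟩ <;> constructor <;> linarith

/-! ### The angles of the sheets -/

lemma g0_base (t : ℝ) : g0 (0, t) =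
    (2 : ℝ) * Complex.exp (-((Real.pi / 2 : ℝ) * Complex.I)) := by
  rw [← neg_mul, ← Complex.ofReal_neg, Complex.exp_mul_I, ← Complex.ofReal_cos,
    ← Complex.ofReal_sin]
  simp [g0]; ring

lemma neg_om_pow (i : ℕ) : (-om) ^ i = Complex.exp (-((-(Real.pi / 3 * i) : ℝ) * Complex.I)) := by
  have h1 : -om = Complex.exp ((Real.pi / 3 : ℝ) * Complex.I) := by
    apply Complex.ext
    · rw [Complex.exp_ofReal_mul_I_re, Real.cos_pi_div_three, Complex.neg_re, om_re]; ring
    · rw [Complex.exp_ofReal_mul_I_im, Real.sin_pi_div_three, Complex.neg_im, om_im]; ring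
  rw [h1, ← Complex.exp_nat_mul]
  congr 1; push_cast; ring

/-- The integer `k` is free, to choose the branch of the angle that makes the angles increase around
the edge. -/
lemma rot_base {γ : ℂ × ℝ → ℂ} {r b t : ℝ} (h : γ (0, t) = r * Complex.exp (-(b * Complex.I)))
    (i : ℕ) (k : ℤ) : rot i γ (0, t) =
      r * Complex.exp (-((b - Real.pi / 3 * i + 2 * Real.pi * k : ℝ) * Complex.I)) := by
  rw [rot, mul_zero, h, neg_om_pow, mul_left_comm, ← Complex.exp_add]
  congr 1
  rw [Complex.exp_eq_exp_iff_exists_int]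
  exact ⟨k, by push_cast; ring⟩

lemma neg_base {γ : ℂ × ℝ → ℂ} {r b t : ℝ} (h : γ (0, t) = r * Complex.exp (-(b * Complex.I))) :
    (-γ) (0, t) = r * Complex.exp (-((b + Real.pi : ℝ) * Complex.I)) := by
  rw [Pi.neg_apply, h]
  push_cast
  rw [add_mul, neg_add, Complex.exp_add, ← mul_assoc, Complex.exp_neg (Real.pi * Complex.I),
    Complex.exp_pi_mul_I]
  ring

lemma g1_base (t : ℝ) : g1 (0, t) =
    (2 : ℝ) * Complex.exp (-((7 * Real.pi / 6 : ℝ) * Complex.I)) := by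
  have : 7 * Real.pi / 6 = Real.pi / 6 + Real.pi := by ring
  rw [this, ← neg_mul, ← Complex.ofReal_neg, Complex.exp_mul_I, ← Complex.ofReal_cos,
    ← Complex.ofReal_sin, Real.cos_neg, Real.sin_neg, Real.cos_add_pi, Real.sin_add_pi,
    Real.cos_pi_div_six, Real.sin_pi_div_six]
  apply Complex.ext
  · simp [g1, om_im]; ring
  · simp [g1, om_re]; norm_num

/-- The angle of the sheet of multiplier `gm`. -/
def angm (t : ℝ) : ℝ := 2 * Real.pi - Complex.arg (gm (0, t))

lemma gm_zero (t : ℝ) : gm (0, t) = ⟨(t + Real.sqrt 3) / 4, (Real.sqrt 3 * t - 1) / 4⟩ := by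
  apply Complex.ext
  · simp [gm, xc_re, xc_im, om_re, om_im]; ring
  · simp [gm, xc_re, xc_im, om_re, om_im]; ring

lemma gm_base {t : ℝ} (ht : Real.sqrt 3 < t) : 0 < ‖gm (0, t)‖ ∧ gm (0, t) =
    (‖gm (0, t)‖ : ℝ) * Complex.exp (-((angm t : ℝ) * Complex.I)) := by
  have hp := sqrt3_pos
  constructor
  · rw [norm_pos_iff, gm_zero]
    intro h
    have := congrArg Complex.re h
    simp at this; linarith
  · conv_lhs => rw [← Complex.norm_mul_exp_arg_mul_I (gm (0, t))]
    congr 1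
    rw [Complex.exp_eq_exp_iff_exists_int]
    exact ⟨1, by rw [angm]; push_cast; ring⟩

/-- The tangent of the argument is `(√3 t - 1)/(t + √3)`; for `t > √3` it lies strictly between
`1/√3` and `√3`. -/
lemma angm_mem {t : ℝ} (ht : Real.sqrt 3 < t) :
    5 * Real.pi / 3 < angm t ∧ angm t < 11 * Real.pi / 6 := by
  have hp := sqrt3_pos
  have hs := sqrt3_sq
  have hpi := Real.pi_pos
  have h := gm_zero t
  have hre : 0 < (gm (0, t)).re := by rw [h]; simp; linarith
  have harg : Complex.arg (gm (0, t)) = Real.arctan ((gm (0, t)).im / (gm (0, t)).re) := by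
    have := abs_lt.mp (Complex.abs_arg_lt_pi_div_two_iff.mpr (Or.inl hre))
    rw [← Complex.tan_arg, Real.arctan_tan this.1 this.2]
  have e : (gm (0, t)).im / (gm (0, t)).re = (Real.sqrt 3 * t - 1) / (t + Real.sqrt 3) := by
    rw [h]; field_simp
  rw [e] at harg
  have ht0 : 0 < t + Real.sqrt 3 := by linarith
  have h1 : Real.pi / 6 < Real.arctan ((Real.sqrt 3 * t - 1) / (t + Real.sqrt 3)) := by
    rw [← Real.arctan_tan (x := Real.pi / 6) (by linarith) (by linarith), Real.tan_pi_div_six]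
    apply Real.arctan_strictMono
    rw [div_lt_div_iff₀ hp ht0]; nlinarith
  have h2 : Real.arctan ((Real.sqrt 3 * t - 1) / (t + Real.sqrt 3)) < Real.pi / 3 := by
    rw [← Real.arctan_tan (x := Real.pi / 3) (by linarith) (by linarith), Real.tan_pi_div_three]
    apply Real.arctan_strictMono
    rw [div_lt_iff₀ ht0]; nlinarith
  rw [angm, harg]
  constructor <;> linarith

end

section

/-! ### The cells around an edge -/

/-- The corners of cells around the edge, anticlockwise: the edge `(14)` of the first tetrahedron,
the edges `(12)` of the next tetrahedra and of the slabs lying on them, the edge `(23)` of the last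
tetrahedron, and the edges `(34)` of the intermediate tetrahedra. -/
inductive Corner
  | p14
  | p12 (i : ℕ)
  | sl (i : ℕ)
  | p23
  | p34 (i : ℕ)

namespace Corner

/-- The corners that occur if there are `n` letters `R` between two letters `L`. -/
def Valid (n : ℕ) : Corner → Prop
  | p14 => True
  | p12 i => i ≤ n
  | sl i => i < n
  | p23 => True
  | p34 i => i ≤ n

/-- The next corner, anticlockwise. -/
def next (n : ℕ) : Corner → Corner
  | p14 => p12 0
  | p12 i => if i < n then sl i else p23
  | sl i => p12 (i + 1)
  | p23 => p34 n
  | p34 0 => p14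
  | p34 (i + 1) => p34 i

/-- The position of a corner. -/
def idx (n : ℕ) : Corner → ℕ
  | p14 => 0
  | p12 i => 2 * i + 1
  | sl i => 2 * i + 2
  | p23 => 2 * n + 2
  | p34 i => 3 * n + 3 - i

/-- The corner at a position. -/
def seq (n k : ℕ) : Corner :=
  if k = 0 then p14
  else if k ≤ 2 * n + 1 then (if k % 2 = 1 then p12 (k / 2) else sl (k / 2 - 1))
  else if k = 2 * n + 2 then p23
  else p34 (3 * n + 3 - k)

lemma idx_lt {n : ℕ} {x : Corner} (h : x.Valid n) : x.idx n < 3 * n + 4 := by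
  cases x <;> simp only [Valid, idx] at * <;> omega

lemma seq_idx {n : ℕ} {x : Corner} (h : x.Valid n) : seq n (x.idx n) = x := by
  cases x with
  | p14 => rfl
  | p12 i =>
    simp only [Valid, idx] at *
    rw [seq, if_neg (by omega), if_pos (by omega), if_pos (by omega)]; congr 1; omega
  | sl i =>
    simp only [Valid, idx] at *
    rw [seq, if_neg (by omega), if_pos (by omega), if_neg (by omega)]; congr 1; omega
  | p23 =>
    simp only [idx] at *
    rw [seq, if_neg (by omega), if_neg (by omega), if_pos rfl]
  | p34 i =>
    simp only [Valid, idx] at *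
    rw [seq, if_neg (by omega), if_neg (by omega), if_neg (by omega)]; congr 1; omega

lemma valid_seq {n k : ℕ} : (seq n k).Valid n := by
  unfold seq
  split_ifs <;> simp only [Valid] <;> omega

lemma idx_seq {n k : ℕ} (hk : k < 3 * n + 4) : (seq n k).idx n = k := by
  unfold seq
  split_ifs <;> simp only [idx] <;> omega

lemma valid_next {n : ℕ} {x : Corner} (h : x.Valid n) : (x.next n).Valid n := by
  cases x with
  | p14 => exact Nat.zero_le _
  | p12 i => simp only [next]; split_ifs <;> simp only [Valid]; assumption
  | sl i => exact h
  | p23 => exact le_rfl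
  | p34 i => cases i with
    | zero => trivial
    | succ i => simp only [Valid, next] at *; omega

lemma idx_next {n : ℕ} {x : Corner} (h : x.Valid n) :
    (x.next n).idx n = (x.idx n + 1) % (3 * n + 4) := by
  cases x with
  | p14 => simp only [next, idx]; rw [Nat.mod_eq_of_lt (by omega)]
  | p12 i =>
    simp only [next, Valid] at *
    split_ifs <;> simp only [idx] <;> rw [Nat.mod_eq_of_lt (by omega)] <;> omega
  | sl i => simp only [next, idx, Valid] at *; rw [Nat.mod_eq_of_lt (by omega)]; omega
  | p23 => simp only [next, idx, Valid] at *; rw [Nat.mod_eq_of_lt (by omega)]; omega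
  | p34 i => cases i with
    | zero => simp only [next, idx]; simp
    | succ i => simp only [next, idx, Valid] at *; rw [Nat.mod_eq_of_lt (by omega)]; omega

lemma seq_succ {n k : ℕ} (hk : k < 3 * n + 4) :
    seq n ((k + 1) % (3 * n + 4)) = (seq n k).next n := by
  rw [← seq_idx (valid_next (valid_seq (n := n) (k := k))), idx_next valid_seq, idx_seq hk]

end Corner

open Corner

variable {m : ℕ}

/-- Between the letters `L` at `j` and at `j + n + 1` there are `n` letters `R`. -/
structure EdgeWord (w : ZMod m → Flip) (j : ZMod m) (n : ℕ) : Prop where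
  first : w j = Flip.L
  mid : ∀ d : ℕ, 1 ≤ d → d ≤ n → w (j + d) = Flip.R
  last : w (j + (n + 1 : ℕ)) = Flip.L

open Classical in
/-- The cell of a corner. -/
def Corner.cell (w : ZMod m → Flip) (j : ZMod m) (n : ℕ) : Corner → Cell w
  | p14 => .tet j
  | p12 i => .tet (j + (i + 1 : ℕ))
  -- The alternative `.tet j` is a default; for valid corners the letter is `R`
  -- (`EdgeWord.cell_sl`).
  | sl i => if h : w (j + (i + 1 : ℕ)) = Flip.R then .slab _ h else .tet j
  | p23 => .tet (j + (n + 2 : ℕ))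
  | p34 i => .tet (j + (i + 1 : ℕ))

/-- The developing map of a corner. -/
def Corner.dev (n : ℕ) : Corner → Matrix (Fin 3) (Fin 3) ℂ
  | p14 => devT
  | p12 i => rotM i * dev12
  | sl i => rotM i * dev12
  | p23 => rotM n * dev23
  | p34 i => rotM i * dev34

/-- The point of a corner that develops to `(0, t)`. -/
def Corner.base (t : ℝ) : Corner → ℂ × ℝ
  | p14 => q14 t
  | p12 _ => q12 t
  | sl _ => q12 t
  | p23 => q23 t
  | p34 _ => q34 t

/-- The multiplier of the first sheet of a corner. -/
def Corner.lo (n : ℕ) : Corner → ℂ × ℝ → ℂ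
  | p14 => g0
  | p12 0 => g1
  | p12 (i + 1) => -rot i gm
  | sl i => rot i gm
  | p23 => rot n gm
  | p34 i => rot i (-g1)

/-- The angle of the first sheet of a corner. -/
def Corner.ang (t : ℝ) (n : ℕ) : Corner → ℝ
  | p14 => Real.pi / 2
  | p12 0 => 7 * Real.pi / 6
  -- A slab takes up `π` and the corner (12) after it `2π/3`, together the `5π/3` per letter `R`;
  -- the missing `π/3` of the full turn is the additional corner (34).
  | p12 (i + 1) => angm t + 5 * Real.pi / 3 * i + Real.pi
  | sl i => angm t + 5 * Real.pi / 3 * i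
  | p23 => angm t + 5 * Real.pi / 3 * n
  | p34 i => 13 * Real.pi / 6 - Real.pi / 3 * i + 2 * Real.pi * n

namespace Corner

lemma isUnit21_dev (n : ℕ) (x : Corner) : IsUnit21 (x.dev n) := by
  cases x with
  | p14 => exact isUnit21_devT
  | p12 i => exact (isUnit21_rotM i).mul isUnit21_dev12
  | sl i => exact (isUnit21_rotM i).mul isUnit21_dev12
  | p23 => exact (isUnit21_rotM n).mul isUnit21_dev23
  | p34 i => exact (isUnit21_rotM i).mul isUnit21_dev34

lemma crMap_dev {t : ℝ} (ht : Real.sqrt 3 < t) (n : ℕ) (x : Corner) :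
    crMap (x.dev n) (x.base t) = pt 0 t := by
  cases x with
  | p14 => exact crMap_devT_q14 t
  | p12 i => exact crMap_rot_axis isUnit21_dev12 (crMap_dev12_q12 ht.le) i
  | sl i => exact crMap_rot_axis isUnit21_dev12 (crMap_dev12_q12 ht.le) i
  | p23 => exact crMap_rot_axis isUnit21_dev23 (crMap_dev23_q23 ht.le) n
  | p34 i => exact crMap_rot_axis isUnit21_dev34 (crMap_dev34_q34 t) i

lemma continuous_lo (n : ℕ) (x : Corner) : Continuous (x.lo n) := by
  match x with
  | p14 => exact continuous_g0
  | p12 0 => exact continuous_g1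
  | p12 (i + 1) => exact (continuous_rot continuous_gm i).neg
  | sl i => exact continuous_rot continuous_gm i
  | p23 => exact continuous_rot continuous_gm n
  | p34 i => exact continuous_rot continuous_g1.neg i

lemma lo_base {t : ℝ} (ht : Real.sqrt 3 < t) (n : ℕ) (x : Corner) :
    ∃ r : ℝ, 0 < r ∧ x.lo n (0, t) = r * Complex.exp (-(x.ang t n * Complex.I)) := by
  obtain ⟨h1, h2⟩ := gm_base ht
  -- Each rotation lowers the angle by `π/3`; adding one full turn for each gives the increment
  -- `5π/3`.
  have key (i : ℕ) : rot i gm (0, t) = (‖gm (0, t)‖ : ℝ) *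
      Complex.exp (-((angm t + 5 * Real.pi / 3 * i : ℝ) * Complex.I)) := by
    rw [rot_base h2 i i]; congr 4; push_cast; ring
  match x with
  | p14 => exact ⟨2, two_pos, g0_base t⟩
  | p12 0 => exact ⟨2, two_pos, g1_base t⟩
  | p12 (i + 1) => exact ⟨_, h1, neg_base (key i)⟩
  | sl i => exact ⟨_, h1, key i⟩
  | p23 => exact ⟨_, h1, key n⟩
  | p34 i =>
    refine ⟨2, two_pos, (rot_base (neg_base (g1_base t)) i n).trans ?_⟩
    congr 4; simp only [ang]; push_cast; ring

/-- The wedges have positive width below `π`, except the slabs, of width exactly `π` between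
opposite multipliers. The corner `p34 0` is left out because after it the angle is that of `p14`
only up to full turns. -/
lemma ang_next {t : ℝ} (ht : Real.sqrt 3 < t) {n : ℕ} {x : Corner} (hx : x.Valid n)
    (h0 : x ≠ p34 0) : x.ang t n < (x.next n).ang t n ∧
      ((x.next n).ang t n < x.ang t n + Real.pi ∨
        (x.next n).lo n = -x.lo n ∧ (x.next n).ang t n = x.ang t n + Real.pi) := by
  have hpi := Real.pi_pos
  obtain ⟨h1, h2⟩ := angm_mem ht
  match x with
  | p14 => simp only [next, ang]; exact ⟨by linarith, Or.inl (by linarith)⟩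
  | p12 i =>
    simp only [next, Valid] at *
    have e : (if i < n then sl i else p23).ang t n = angm t + 5 * Real.pi / 3 * i := by
      split_ifs with h
      · rfl
      · have : i = n := by omega
        subst this; rfl
    rw [e]
    cases i with
    | zero => simp only [ang]; push_cast; exact ⟨by linarith, Or.inl (by linarith)⟩
    | succ i => simp only [ang]; push_cast; exact ⟨by linarith, Or.inl (by linarith)⟩
  | sl i => exact ⟨by simp only [next, ang]; linarith, Or.inr ⟨rfl, rfl⟩⟩
  | p23 =>
    simp only [next, ang]; exact ⟨by linarith, Or.inl (by linarith)⟩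
  | p34 0 => exact absurd rfl h0
  | p34 (i + 1) =>
    simp only [next, ang]; push_cast; exact ⟨by linarith, Or.inl (by linarith)⟩

lemma base_notMem_vertices {t : ℝ} (ht : Real.sqrt 3 < t) (w : ZMod m → Flip) (j : ZMod m)
    (n : ℕ) (x : Corner) : (x.base t : Hbar) ∉ (x.cell w j n).vertices := by
  have hp := sqrt3_pos
  have hsub (c : Cell w) : c.vertices ⊆ {P1, P2, P3, P4} := by
    cases c with
    | tet a => exact subset_rfl
    | slab a h => simp only [Cell.vertices]; intro X; simp; tauto
  intro h
  have h := hsub _ h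
  obtain ⟨b1, b2, -⟩ := q12_arc ht
  obtain ⟨c1, c2, -⟩ := q23_arc ht
  have hn1 : Complex.normSq (1 + om) = 1 := by rw [normSq_add_om]; simp
  have key (q : ℂ × ℝ) (hq : (q : Hbar) ∈ ({P1, P2, P3, P4} : Set Hbar)) :
      q = (1, Real.sqrt 3) ∨ q.1 = -om ∨ q = (0, 0) := by
    rcases hq with h | h | h | h
    · exact Or.inl (OnePoint.coe_injective h)
    · exact Or.inr (Or.inl (congrArg Prod.fst (OnePoint.coe_injective h :)))
    · exact Or.inr (Or.inr (OnePoint.coe_injective h))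
    · exact absurd h (OnePoint.coe_ne_infty _)
  have k12 : ¬ (q12 t = (1, Real.sqrt 3) ∨ (q12 t).1 = -om ∨ q12 t = (0, 0)) := by
    rintro (h | h | h)
    · rw [h] at b2; simp only [hn1] at b2; exact lt_irrefl _ b2
    · exact q12_ne ht h
    · rw [h] at b1; simp at b1
  match x with
  | p14 =>
    rcases key _ h with h | h | h
    · exact ht.ne' (congrArg Prod.snd h)
    · exact one_ne_neg_om h
    · exact one_ne_zero (congrArg Prod.fst h)
  | p12 i => exact k12 (key _ h)
  | sl i => exact k12 (key _ h)
  | p23 =>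
    rcases key _ h with h | h | h
    · change q23 t = _ at h; rw [h] at c2; simp only [hn1] at c2; exact lt_irrefl _ c2
    · exact q23_ne t h
    · change q23 t = _ at h; rw [h] at c2; simp [normSq_om] at c2
  | p34 i =>
    rcases key _ h with h | h | h
    · exact zero_ne_one (congrArg Prod.fst h)
    · exact zero_ne_neg_om h
    · have := congrArg Prod.snd h
      simp only [base, q34] at this; linarith

end Corner

namespace EdgeWord

variable {w : ZMod m → Flip} {j : ZMod m} {n : ℕ}

/-- If positions `a < b` coincided modulo `m`, the closing `L` at distance `n + 1 - b` after `b`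
would also occur at that distance after `a`, among the letters `R`. -/
lemma index_inj (hw : EdgeWord w j n) {a b : ℕ} (ha : 1 ≤ a) (ha' : a ≤ n + 1) (hb : 1 ≤ b) (hb' : b ≤ n + 1)
    (h : j + (a : ZMod m) = j + (b : ZMod m)) : a = b := by
  have key (a b : ℕ) (ha : 1 ≤ a) (hb' : b ≤ n + 1)
      (h : j + (a : ZMod m) = j + (b : ZMod m)) : ¬ a < b := by
    intro hlt
    have h1 := hw.mid (a + (n + 1 - b)) (by omega) (by omega)
    have h2 : j + ((a + (n + 1 - b) : ℕ) : ZMod m) = j + ((n + 1 : ℕ) : ZMod m) := by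
      rw [Nat.cast_add, ← add_assoc, h, add_assoc, ← Nat.cast_add]; congr 2; omega
    rw [h2, hw.last] at h1
    cases h1
  exact le_antisymm (not_lt.mp (key b a hb ha' h.symm)) (not_lt.mp (key a b ha hb' h))

lemma index_sub_one (j : ZMod m) (d : ℕ) : j + ((d + 1 : ℕ) : ZMod m) - 1 = j + (d : ℕ) :=
    by push_cast; ring

lemma index_add_one (j : ZMod m) (d : ℕ) : j + (d : ZMod m) + 1 = j + ((d + 1 : ℕ) : ZMod m) :=
    by push_cast; ring

lemma cell_sl (hw : EdgeWord w j n) {i : ℕ} (hi : i < n) :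
    (sl i).cell w j n = .slab _ (hw.mid (i + 1) (by omega) (by omega)) :=
  dif_pos (hw.mid (i + 1) (by omega) (by omega))

/-- A tetrahedron can occur at several corners, but the points on its edges (14), (12), (23), (34)
are different; corners of the same kind are distinguished by `index_inj`. -/
lemma base_inj (hw : EdgeWord w j n) {t : ℝ} (ht : Real.sqrt 3 < t) {x y : Corner} (hx : x.Valid n) (hy : y.Valid n)
    (h1 : x.cell w j n = y.cell w j n) (h2 : x.base t = y.base t) : x = y := by
  obtain ⟨b1, b2, b3⟩ := q12_arc ht
  obtain ⟨c1, c2, c3⟩ := q23_arc ht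
  have hn1 : Complex.normSq (1 + om) = 1 := by rw [normSq_add_om]; simp
  have n1 : q14 t ≠ q12 t := fun h => by
    rw [← h] at b2; simp only [q14, hn1] at b2; exact lt_irrefl _ b2
  have n2 : q14 t ≠ q23 t := fun h => by
    rw [← h] at c2; simp only [q14, hn1] at c2; exact lt_irrefl _ c2
  have n3 : q14 t ≠ q34 t := fun h => one_ne_zero (congrArg Prod.fst h)
  have n4 : q12 t ≠ q23 t := fun h => by rw [← h] at c1; linarith
  have n5 : q12 t ≠ q34 t := fun h => by rw [h] at b1; simp [q34] at b1
  have n6 : q23 t ≠ q34 t := fun h => by rw [h] at c2; simp [q34, normSq_om] at c2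
  have hidx (a b : ℕ) (ha : a ≤ n) (hb : b ≤ n)
      (h : j + ((a + 1 : ℕ) : ZMod m) = j + ((b + 1 : ℕ) : ZMod m)) : a = b := by
    have := hw.index_inj (by omega) (by omega) (by omega) (by omega) h
    omega
  cases x <;> cases y <;> simp only [Corner.base] at h2 <;>
    first
    | rfl
    | exact absurd h2 n1
    | exact absurd h2 n2
    | exact absurd h2 n3
    | exact absurd h2 n4
    | exact absurd h2 n5
    | exact absurd h2 n6
    | exact absurd h2.symm n1
    | exact absurd h2.symm n2
    | exact absurd h2.symm n3
    | exact absurd h2.symm n4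
    | exact absurd h2.symm n5
    | exact absurd h2.symm n6
    | skip
  · rw [hidx _ _ hx hy (Cell.tet.inj h1)]
  · rw [hw.cell_sl hy] at h1; cases h1
  · rw [hw.cell_sl hx] at h1; cases h1
  · rw [hw.cell_sl hx, hw.cell_sl hy] at h1
    rw [hidx _ _ (le_of_lt hx) (le_of_lt hy) (Cell.slab.inj h1)]
  · rw [hidx _ _ hx hy (Cell.tet.inj h1)]

lemma body (hw : EdgeWord w j n) {t : ℝ} (ht : Real.sqrt 3 < t) {x : Corner} (hx : x.Valid n) :
    ∀ᶠ y : ℂ × ℝ in 𝓝 (x.base t), ((y : Hbar) ∈ (x.cell w j n).body ↔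
      0 ≤ (zval (x.dev n) (x.lo n) y).im ∧ (zval (x.dev n) ((x.next n).lo n) y).im ≤ 0) := by
  have e (i : ℕ) (hi : i ≤ n) : ((p12 i).next n).lo n = rot i gm := by
    simp only [next]
    split_ifs with h
    · rfl
    · have : i = n := by omega
      subst this; rfl
  match x with
  | p14 => exact body_14 j ht
  | p12 0 =>
    rw [e 0 hx]
    exact body_12A (by rw [index_sub_one]; simpa using hw.first) ht
  | p12 (i + 1) =>
    rw [e _ hx]
    simp only [Valid] at hx
    exact body_12B (by rw [index_sub_one]; exact hw.mid _ (by omega) (by omega)) ht i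
  | sl i =>
    rw [hw.cell_sl hx]
    exact body_slab _ ht i
  | p23 => exact body_23 (by rw [index_sub_one]; exact hw.last) ht n
  | p34 0 =>
    have := body_34 (w := w) (j + (0 + 1 : ℕ)) ht 0
    simp only [next, lo, Corner.dev, base, Corner.cell]
    simpa only [rotM_zero, one_mul, zval_dev34_g0] using this
  | p34 (i + 1) =>
    have := body_34 (w := w) (j + (i + 1 + 1 : ℕ)) ht (i + 1)
    simp only [next, lo, Corner.dev, base, Corner.cell, zval_dev34_succ]
    exact this

end EdgeWord

end

section

/-! ### The face pairings around an edge -/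

variable {m : ℕ} {w : ZMod m → Flip}

lemma FacePairing.tet_out {a : ZMod m} {d : Cell w} {F : Set Hbar} {G : Hbar → Hbar}
    (h : FacePairing w (.tet a) d F G) :
    (w a = Flip.L ∧ d = .tet (a + 1) ∧ F = triMinus P4 P3 P1 ∧ G = crMap G1) ∨
    (w a = Flip.L ∧ d = .tet (a + 1) ∧ F = triMinus P4 P1 P2 ∧ G = crMap G2) ∨
    (w a = Flip.R ∧ d = .tet (a + 1) ∧ F = triMinus P4 P3 P1 ∧ G = crMap G3) ∨
    (∃ h : w a = Flip.R, d = .slab a h ∧ F = triMinus P4 P1 P2 ∧ G = crMap 1) := by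
  cases h with
  | l134 _ h => exact Or.inl ⟨h, rfl, rfl, rfl⟩
  | l124 _ h => exact Or.inr (Or.inl ⟨h, rfl, rfl, rfl⟩)
  | r134 _ h => exact Or.inr (Or.inr (Or.inl ⟨h, rfl, rfl, rfl⟩))
  | r124 _ h => exact Or.inr (Or.inr (Or.inr ⟨h, rfl, rfl, rfl⟩))

lemma FacePairing.slab_out {a : ZMod m} {ha : w a = Flip.R} {d : Cell w} {F : Set Hbar}
    {G : Hbar → Hbar} (h : FacePairing w (.slab a ha) d F G) :
    (d = .tet (a + 1) ∧ F = triPlus P4 P1 P2 ∧ G = crMap G4) ∨ F = bigonB := by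
  cases h with
  | s124 _ h => exact Or.inl ⟨rfl, rfl, rfl⟩
  | bigon _ n h hL hR => exact Or.inr rfl

/-- The target index is a variable `b` with an equation so that case analysis can unify it with the
`j + 1` of the constructors. -/
lemma FacePairing.tet_in {a b : ZMod m} (hab : b = a + 1) {d : Cell w} {F : Set Hbar}
    {G : Hbar → Hbar} (h : FacePairing w d (.tet b) F G) :
    (w a = Flip.L ∧ d = .tet a ∧ F = triMinus P4 P3 P1 ∧ G = crMap G1) ∨
    (w a = Flip.L ∧ d = .tet a ∧ F = triMinus P4 P1 P2 ∧ G = crMap G2) ∨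
    (w a = Flip.R ∧ d = .tet a ∧ F = triMinus P4 P3 P1 ∧ G = crMap G3) ∨
    (∃ h : w a = Flip.R, d = .slab a h ∧ F = triPlus P4 P1 P2 ∧ G = crMap G4) := by
  cases h with
  | l134 c h => cases add_right_cancel hab; exact Or.inl ⟨h, rfl, rfl, rfl⟩
  | l124 c h => cases add_right_cancel hab; exact Or.inr (Or.inl ⟨h, rfl, rfl, rfl⟩)
  | r134 c h => cases add_right_cancel hab; exact Or.inr (Or.inr (Or.inl ⟨h, rfl, rfl, rfl⟩))
  | s124 c h => cases add_right_cancel hab; exact Or.inr (Or.inr (Or.inr ⟨h, rfl, rfl, rfl⟩))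

lemma FacePairing.slab_in {a : ZMod m} {ha : w a = Flip.R} {d : Cell w} {F : Set Hbar}
    {G : Hbar → Hbar} (h : FacePairing w d (.slab a ha) F G) :
    (d = .tet a ∧ F = triMinus P4 P1 P2 ∧ G = crMap 1) ∨
    (F = bigonB ∧ ∃ n : ℕ, G = crMap (G2 ^ n * G3)) := by
  cases h with
  | r124 _ h => exact Or.inl ⟨rfl, rfl, rfl⟩
  | bigon _ n h hL hR => exact Or.inr ⟨rfl, n, rfl⟩

/-- A sheet condition on a face is transported by the face pairing. -/
lemma eventually_onSheet_image {A B M : Matrix (Fin 3) (Fin 3) ℂ} (hB : IsUnit21 B)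
    (hM : IsUnit21 M) (h : crMap A = crMap B ∘ crMap M) {qa qb : ℂ × ℝ} {t : ℝ}
    (ha : crMap A qa = pt 0 t) (hb : crMap B qb = pt 0 t) {F : Set Hbar} {γ : ℂ × ℝ → ℂ}
    (hF : ∀ᶠ y : ℂ × ℝ in 𝓝 qa, ((y : Hbar) ∈ F → OnSheet γ (cm A y))) :
    ∀ᶠ y : ℂ × ℝ in 𝓝 qb, ((y : Hbar) ∈ crMap M '' F → OnSheet γ (cm B y)) := by
  have hq : crMap M qa = (qb : Hbar) := by
    apply hB.crMap_injective
    rw [hb, ← ha, h]; rfl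
  have hq' : crMap (uinv M) qb = (qa : Hbar) := by rw [← hq, hM.crMap_uinv_crMap]
  have hd := den_ne_zero hq'
  have ht : Tendsto (cm (uinv M)) (𝓝 qb) (𝓝 qa) := by
    have := continuousAt_cm hd
    rwa [ContinuousAt, cm_eq hq'] at this
  filter_upwards [ht.eventually hF, eventually_den_ne hd,
    eventually_den_ne (den_ne_zero (Y := (0, t)) hb)] with y h1 h2 h3
  rintro ⟨X, hX, hXy⟩
  have e : crMap (uinv M) y = X := by rw [← hXy, hM.crMap_uinv_crMap]
  rw [crMap_coe h2] at e
  have h4 := h1 (e ▸ hX)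
  have e2 : crMap A (cm (uinv M) y) = (cm B y : Hbar) := by
    rw [e, h, Function.comp_apply, hXy, crMap_coe h3]
  rwa [cm_eq e2] at h4

open Corner

/-- The matrix `M` realises a face pairing from a face `F` of the corner `x` to a face of the next
corner, along the sheet between the two. -/
structure FwdLink (w : ZMod m → Flip) (j : ZMod m) (n : ℕ) (t : ℝ) (x : Corner) (F : Set Hbar)
    (M : Matrix (Fin 3) (Fin 3) ℂ) : Prop where
  unit : IsUnit21 M
  pair : FacePairing w (x.cell w j n) ((x.next n).cell w j n) F (crMap M)
  dev : crMap (x.dev n) = crMap ((x.next n).dev n) ∘ crMap M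
  sheet : ∀ᶠ y : ℂ × ℝ in 𝓝 (x.base t),
    ((y : Hbar) ∈ F ↔ OnSheet ((x.next n).lo n) (cm (x.dev n) y))

/-- The matrix `M` realises a face pairing from a face `F` of the corner after `x` to a face of
`x`, along the sheet between the two. -/
structure BwdLink (w : ZMod m → Flip) (j : ZMod m) (n : ℕ) (t : ℝ) (x : Corner) (F : Set Hbar)
    (M : Matrix (Fin 3) (Fin 3) ℂ) : Prop where
  unit : IsUnit21 M
  pair : FacePairing w ((x.next n).cell w j n) (x.cell w j n) F (crMap M)
  dev : crMap ((x.next n).dev n) = crMap (x.dev n) ∘ crMap M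
  sheet : ∀ᶠ y : ℂ × ℝ in 𝓝 ((x.next n).base t),
    ((y : Hbar) ∈ F ↔ OnSheet ((x.next n).lo n) (cm ((x.next n).dev n) y))

/-- The corners `x` and `z` are adjacent along a sheet, on which the point `Y` lies. -/
def Corner.Adj (n : ℕ) (x z : Corner) (Y : ℂ × ℝ) : Prop :=
  x.next n = z ∧ OnSheet (z.lo n) Y ∨ z.next n = x ∧ OnSheet (x.lo n) Y

/-- The cell `d`, at the point `y` of the corner `x`, is that of an adjacent corner. -/
def Corner.IsOut (w : ZMod m → Flip) (j : ZMod m) (n : ℕ) (x : Corner) (y : ℂ × ℝ) (d : Cell w)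
    (G : Hbar → Hbar) : Prop :=
  ∃ z : Corner, z.Valid n ∧ d = z.cell w j n ∧ crMap (x.dev n) = crMap (z.dev n) ∘ G ∧
    x.Adj n z (cm (x.dev n) y)

/-- The cell `d`, paired to the corner `x` at the point `y`, is that of an adjacent corner. -/
def Corner.IsInn (w : ZMod m → Flip) (j : ZMod m) (n : ℕ) (x : Corner) (y : ℂ × ℝ) (d : Cell w)
    (G : Hbar → Hbar) : Prop :=
  ∃ z : Corner, z.Valid n ∧ d = z.cell w j n ∧ crMap (z.dev n) = crMap (x.dev n) ∘ G ∧
    x.Adj n z (cm (x.dev n) y)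

variable {j : ZMod m} {n : ℕ} {t : ℝ} {x : Corner} {F : Set Hbar}
  {M : Matrix (Fin 3) (Fin 3) ℂ}

/-- A link controls pairings at both of its corners: a forward one is outgoing at `x` and incoming
at the next corner, a backward one the reverse. -/
lemma FwdLink.isOut (h : FwdLink w j n t x F M) (hx : x.Valid n) :
    ∀ᶠ y : ℂ × ℝ in 𝓝 (x.base t),
      ((y : Hbar) ∈ F → x.IsOut w j n y ((x.next n).cell w j n) (crMap M)) := by
  filter_upwards [h.sheet] with y hy hF
  exact ⟨_, valid_next hx, rfl, h.dev, Or.inl ⟨rfl, hy.mp hF⟩⟩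

lemma BwdLink.isOut (h : BwdLink w j n t x F M) (hx : x.Valid n) :
    ∀ᶠ y : ℂ × ℝ in 𝓝 ((x.next n).base t),
      ((y : Hbar) ∈ F → (x.next n).IsOut w j n y (x.cell w j n) (crMap M)) := by
  filter_upwards [h.sheet] with y hy hF
  exact ⟨_, hx, rfl, h.dev, Or.inr ⟨rfl, hy.mp hF⟩⟩

lemma FwdLink.isInn (h : FwdLink w j n t x F M) (ht : Real.sqrt 3 < t) (hx : x.Valid n) :
    ∀ᶠ y : ℂ × ℝ in 𝓝 ((x.next n).base t),
      ((y : Hbar) ∈ crMap M '' F → (x.next n).IsInn w j n y (x.cell w j n) (crMap M)) := by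
  filter_upwards [eventually_onSheet_image (isUnit21_dev n _) h.unit h.dev (crMap_dev ht n x)
    (crMap_dev ht n _) (h.sheet.mono fun _ => Iff.mp)] with y hy hF
  exact ⟨_, hx, rfl, h.dev, Or.inr ⟨rfl, hy hF⟩⟩

lemma BwdLink.isInn (h : BwdLink w j n t x F M) (ht : Real.sqrt 3 < t) (hx : x.Valid n) :
    ∀ᶠ y : ℂ × ℝ in 𝓝 (x.base t),
      ((y : Hbar) ∈ crMap M '' F → x.IsInn w j n y ((x.next n).cell w j n) (crMap M)) := by
  filter_upwards [eventually_onSheet_image (isUnit21_dev n _) h.unit h.dev (crMap_dev ht n _)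
    (crMap_dev ht n _) (h.sheet.mono fun _ => Iff.mp)] with y hy hF
  exact ⟨_, valid_next hx, rfl, h.dev, Or.inl ⟨rfl, hy hF⟩⟩

namespace EdgeWord

lemma fwd_p14 (hw : EdgeWord w j n) (ht : Real.sqrt 3 < t) :
    FwdLink w j n t p14 (triMinus P4 P3 P1) G1 where
  unit := isUnit21_G1
  pair := by
    have := FacePairing.l134 j hw.first
    simpa [next, Corner.cell] using this
  dev := by simpa [next, Corner.dev, rotM_zero] using devT_eq_12
  sheet := sheet_F134_14 ht

lemma fwd_p12 (hw : EdgeWord w j n) (ht : Real.sqrt 3 < t) {i : ℕ} (hi : i < n) :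
    FwdLink w j n t (p12 i) (triMinus P4 P1 P2) 1 := by
  have e : (p12 i).next n = sl i := if_pos hi
  refine ⟨isUnit21_one, ?_, ?_, ?_⟩ <;> rw [e]
  · rw [hw.cell_sl hi]
    exact FacePairing.r124 _ _
  · funext X
    rw [Function.comp_apply, crMap_one]; rfl
  · exact sheet_F124_12 ht i

lemma fwd_p12_last (hw : EdgeWord w j n) (ht : Real.sqrt 3 < t) :
    FwdLink w j n t (p12 n) (triMinus P4 P1 P2) G2 := by
  have e : (p12 n).next n = p23 := if_neg (lt_irrefl _)
  refine ⟨isUnit21_G2, ?_, ?_, ?_⟩ <;> rw [e]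
  · have := FacePairing.l124 _ hw.last
    rwa [index_add_one] at this
  · exact crMap_rot_comp isUnit21_dev23 isUnit21_dev12 dev12_eq_23 n
  · exact sheet_F124_12 ht n

lemma fwd_sl (hw : EdgeWord w j n) (ht : Real.sqrt 3 < t) {i : ℕ} (hi : i < n) :
    FwdLink w j n t (sl i) (triPlus P4 P1 P2) G4 where
  unit := isUnit21_G4
  pair := by
    rw [hw.cell_sl hi]
    have := FacePairing.s124 _ (hw.mid (i + 1) (by omega) (by omega))
    rwa [index_add_one] at this
  dev := rot_dev12_succ i
  sheet := sheet_low_12 ht i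

lemma bwd_p23 (hw : EdgeWord w j n) (ht : Real.sqrt 3 < t) :
    BwdLink w j n t p23 (triMinus P4 P3 P1) G1 where
  unit := isUnit21_G1
  pair := by
    have := FacePairing.l134 _ hw.last
    rwa [index_add_one] at this
  dev := crMap_rot_comp isUnit21_dev23 isUnit21_dev34 dev34_eq_23 n
  sheet := sheet_F134_34 ht n

lemma bwd_p34 (hw : EdgeWord w j n) (ht : Real.sqrt 3 < t) {i : ℕ} (hi : i < n) :
    BwdLink w j n t (p34 (i + 1)) (triMinus P4 P3 P1) G3 where
  unit := isUnit21_G3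
  pair := by
    have := FacePairing.r134 _ (hw.mid (i + 1) (by omega) (by omega))
    rwa [index_add_one] at this
  dev := rot_dev34_succ i
  sheet := sheet_F134_34 ht i

lemma bwd_p34_zero (hw : EdgeWord w j n) (ht : Real.sqrt 3 < t) :
    BwdLink w j n t (p34 0) (triMinus P4 P1 P2) G2 where
  unit := isUnit21_G2
  pair := by
    have := FacePairing.l124 j hw.first
    simpa [next, Corner.cell] using this
  dev := by simpa [next, Corner.dev, rotM_zero] using devT_eq_34
  sheet := sheet_F124_14 ht

/-- Each pairing starting at the cell is excluded by the letter, or starts from a face that misses a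
neighbourhood of the edge point, or is a link to an adjacent corner. The corner (14) has two
outgoing links and the corner (23) none. -/
lemma isOut (hw : EdgeWord w j n) (ht : Real.sqrt 3 < t) (hx : x.Valid n) :
    ∀ᶠ y : ℂ × ℝ in 𝓝 (x.base t), ∀ d F G, FacePairing w (x.cell w j n) d F G →
      (y : Hbar) ∈ F → x.IsOut w j n y d G := by
  match x with
  | p14 =>
    filter_upwards [(hw.fwd_p14 ht).isOut trivial, (hw.bwd_p34_zero ht).isOut (Nat.zero_le _)]
      with y h1 h2 d F G h hF
    rcases h.tet_out with ⟨-, rfl, rfl, rfl⟩ | ⟨-, rfl, rfl, rfl⟩ | ⟨h', -⟩ | ⟨h', -⟩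
    · simpa [next, Corner.cell] using h1 hF
    · simpa [next, Corner.cell] using h2 hF
    · rw [hw.first] at h'; cases h'
    · rw [hw.first] at h'; cases h'
  | p12 i =>
    rcases Nat.lt_or_ge i n with hi | hi
    · have hR := hw.mid (i + 1) (by omega) (by omega)
      filter_upwards [(hw.fwd_p12 ht hi).isOut hx, eventually_notMem_12 ht] with y h1 h2 d F G h hF
      rcases h.tet_out with ⟨h', -⟩ | ⟨h', -⟩ | ⟨-, rfl, rfl, rfl⟩ | ⟨h', rfl, rfl, rfl⟩
      · rw [hR] at h'; cases h'
      · rw [hR] at h'; cases h'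
      · exact absurd hF h2.1
      · have := h1 hF
        rwa [show (p12 i).next n = sl i from if_pos hi, hw.cell_sl hi] at this
    · obtain rfl : i = n := le_antisymm hx hi
      have hL := hw.last
      filter_upwards [(hw.fwd_p12_last ht).isOut hx, eventually_notMem_12 ht]
        with y h1 h2 d F G h hF
      rcases h.tet_out with ⟨-, rfl, rfl, rfl⟩ | ⟨-, rfl, rfl, rfl⟩ | ⟨h', -⟩ | ⟨h', -⟩
      · exact absurd hF h2.1
      · have := h1 hF
        rw [show (p12 i).next i = p23 from if_neg (lt_irrefl _)] at this
        rw [index_add_one]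
        exact this
      · rw [hL] at h'; cases h'
      · rw [hL] at h'; cases h'
  | sl i =>
    filter_upwards [(hw.fwd_sl ht hx).isOut hx, eventually_notMem_12 ht] with y h1 h2 d F G h hF
    rw [hw.cell_sl hx] at h
    rcases h.slab_out with ⟨rfl, rfl, rfl⟩ | rfl
    · rw [index_add_one]
      exact h1 hF
    · exact absurd hF h2.2.2.2.1
  | p23 =>
    filter_upwards [eventually_notMem_23 ht] with y h2 d F G h hF
    rcases h.tet_out with ⟨-, -, rfl, -⟩ | ⟨-, -, rfl, -⟩ | ⟨-, -, rfl, -⟩ | ⟨-, -, rfl, -⟩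
    · exact absurd hF h2.1
    · exact absurd hF h2.2
    · exact absurd hF h2.1
    · exact absurd hF h2.2
  | p34 i =>
    rcases Nat.lt_or_ge i n with hi | hi
    · have hR := hw.mid (i + 1) (by omega) (by omega)
      filter_upwards [(hw.bwd_p34 ht hi).isOut (show i + 1 ≤ n from hi), eventually_notMem_34 ht]
        with y h1 h2 d F G h hF
      rcases h.tet_out with ⟨h', -⟩ | ⟨h', -⟩ | ⟨-, rfl, rfl, rfl⟩ | ⟨h', rfl, rfl, rfl⟩
      · rw [hR] at h'; cases h'
      · rw [hR] at h'; cases h'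
      · rw [index_add_one]
        exact h1 hF
      · exact absurd hF h2.2.1
    · obtain rfl : i = n := le_antisymm hx hi
      have hL := hw.last
      filter_upwards [(hw.bwd_p23 ht).isOut trivial, eventually_notMem_34 ht]
        with y h1 h2 d F G h hF
      rcases h.tet_out with ⟨-, rfl, rfl, rfl⟩ | ⟨-, rfl, rfl, rfl⟩ | ⟨h', -⟩ | ⟨h', -⟩
      · rw [index_add_one]
        exact h1 hF
      · exact absurd hF h2.2.1
      · rw [hL] at h'; cases h'
      · rw [hL] at h'; cases h'

lemma isInn (hw : EdgeWord w j n) (ht : Real.sqrt 3 < t) (hx : x.Valid n) :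
    ∀ᶠ y : ℂ × ℝ in 𝓝 (x.base t), ∀ d F G, FacePairing w d (x.cell w j n) F G →
      (y : Hbar) ∈ G '' F → x.IsInn w j n y d G := by
  match x with
  | p14 =>
    filter_upwards [eventually_notMem_14 ht] with y h2 d F G h hF
    rcases h.tet_in (sub_add_cancel j 1).symm with
      ⟨-, -, rfl, rfl⟩ | ⟨-, -, rfl, rfl⟩ | ⟨-, -, rfl, rfl⟩ | ⟨-, -, rfl, rfl⟩
    · exact absurd hF h2.1
    · exact absurd hF h2.2.1
    · exact absurd hF h2.2.2.1
    · exact absurd hF h2.2.2.2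
  | p12 0 =>
    filter_upwards [(hw.fwd_p14 ht).isInn ht trivial, eventually_notMem_12 ht]
      with y h1 h2 d F G h hF
    rcases h.tet_in (a := j) (by simp) with
      ⟨-, rfl, rfl, rfl⟩ | ⟨-, -, rfl, rfl⟩ | ⟨h', -⟩ | ⟨h', -⟩
    · exact h1 hF
    · exact absurd hF h2.2.1
    · rw [hw.first] at h'; cases h'
    · rw [hw.first] at h'; cases h'
  | p12 (i + 1) =>
    have hi : i < n := hx
    have hR := hw.mid (i + 1) (by omega) (by omega)
    filter_upwards [(hw.fwd_sl ht hi).isInn ht hi, eventually_notMem_12 ht]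
      with y h1 h2 d F G h hF
    rcases h.tet_in (index_add_one j (i + 1)).symm with
      ⟨h', -⟩ | ⟨h', -⟩ | ⟨-, -, rfl, rfl⟩ | ⟨h', rfl, rfl, rfl⟩
    · rw [hR] at h'; cases h'
    · rw [hR] at h'; cases h'
    · exact absurd hF h2.2.2.1
    · have := h1 hF
      rwa [hw.cell_sl hi] at this
  | sl i =>
    have e : (p12 i).next n = sl i := if_pos hx
    have h1 := (hw.fwd_p12 ht hx).isInn ht (le_of_lt hx : i ≤ n)
    rw [e] at h1
    filter_upwards [h1, eventually_notMem_12 ht] with y h1 h2 d F G h hF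
    rw [hw.cell_sl hx] at h
    rcases h.slab_in with ⟨rfl, rfl, rfl⟩ | ⟨rfl, k, rfl⟩
    · exact h1 hF
    · exact absurd hF (h2.2.2.2.2 k)
  | p23 =>
    have e : (p12 n).next n = p23 := if_neg (lt_irrefl _)
    have hL := hw.last
    have h1 := (hw.fwd_p12_last ht).isInn ht (le_refl n)
    rw [e] at h1
    filter_upwards [h1, (hw.bwd_p23 ht).isInn ht trivial] with y h1 h2 d F G h hF
    rcases h.tet_in (index_add_one j (n + 1)).symm with
      ⟨-, rfl, rfl, rfl⟩ | ⟨-, rfl, rfl, rfl⟩ | ⟨h', -⟩ | ⟨h', -⟩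
    · exact h2 hF
    · exact h1 hF
    · rw [hL] at h'; cases h'
    · rw [hL] at h'; cases h'
  | p34 0 =>
    filter_upwards [(hw.bwd_p34_zero ht).isInn ht hx, eventually_notMem_34 ht]
      with y h1 h2 d F G h hF
    rcases h.tet_in (a := j) (by simp) with
      ⟨-, -, rfl, rfl⟩ | ⟨-, rfl, rfl, rfl⟩ | ⟨h', -⟩ | ⟨h', -⟩
    · exact absurd hF h2.1
    · exact h1 hF
    · rw [hw.first] at h'; cases h'
    · rw [hw.first] at h'; cases h'
  | p34 (i + 1) =>
    have hi : i < n := hx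
    have hR := hw.mid (i + 1) (by omega) (by omega)
    filter_upwards [(hw.bwd_p34 ht hi).isInn ht hx, eventually_notMem_34 ht]
      with y h1 h2 d F G h hF
    rcases h.tet_in (index_add_one j (i + 1)).symm with
      ⟨h', -⟩ | ⟨h', -⟩ | ⟨-, rfl, rfl, rfl⟩ | ⟨-, -, rfl, rfl⟩
    · rw [hR] at h'; cases h'
    · rw [hR] at h'; cases h'
    · exact h1 hF
    · exact absurd hF h2.2.2

lemma exists_link (hw : EdgeWord w j n) (ht : Real.sqrt 3 < t) (hx : x.Valid n) :
    (∃ F M, FwdLink w j n t x F M) ∨ ∃ F M, BwdLink w j n t x F M := by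
  match x with
  | p14 => exact Or.inl ⟨_, _, hw.fwd_p14 ht⟩
  | p12 i =>
    rcases Nat.lt_or_ge i n with hi | hi
    · exact Or.inl ⟨_, _, hw.fwd_p12 ht hi⟩
    · obtain rfl : i = n := le_antisymm hx hi
      exact Or.inl ⟨_, _, hw.fwd_p12_last ht⟩
  | sl i => exact Or.inl ⟨_, _, hw.fwd_sl ht hx⟩
  | p23 => exact Or.inr ⟨_, _, hw.bwd_p23 ht⟩
  | p34 0 => exact Or.inr ⟨_, _, hw.bwd_p34_zero ht⟩
  | p34 (i + 1) => exact Or.inr ⟨_, _, hw.bwd_p34 ht hx⟩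

end EdgeWord

end

/-! ### Assembling the cycle of corners around the edge -/

section

open Corner

variable {m : ℕ} {w : ZMod m → Flip} {j : ZMod m} {n : ℕ} {t : ℝ}

lemma Corner.next_iff {k l : ℕ} (hk : k < 3 * n + 4) (hl : l < 3 * n + 4) :
    (k + 1) % (3 * n + 4) = l ↔ (seq n k).next n = seq n l := by
  rw [← seq_succ hk]
  constructor
  · rintro rfl; rfl
  · intro h
    have := congrArg (idx n) h
    rwa [idx_seq (Nat.mod_lt _ (by omega)), idx_seq hl] at this

/-- The angles of the sheets around an edge. -/
def EdgeWord.angle (t : ℝ) (n k : ℕ) : ℝ :=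
  if k < 3 * n + 4 then (seq n k).ang t n else Real.pi / 2 + 2 * Real.pi * (n + 1 : ℕ)

lemma EdgeWord.angle_of_lt {k : ℕ} (hk : k < 3 * n + 4) :
    EdgeWord.angle t n k = (seq n k).ang t n := if_pos hk

lemma EdgeWord.angle_last : EdgeWord.angle t n (3 * n + 4) =
    Real.pi / 2 + 2 * Real.pi * (n + 1 : ℕ) := if_neg (lt_irrefl _)

lemma Corner.seq_last : seq n (3 * n + 3) = p34 0 :=
  seq_idx (x := p34 0) (Nat.zero_le _)

lemma Corner.seq_mod_of_lt {k : ℕ} (hk : k < 3 * n + 4) : seq n (k % (3 * n + 4)) = seq n k := by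
  rw [Nat.mod_eq_of_lt hk]

lemma Corner.cm_dev (ht : Real.sqrt 3 < t) (x : Corner) : cm (x.dev n) (x.base t) = (0, t) :=
  cm_eq (crMap_dev ht n x)

lemma EdgeWord.angle_succ (ht : Real.sqrt 3 < t) {k : ℕ} (hk : k < 3 * n + 4) :
    angle t n k < angle t n (k + 1) ∧ (angle t n (k + 1) < angle t n k + Real.pi ∨
      (seq n ((k + 1) % (3 * n + 4))).lo n = -(seq n k).lo n ∧
        angle t n (k + 1) = angle t n k + Real.pi) := by
  have hpi := Real.pi_pos
  rcases Nat.lt_or_ge (k + 1) (3 * n + 4) with h | h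
  · rw [seq_succ hk, angle_of_lt hk, angle_of_lt h, ← Nat.mod_eq_of_lt h, seq_succ hk]
    refine ang_next ht valid_seq fun h0 => ?_
    have := congrArg (idx n) h0
    rw [idx_seq hk] at this
    simp only [idx] at this
    omega
  · obtain rfl : k = 3 * n + 3 := by omega
    rw [angle_of_lt hk, angle_last, seq_last]
    simp only [ang]
    push_cast
    exact ⟨by linarith, Or.inl (by linarith)⟩

/-- The cells around an edge. -/
def EdgeWord.edgeCycle (hw : EdgeWord w j n) (ht : Real.sqrt 3 < t) :
    EdgeCycle w (3 * n + 4) (n + 1) t where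
  cell k := (seq n k).cell w j n
  D k := (seq n k).dev n
  q k := (seq n k).base t
  -- The multipliers are periodic in `k`, while the angles `b` go on increasing to the closing
  -- value, `n + 1` turns later.
  γ k := (seq n (k % (3 * n + 4))).lo n
  b := angle t n
  K_pos := by omega
  N_pos := by omega
  unit k _ := isUnit21_dev n _
  dev k _ := crMap_dev ht n _
  not_vertex k _ := base_notMem_vertices ht w j n _
  inj k hk l hl h1 h2 := by
    have := congrArg (idx n) (hw.base_inj ht valid_seq valid_seq h1 h2)
    rwa [idx_seq hk, idx_seq hl] at this
  γ_cont k _ := continuous_lo n _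
  γ_base k hk := by
    rcases hk.lt_or_eq with h | rfl
    · rw [seq_mod_of_lt h, angle_of_lt h]; exact lo_base ht n _
    · rw [Nat.mod_self, angle_last]
      obtain ⟨r, hr, h⟩ := lo_base ht n p14
      refine ⟨r, hr, h.trans ?_⟩
      have e : Complex.exp (-(((Real.pi / 2 + 2 * Real.pi * (n + 1 : ℕ) : ℝ) : ℂ) * Complex.I)) =
          Complex.exp (-((Real.pi / 2 : ℝ) * Complex.I)) := by
        rw [Complex.exp_eq_exp_iff_exists_int]
        refine ⟨-(n + 1), ?_⟩
        push_cast; ring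
      rw [e]; rfl
  b_lt k hk := (angle_succ ht hk).1
  b_width k hk := by
    rw [seq_mod_of_lt hk]
    exact (angle_succ ht hk).2.imp_right fun h => ⟨fun Y => congrFun h.1 Y, h.2⟩
  γ_last := by rw [Nat.mod_self, Nat.zero_mod]
  b_last := by rw [angle_last, angle_of_lt (by omega)]; rfl
  body k hk := by
    simp only [seq_succ hk, seq_mod_of_lt hk]
    exact hw.body ht valid_seq
  out k hk := by
    filter_upwards [hw.isOut ht (valid_seq (n := n) (k := k))] with y hy d F G h hF
    obtain ⟨z, hz, h1, h2, h3⟩ := hy d F G h hF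
    have hl := idx_lt hz
    refine ⟨z.idx n, hl, ?_, ?_, ?_⟩
    · rw [seq_idx hz]; exact h1
    · rw [seq_idx hz]; exact h2
    · rw [next_iff hk hl, next_iff hl hk, seq_mod_of_lt hk, seq_mod_of_lt hl, seq_idx hz]
      exact h3
  inn k hk := by
    filter_upwards [hw.isInn ht (valid_seq (n := n) (k := k))] with y hy d F G h hF
    obtain ⟨z, hz, h1, h2, h3⟩ := hy d F G h hF
    have hl := idx_lt hz
    refine ⟨z.idx n, hl, ?_, ?_, ?_⟩
    · rw [seq_idx hz]; exact h1
    · rw [seq_idx hz]; exact h2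
    · rw [next_iff hk hl, next_iff hl hk, seq_mod_of_lt hk, seq_mod_of_lt hl, seq_idx hz]
      exact h3
  link k hk l hl hkl := by
    rw [next_iff hk hl] at hkl
    simp only [seq_mod_of_lt hl, ← hkl]
    rcases hw.exists_link ht (valid_seq (n := n) (k := k)) with ⟨F, M, h⟩ | ⟨F, M, h⟩
    · exact Or.inl ⟨F, crMap M, h.pair, h.dev, h.sheet.mono fun _ => Iff.mpr⟩
    · exact Or.inr ⟨F, crMap M, h.pair, h.dev, h.sheet.mono fun _ => Iff.mpr⟩

lemma EdgeWord.hasBranchedChart (hw : EdgeWord w j n) (ht : Real.sqrt 3 < t) {p : Pts w}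
    (h1 : p.1 = .tet j) (h2 : p.2.1 = (q14 t : Hbar)) : HasBranchedChart w (proj w p) (n + 1) :=
  (hw.edgeCycle ht).hasBranchedChart (k := 0) (by omega) h1 h2

end

section

open Corner

/-! ### The valence of an edge -/

lemma Arc.im_le {e : ℂ} (h : Arc e) : 2 * e.im ≤ Real.sqrt 3 := by
  have h1 := h.re_ge
  have h2 := h.1
  rw [← abs_of_nonneg (show 0 ≤ 2 * e.im by linarith [h.2.1])]
  exact Real.abs_le_sqrt (by nlinarith)

lemma normSq_of_arc {e : ℂ} (h : Arc e) : Complex.normSq e = 1 := h.1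

lemma mem_edge_P1_P4 {q : ℂ × ℝ} : (q : Hbar) ∈ edge P1 P4 ↔ q.1 = 1 ∧ Real.sqrt 3 ≤ q.2 :=
  mem_edge_pt_P4

lemma mem_edge_P2_P4 {q : ℂ × ℝ} : (q : Hbar) ∈ edge P2 P4 ↔ q.1 = -om ∧ Real.sqrt 3 ≤ q.2 :=
  mem_edge_pt_P4

lemma mem_edge_P3_P4 {q : ℂ × ℝ} : (q : Hbar) ∈ edge P3 P4 ↔ q.1 = 0 ∧ 0 ≤ q.2 :=
  mem_edge_pt_P4

lemma mem_edge_P4_P1 {q : ℂ × ℝ} : (q : Hbar) ∈ edge P4 P1 ↔ q.1 = 1 ∧ q.2 ≤ Real.sqrt 3 :=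
  mem_edge_P4_pt

lemma mem_edge_P4_P2 {q : ℂ × ℝ} : (q : Hbar) ∈ edge P4 P2 ↔ q.1 = -om ∧ q.2 ≤ Real.sqrt 3 :=
  mem_edge_P4_pt

lemma of_mem_edge_P1_P2 {q : ℂ × ℝ} (h : (q : Hbar) ∈ edge P1 P2) :
    Complex.normSq q.1 = 1 ∧ q.2 = Real.sqrt 3 := by
  obtain ⟨e, he, h⟩ := mem_edge_P1_P2.mp h
  obtain ⟨h1, h2⟩ := pt_inj.mp ((coe_eq_pt q).symm.trans h)
  exact ⟨h1 ▸ he.1, h2⟩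

lemma of_mem_edge_P3_P1 {q : ℂ × ℝ} (h : (q : Hbar) ∈ edge P3 P1) :
    Complex.normSq (q.1 + om) = 1 ∧ q.2 ≤ Real.sqrt 3 ∧ (q.1 = 0 → q.2 = 0) := by
  obtain ⟨e, he, h⟩ := mem_edge_P3_P1.mp h
  obtain ⟨h1, h2⟩ := pt_inj.mp ((coe_eq_pt q).symm.trans h)
  refine ⟨?_, h2 ▸ he.im_le, fun h0 => ?_⟩
  · rw [h1, show om * (e - 1) + om = om * e by ring, Complex.normSq_mul, normSq_om,
      normSq_of_arc he, one_mul]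
  · rw [h0, eq_comm, mul_eq_zero, or_iff_right om_ne_zero, sub_eq_zero] at h1
    rw [h2, h1]; simp

lemma of_mem_edge_P3_P2 {q : ℂ × ℝ} (h : (q : Hbar) ∈ edge P3 P2) :
    Complex.normSq (q.1 - star om) = 1 ∧ q.2 ≤ Real.sqrt 3 ∧ (q.1 = 0 → q.2 = 0) := by
  obtain ⟨e, he, h⟩ := (mem_edge_P3 arc_neg_om.norm).mp h
  obtain ⟨h1, h2⟩ := pt_inj.mp ((coe_eq_pt q).symm.trans h)
  refine ⟨?_, h2 ▸ he.im_le, fun h0 => ?_⟩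
  · have : q.1 - star om = -(om * om * e) := by
      rw [h1, star_om]; linear_combination om_sq
    rw [this, Complex.normSq_neg, Complex.normSq_mul, Complex.normSq_mul, normSq_om,
      normSq_of_arc he]; norm_num
  · rw [h0, eq_comm, mul_eq_zero, mul_eq_zero, neg_eq_zero, or_self, or_iff_right om_ne_zero,
      sub_eq_zero] at h1
    rw [h2, h1]; simp

lemma normSq_one_add_om : Complex.normSq (1 + om) = 1 := by rw [normSq_add_om]; simp

variable {m : ℕ} {w : ZMod m → Flip} {j : ZMod m} {n : ℕ} {t : ℝ}

/-- The edge of a corner. -/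
def Corner.edge : Corner → Set Hbar
  | p14 => CRBundle.edge P1 P4
  | p12 _ => CRBundle.edge P1 P2
  | sl _ => CRBundle.edge P1 P2
  | p23 => CRBundle.edge P3 P2
  | p34 _ => CRBundle.edge P3 P4

lemma edge_P1_P2_eq : edge P1 P2 = crMap G1 '' edge P1 P4 := by
  rw [isUnit21_G1.edge_image (show P1 ≠ P4 from OnePoint.coe_ne_infty _), G1_P1, G1_P4]

lemma edge_P3_P2_eq : edge P3 P2 = crMap G1 '' edge P3 P4 := by
  rw [isUnit21_G1.edge_image (show P3 ≠ P4 from OnePoint.coe_ne_infty _), G1_P3, G1_P4]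

lemma exists_of_mem_edge_P1_P4 {X : Hbar} (hX : X ∈ edge P1 P4) (h1 : X ≠ P1) (h4 : X ≠ P4) :
    ∃ t, Real.sqrt 3 < t ∧ X = q14 t := by
  induction X using OnePoint.rec with
  | infty => exact absurd rfl h4
  | coe q =>
    obtain ⟨ha, hb⟩ := mem_edge_P1_P4.mp hX
    refine ⟨q.2, hb.lt_of_ne fun h => h1 ?_, ?_⟩
    · rw [coe_eq_pt, ha, ← h]; rfl
    · rw [coe_eq_pt, ha]; rfl

lemma exists_of_mem_edge_P3_P4 {X : Hbar} (hX : X ∈ edge P3 P4) (h3 : X ≠ P3) (h4 : X ≠ P4) :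
    ∃ t, Real.sqrt 3 < t ∧ X = q34 t := by
  induction X using OnePoint.rec with
  | infty => exact absurd rfl h4
  | coe q =>
    obtain ⟨ha, hb⟩ := mem_edge_P3_P4.mp hX
    have : 0 < q.2 := hb.lt_of_ne fun h => h3 (by rw [coe_eq_pt, ha, ← h]; rfl)
    refine ⟨q.2 + Real.sqrt 3, by linarith, ?_⟩
    rw [coe_eq_pt, ha, q34, add_sub_cancel_right]; rfl

namespace Corner

/-- The points of the edge of a corner, other than the vertices. -/
lemma exists_base (w : ZMod m → Flip) (j : ZMod m) {x : Corner} {X : Hbar} (hX : X ∈ x.edge)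
    (hx : x.Valid n) (hw : EdgeWord w j n) (hv : X ∉ (x.cell w j n).vertices) :
    ∃ t, Real.sqrt 3 < t ∧ X = x.base t := by
  have h12 (hX : X ∈ CRBundle.edge P1 P2) (h1 : X ≠ P1) (h2 : X ≠ P2) :
      ∃ t, Real.sqrt 3 < t ∧ X = q12 t := by
    rw [edge_P1_P2_eq] at hX
    obtain ⟨Y, hY, rfl⟩ := hX
    obtain ⟨t, ht, rfl⟩ := exists_of_mem_edge_P1_P4 hY
      (by rintro rfl; exact h1 G1_P1) (by rintro rfl; exact h2 G1_P4)
    exact ⟨t, ht, G1_q14 ht.le⟩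
  match x with
  | p14 =>
    exact exists_of_mem_edge_P1_P4 hX (fun h => hv (by simp [Corner.cell, Cell.vertices, h]))
      (fun h => hv (by simp [Corner.cell, Cell.vertices, h]))
  | p12 i =>
    exact h12 hX (fun h => hv (by simp [Corner.cell, Cell.vertices, h]))
      (fun h => hv (by simp [Corner.cell, Cell.vertices, h]))
  | sl i =>
    rw [hw.cell_sl hx] at hv
    exact h12 hX (fun h => hv (by simp [Cell.vertices, h])) (fun h => hv (by simp [Cell.vertices,
        h]))
  | p23 =>
    simp only [edge] at hX
    rw [edge_P3_P2_eq] at hX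
    obtain ⟨Y, hY, rfl⟩ := hX
    obtain ⟨t, ht, rfl⟩ := exists_of_mem_edge_P3_P4 hY
      (by rintro rfl; exact hv (by simp [Corner.cell, Cell.vertices, G1_P3]))
      (by rintro rfl; exact hv (by simp [Corner.cell, Cell.vertices, G1_P4]))
    exact ⟨t, ht, G1_q34 ht.le⟩
  | p34 i =>
    exact exists_of_mem_edge_P3_P4 hX (fun h => hv (by simp [Corner.cell, Cell.vertices, h]))
      (fun h => hv (by simp [Corner.cell, Cell.vertices, h]))

lemma base_mem_edge (ht : Real.sqrt 3 < t) (x : Corner) : (x.base t : Hbar) ∈ x.edge := by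
  have h14 : (q14 t : Hbar) ∈ CRBundle.edge P1 P4 := mem_edge_P1_P4.mpr ⟨rfl, ht.le⟩
  have h34 : (q34 t : Hbar) ∈ CRBundle.edge P3 P4 :=
    mem_edge_P3_P4.mpr ⟨rfl, sub_nonneg.mpr ht.le⟩
  have h12 : (q12 t : Hbar) ∈ CRBundle.edge P1 P2 := by
    rw [edge_P1_P2_eq]; exact ⟨_, h14, G1_q14 ht.le⟩
  match x with
  | p14 => exact h14
  | p12 i => exact h12
  | sl i => exact h12
  | p23 =>
    simp only [edge]
    rw [edge_P3_P2_eq]; exact ⟨_, h34, G1_q34 ht.le⟩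
  | p34 i => exact h34

lemma edge_mem_edges {x : Corner} (hw : EdgeWord w j n) (hx : x.Valid n) :
    x.edge ∈ (x.cell w j n).edges := by
  match x with
  | p14 => simp [Corner.cell, Cell.edges, Corner.edge]
  | p12 i => simp [Corner.cell, Cell.edges, Corner.edge]
  | sl i => rw [hw.cell_sl hx]; simp [Cell.edges, Corner.edge]
  | p23 => simp [Corner.cell, Cell.edges, Corner.edge]
  | p34 i => simp [Corner.cell, Cell.edges, Corner.edge]

/-- A point of the edge of a corner lies in no other edge of its cell. -/
lemma eq_edge_of_mem (ht : Real.sqrt 3 < t) {x : Corner} (hw : EdgeWord w j n) (hx : x.Valid n)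
    {E : Set Hbar} (hE : E ∈ (x.cell w j n).edges) (h : (x.base t : Hbar) ∈ E) : E = x.edge := by
  obtain ⟨b1, b2, b3⟩ := q12_arc ht
  obtain ⟨c1, c2, c3⟩ := q23_arc ht
  have n1 : (q12 t).1 ≠ 1 := fun h => by rw [h, normSq_one_add_om] at b2; exact lt_irrefl _ b2
  have n0 : (q12 t).1 ≠ 0 := fun h => by rw [h] at b1; simp at b1
  have hs := sqrt3_pos
  match x with
  | p14 =>
    rcases hE with rfl | rfl | rfl | rfl | rfl | rfl
    · exact absurd (of_mem_edge_P1_P2 h).2 ht.ne'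
    · exact absurd (of_mem_edge_P3_P1 h).2.1 ht.not_ge
    · rfl
    · exact absurd (of_mem_edge_P3_P2 h).2.1 ht.not_ge
    · exact absurd (mem_edge_P2_P4.mp h).1 one_ne_neg_om
    · exact absurd (mem_edge_P3_P4.mp h).1 one_ne_zero
  | p12 i =>
    rcases hE with rfl | rfl | rfl | rfl | rfl | rfl
    · rfl
    · exact absurd (of_mem_edge_P3_P1 h).1 b2.ne
    · exact absurd (mem_edge_P1_P4.mp h).1 n1
    · exact absurd (of_mem_edge_P3_P2 h).1 b3.ne'
    · exact absurd (mem_edge_P2_P4.mp h).1 (q12_ne ht)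
    · exact absurd (mem_edge_P3_P4.mp h).1 n0
  | sl i =>
    rw [hw.cell_sl hx] at hE
    rcases hE with rfl | rfl | rfl | rfl | rfl
    · rfl
    · exact absurd (mem_edge_P1_P4.mp h).1 n1
    · exact absurd (mem_edge_P2_P4.mp h).1 (q12_ne ht)
    · exact absurd (mem_edge_P4_P1.mp h).1 n1
    · exact absurd (mem_edge_P4_P2.mp h).1 (q12_ne ht)
  | p23 =>
    rcases hE with rfl | rfl | rfl | rfl | rfl | rfl
    · exact absurd (of_mem_edge_P1_P2 h).1 c1.ne
    · exact absurd (of_mem_edge_P3_P1 h).1 c2.ne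
    · refine absurd (mem_edge_P1_P4.mp h).1 fun h => ?_
      simp only [base] at h
      rw [h] at c1; simp at c1
    · rfl
    · exact absurd (mem_edge_P2_P4.mp h).1 (q23_ne t)
    · refine absurd (mem_edge_P3_P4.mp h).1 fun h => ?_
      simp only [base] at h
      rw [h] at c2; simp [normSq_om] at c2
  | p34 i =>
    rcases hE with rfl | rfl | rfl | rfl | rfl | rfl
    · exact absurd (of_mem_edge_P1_P2 h).1 (by simp [base, q34])
    · exact absurd ((of_mem_edge_P3_P1 h).2.2 rfl) (sub_pos.mpr ht).ne'
    · exact absurd (mem_edge_P1_P4.mp h).1 zero_ne_one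
    · exact absurd ((of_mem_edge_P3_P2 h).2.2 rfl) (sub_pos.mpr ht).ne'
    · exact absurd (mem_edge_P2_P4.mp h).1 zero_ne_neg_om
    · rfl

end Corner

/-! ### The fibre over a point of the edge, and the count of 1-cells -/

namespace EdgeWord

/-- The points of the cells that lie over the point at height `t` of the edge. -/
def Over (w : ZMod m → Flip) (j : ZMod m) (n : ℕ) (t : ℝ) (p : Pts w) : Prop :=
  ∃ x : Corner, x.Valid n ∧ p.1 = x.cell w j n ∧ p.2.1 = (x.base t : Hbar)

/-- The local statements `isOut` and `isInn`, evaluated at the edge points themselves, show that a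
face pairing leads from a corner point only to corner points at the same `t`. With `proj_point`, the
corner points form one full fibre of the projection. -/
lemma over_iff (hw : EdgeWord w j n) (ht : Real.sqrt 3 < t) {p q : Pts w} (h : Glue w p q) :
    Over w j n t p ↔ Over w j n t q := by
  obtain ⟨c, X, hX⟩ := p
  obtain ⟨d, Y, hY⟩ := q
  obtain ⟨F, G, hFG, hF, hG⟩ := h
  dsimp only at hFG hF hG
  constructor
  · rintro ⟨x, hx, h1, h2⟩
    dsimp only at h1 h2
    subst h1 h2
    obtain ⟨z, hz, h1, h2, -⟩ := (hw.isOut ht hx).self_of_nhds d F G hFG hF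
    refine ⟨z, hz, h1, (isUnit21_dev n z).crMap_injective ?_⟩
    change crMap (z.dev n) Y = _
    rw [crMap_dev ht, ← crMap_dev ht n x, h2, hG]; rfl
  · rintro ⟨x, hx, h1, h2⟩
    dsimp only at h1 h2
    subst h1 h2
    obtain ⟨z, hz, h1, h2, -⟩ := (hw.isInn ht hx).self_of_nhds c F G hFG ⟨X, hF, hG.symm⟩
    refine ⟨z, hz, h1, (isUnit21_dev n z).crMap_injective ?_⟩
    rw [crMap_dev ht, ← crMap_dev ht n x, h2, hG]; rfl

lemma over_iff_of_proj (hw : EdgeWord w j n) (ht : Real.sqrt 3 < t) {p q : Pts w}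
    (h : proj w p = proj w q) : Over w j n t p ↔ Over w j n t q := by
  have h' := Quot.eqvGen_exact h
  clear h
  induction h' with
  | rel p q h => exact hw.over_iff ht h
  | refl p => exact Iff.rfl
  | symm p q _ ih => exact ih.symm
  | trans p q r _ _ ih1 ih2 => exact ih1.trans ih2

lemma onSheet_base (γ : ℂ × ℝ → ℂ) : OnSheet γ (0, t) := by simp [OnSheet]

lemma base_mem_body (hw : EdgeWord w j n) (ht : Real.sqrt 3 < t) {x : Corner} (hx : x.Valid n) :
    (x.base t : Hbar) ∈ (x.cell w j n).body := by
  rw [(hw.body ht hx).self_of_nhds]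
  simp [zval, Corner.cm_dev ht]

/-- The point at height `t` on the edge, as a point of the corner `x`. -/
def point (hw : EdgeWord w j n) (ht : Real.sqrt 3 < t) {x : Corner} (hx : x.Valid n) : Pts w :=
  ⟨x.cell w j n, x.base t, hw.base_mem_body ht hx, base_notMem_vertices ht w j n x⟩

lemma proj_point_next (hw : EdgeWord w j n) (ht : Real.sqrt 3 < t) {x : Corner} (hx : x.Valid n) :
    proj w (hw.point ht (valid_next hx)) = proj w (hw.point ht hx) := by
  rcases hw.exists_link ht hx with ⟨F, M, h⟩ | ⟨F, M, h⟩
  · refine (Quot.sound ⟨F, crMap M, h.pair, ?_, ?_⟩).symm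
    · refine h.sheet.self_of_nhds.mpr ?_
      rw [Corner.cm_dev ht]; exact onSheet_base _
    · apply (isUnit21_dev n (x.next n)).crMap_injective
      have := congrFun h.dev (x.base t)
      rw [crMap_dev ht] at this
      exact (crMap_dev ht n _).trans this
  · refine Quot.sound ⟨F, crMap M, h.pair, ?_, ?_⟩
    · refine h.sheet.self_of_nhds.mpr ?_
      rw [Corner.cm_dev ht]; exact onSheet_base _
    · apply (isUnit21_dev n x).crMap_injective
      have := congrFun h.dev ((x.next n).base t)
      rw [crMap_dev ht] at this
      exact (crMap_dev ht n _).trans this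

lemma proj_point_seq (hw : EdgeWord w j n) (ht : Real.sqrt 3 < t) {k : ℕ} (hk : k < 3 * n + 4) :
    proj w (hw.point ht (valid_seq (n := n) (k := k))) =
      proj w (hw.point ht (x := p14) trivial) := by
  induction k with
  | zero => rfl
  | succ k ih =>
    have := seq_succ (n := n) (k := k) (by omega)
    rw [Nat.mod_eq_of_lt hk] at this
    refine Eq.trans ?_ ((hw.proj_point_next ht valid_seq).trans (ih (by omega)))
    congr 2

lemma proj_point (hw : EdgeWord w j n) (ht : Real.sqrt 3 < t) {x : Corner} (hx : x.Valid n) :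
    proj w (hw.point ht hx) = proj w (hw.point ht (x := p14) trivial) := by
  rw [← hw.proj_point_seq ht (idx_lt hx)]
  congr 2
  exact (seq_idx hx).symm

lemma imageOf_edge (hw : EdgeWord w j n) {x : Corner} (hx : x.Valid n) :
    imageOf w (x.cell w j n) x.edge = imageOf w (.tet j) (edge P1 P4) := by
  have key {x y : Corner} (hx : x.Valid n) (hy : y.Valid n) :
      imageOf w (x.cell w j n) x.edge ⊆ imageOf w (y.cell w j n) y.edge := by
    rintro _ ⟨⟨c, X, hX⟩, h1, h2, rfl⟩
    dsimp only at h1 h2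
    subst h1
    obtain ⟨t, ht, rfl⟩ := exists_base w j h2 hx hw hX.2
    exact ⟨hw.point ht hy, rfl, base_mem_edge ht y,
      (hw.proj_point ht hy).trans (hw.proj_point ht hx).symm⟩
  exact (key hx (y := p14) trivial).antisymm (key (x := p14) trivial hx)

lemma edge_injective (hw : EdgeWord w j n) {x y : Corner} (hx : x.Valid n) (hy : y.Valid n)
    (h1 : x.cell w j n = y.cell w j n) (h2 : x.edge = y.edge) : x = y := by
  -- Any parameter above `√3` would serve as a sample point; `2` is used.
  have ht : Real.sqrt 3 < 2 := by
    rw [Real.sqrt_lt' two_pos]; norm_num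
  obtain ⟨b1, b2, b3⟩ := q12_arc ht
  obtain ⟨c1, c2, c3⟩ := q23_arc ht
  have m12 : (q12 2 : Hbar) ∈ edge P1 P2 := base_mem_edge ht (p12 0)
  have m14 : (q14 2 : Hbar) ∈ edge P1 P4 := base_mem_edge ht p14
  have m34 : (q34 2 : Hbar) ∈ edge P3 P4 := base_mem_edge ht (p34 0)
  have n1 : edge P1 P4 ≠ edge P1 P2 := fun h => ht.ne' (of_mem_edge_P1_P2 (h ▸ m14)).2
  have n2 : edge P1 P4 ≠ edge P3 P2 := fun h => ht.not_ge (of_mem_edge_P3_P2 (h ▸ m14)).2.1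
  have n3 : edge P1 P4 ≠ edge P3 P4 := fun h => one_ne_zero (mem_edge_P3_P4.mp (h ▸ m14)).1
  have n4 : edge P1 P2 ≠ edge P3 P2 := fun h => b3.ne' (of_mem_edge_P3_P2 (h ▸ m12)).1
  have n5 : edge P3 P4 ≠ edge P1 P2 := fun h => by
    have := (of_mem_edge_P1_P2 (h ▸ m34 : (q34 2 : Hbar) ∈ edge P1 P2)).1
    rw [q34, map_zero] at this
    exact zero_ne_one this
  have n6 : edge P3 P4 ≠ edge P3 P2 := fun h =>
    (sub_pos.mpr ht).ne' ((of_mem_edge_P3_P2 (h ▸ m34)).2.2 rfl)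
  have hidx (a b : ℕ) (ha : a ≤ n) (hb : b ≤ n)
      (h : j + ((a + 1 : ℕ) : ZMod m) = j + ((b + 1 : ℕ) : ZMod m)) : a = b := by
    have := hw.index_inj (by omega) (by omega) (by omega) (by omega) h
    omega
  cases x <;> cases y <;> simp only [Corner.edge, n1, n2, n3, n4, n5, n6, n1.symm, n2.symm, n3.symm,
    n4.symm, n5.symm, n6.symm] at h2
  · rfl
  · rw [hidx _ _ hx hy (Cell.tet.inj h1)]
  · rw [hw.cell_sl hy] at h1; cases h1
  · rw [hw.cell_sl hx] at h1; cases h1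
  · rw [hw.cell_sl hx, hw.cell_sl hy] at h1
    rw [hidx _ _ (le_of_lt hx) (le_of_lt hy) (Cell.slab.inj h1)]
  · rfl
  · rw [hidx _ _ hx hy (Cell.tet.inj h1)]

/-- A 1-cell mapped onto `e_j` contains a point over the sample point `t = 2`. By saturation that
point is a corner point, and a corner point lies on only one edge of its cell. So the 1-cells are
those of the corners, pairwise distinct by `edge_injective`. -/
lemma valence_eq (hw : EdgeWord w j n) :
    valence w (imageOf w (.tet j) (edge P1 P4)) = 3 * n + 4 := by
  have ht : Real.sqrt 3 < 2 := by
    rw [Real.sqrt_lt' two_pos]; norm_num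
  have : {a : Cell w × Set Hbar | a.2 ∈ a.1.edges ∧
      imageOf w a.1 a.2 = imageOf w (.tet j) (edge P1 P4)} =
      (fun k => ((seq n k).cell w j n, (seq n k).edge)) '' (Finset.range (3 * n + 4) : Set ℕ) := by
    ext ⟨c, E⟩
    simp only [Set.mem_ofPred_eq, Set.mem_image, Finset.coe_range, Set.mem_Iio, Prod.mk.injEq]
    constructor
    · rintro ⟨hE, h⟩
      have h0 : proj w (hw.point ht (x := p14) trivial) ∈ imageOf w c E :=
        h ▸ ⟨hw.point ht (x := p14) trivial, rfl, base_mem_edge ht p14, rfl⟩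
      obtain ⟨p, rfl, hp, hpq⟩ := h0
      obtain ⟨x, hx, h1, h2⟩ := (hw.over_iff_of_proj ht hpq).mpr ⟨p14, trivial, rfl, rfl⟩
      refine ⟨x.idx n, idx_lt hx, ?_⟩
      rw [seq_idx hx]
      rw [h1] at hE
      rw [h2] at hp
      exact ⟨h1.symm, (eq_edge_of_mem ht hw hx hE hp).symm⟩
    · rintro ⟨k, hk, rfl, rfl⟩
      exact ⟨edge_mem_edges hw valid_seq, hw.imageOf_edge valid_seq⟩
  rw [valence, this, Set.InjOn.ncard_image, Set.ncard_coe_finset, Finset.card_range]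
  intro k hk l hl h
  rw [Finset.coe_range, Set.mem_Iio] at hk hl
  have := congrArg (idx n) (hw.edge_injective valid_seq valid_seq (Prod.ext_iff.mp h).1
    (Prod.ext_iff.mp h).2)
  rwa [idx_seq hk, idx_seq hl] at this

/-- The letters `R` following a letter `L`. -/
lemma exists_edgeWord [NeZero m] (hj : w j = Flip.L) : ∃ n, EdgeWord w j n := by
  classical
  have h : ∃ d : ℕ, w (j + ((d + 1 : ℕ) : ZMod m)) = Flip.L := by
    -- Going once around the cyclic word leads back to the `L` at `j`, so a next `L` exists.
    refine ⟨m - 1, ?_⟩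
    rw [Nat.sub_add_cancel (NeZero.one_le), ZMod.natCast_self, add_zero, hj]
  refine ⟨Nat.find h, hj, fun d hd hd' => ?_, Nat.find_spec h⟩
  have := Nat.find_min h (m := d - 1) (by omega)
  rw [Nat.sub_add_cancel hd] at this
  cases hd : w (j + d) with
  | R => rfl
  | L => exact absurd hd this

end EdgeWord

end

end CRBundle

end

theorem mainTheorem4 (f : Matrix.SpecialLinearGroup (Fin 2) ℤ)
    (hf : CRBundle.HasDistinctPositiveEigenvalues f)
    (m : ℕ) [NeZero m] (w : ZMod m → CRBundle.Flip) (hw : CRBundle.IsFlipSequence f w)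
    (j : ZMod m) (hj : w j = CRBundle.Flip.L) (n : ℕ)
    (hn : CRBundle.valence w
      (CRBundle.imageOf w (.tet j) (CRBundle.edge CRBundle.P1 CRBundle.P4)) = 3 * n + 4) :
    ∀ x ∈ CRBundle.imageOf w (.tet j) (CRBundle.edge CRBundle.P1 CRBundle.P4),
      CRBundle.IsRamificationOrder w x (n + 1) := by
  obtain ⟨r, hr⟩ := CRBundle.EdgeWord.exists_edgeWord hj
  -- The length of the run of `R`s after `j` is recovered from the valence.
  obtain rfl : r = n := by have := hr.valence_eq; omega
  rintro _ ⟨⟨c, X, hX⟩, h1, h2, rfl⟩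
  dsimp only at h1 h2
  subst h1
  obtain ⟨t, ht, rfl⟩ := CRBundle.exists_of_mem_edge_P1_P4 h2
    (fun h => hX.2 (by simp [CRBundle.Cell.vertices, h]))
    (fun h => hX.2 (by simp [CRBundle.Cell.vertices, h]))
  exact (hr.hasBranchedChart ht rfl rfl).isRamificationOrder
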